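/- **Network.** Let $N,M\ge 1$, $\nu,\alpha>0$, $\sigma_K\ge 0$, $K_{\mathrm{th}}>0$. Tier $n\in\{1,\dots,N\}$ has density $\lambda_n>0$, power $P_n>0$, lognormal shadowing $\mathcal X_n$ (dB mean $\mu_n$, dB standard deviation $\sigma_n\ge0$), antenna height $h_n>0$ and beamwidth $\theta_n>0$. Put $K_n=(h_n/h_0)^{\kappa_1}(\theta_n/\theta_0)^{\kappa_2}K_0$ with $h_0,\theta_0,K_0>0$ and $\kappa_1,\kappa_2\in\mathbb R$, $\Omega_n=P_n^{2/\nu}\,\mathbf E[\mathcal X_n^{2/\nu}]$, $\widetilde\lambda_n=\lambda_n\Omega_n$, $\lambda_T=\sum_n\widetilde\lambda_n$ and $\Lambda_n=\Omega_n/(\pi\lambda_T)$. In the equivalent unit-power formulation, the cells of tier $n$ form a homogeneous Poisson point process $\widetilde\Phi_n$ on $\mathbb R^2$ of density $\widetilde\lambda_n$, independent over $n$. A cell at $y\in\widetilde\Phi_n$ is received at the origin with power $\|y\|^{-\nu}$ and has K-factor $K_n\gamma\,\Omega_n^{-\alpha/2}\|y\|^{-\alpha}$, where the variables $\gamma$ of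 the cells are i.i.d. lognormal (dB mean $0$, dB standard deviation $\sigma_K$) and independent of the cell positions. The XLOS service probability $P_{\mathrm{XLOS}}(K_{\mathrm{th}})$ is the probability that at least one of the $M$ strongest cells has K-factor $>K_{\mathrm{th}}$. **H-functions.** For $c_1,\dots,c_M>0$, let $\mathcal C_m$ be the line $\Re\zeta=c_m$. All Fox H-functions are Mellin–Barnes integrals over such lines (on which the arguments of all Gamma functions in the numerator have positive real part). In particular $$\mathrm H^{0,1}_{1,1}\Big[x\,\Big|{(1,1)\atop(0,1)}\Big]=\frac1{2\pi j}\int_{\mathcal C}\frac{\Gamma(\zeta)}{\Gamma(1+\zeta)}x^{\zeta}\,d\zeta\qquad(x>0)$$ as a convergent improper integral, $\lim_{T\to\infty}\int_{c-jT}^{c+jT}$. For $x_1,\dots,x_M>0$ let $\mathcal H(x_1,\dots,x_M)$ be the $M$-variate Fox H-function $\mathrm H^{0,M:\,0,1;\dots;0,1}_{M,M-1:\,1,1;\dots;1,1}$ with outer upper parameters $\left(1-\frac{2i}\alpha;\mathbf 1_{1\le i},\dots,\mathbf 1_{M\le i}\right)_{1\le i\le M-1}$, $\left(1-M;\frac\alpha2,\dots,\frac\alpha2\right)$,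 outer lower parameters $\left(-\frac{2i}\alpha;\mathbf 1_{1\le i},\dots,\mathbf 1_{M\le i}\right)_{1\le i\le M-1}$, and inner parameters $(1,1)$ (upper) and $(0,1)$ (lower) in each variable, i.e. $$\mathcal H(x)=\frac1{(2\pi j)^M}\int_{\mathcal C_1}\!\!\cdots\!\int_{\mathcal C_M}\Gamma\Big(M+\tfrac\alpha2\sum_{m}\zeta_m\Big)\prod_{i=1}^{M-1}\frac{\Gamma\big(\frac{2i}\alpha+\sum_{m\le i}\zeta_m\big)}{\Gamma\big(1+\frac{2i}\alpha+\sum_{m\le i}\zeta_m\big)}\prod_{m=1}^M\frac{\Gamma(\zeta_m)}{\Gamma(1+\zeta_m)}x_m^{\zeta_m}\,d\zeta .$$ **Statement.** For $u\in\mathbb R^M$ put $\omega_m(u)=10^{\sqrt2\,\sigma_K u_m/10}$, and for $\mathbf n\in\{1,\dots,N\}^M$ let $$I_1(\mathbf n,u)=\int_{0\le z_1\le\dots\le z_M}\ \prod_{m=1}^M z_m^{2/\alpha-1}\,\mathrm H^{0,1}_{1,1}\Big[\tfrac{K_{\mathrm{th}}\Omega_{n_m}^{\alpha/2}z_m}{\omega_m(u)K_{n_m}}\Big|{(1,1)\atop(0,1)}\Big]\;e^{-\pi\lambda_Tz_M^{2/\alpha}}\,dz_1\cdots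 dz_M .$$ For all choices of the abscissas $c_m>0$ (which may differ between the one-variable and the $M$-variate functions): 1. For all $\mathbf n$ and $u$, the integral $I_1(\mathbf n,u)$ and the integral defining $\mathcal H$ at the point below converge absolutely, and $$I_1(\mathbf n,u)=\frac\alpha2(\pi\lambda_T)^{-M}\,\mathcal H\!\left(\frac{K_{\mathrm{th}}\Lambda_{n_1}^{\alpha/2}}{\omega_1(u)K_{n_1}},\dots,\frac{K_{\mathrm{th}}\Lambda_{n_M}^{\alpha/2}}{\omega_M(u)K_{n_M}}\right).$$ 2. For each $\mathbf n$, the function $u\mapsto e^{-|u|^2}I_1(\mathbf n,u)$ is integrable on $\mathbb R^M$, where $|u|^2=\sum_mu_m^2$, and $$P_{\mathrm{XLOS}}(K_{\mathrm{th}})=1-\Big(\frac{2\sqrt\pi}\alpha\Big)^M\sum_{\mathbf n}\prod_{m=1}^M\widetilde\lambda_{n_m}\int_{\mathbb R^M}e^{-|u|^2}I_1(\mathbf n,u)\,du .$$ 3. For every cubature rule $R$ on $\mathbb R^M$ with weights $w_1,\dots,w_L\in\mathbb R$ and nodes $u_1,\dots,u_L\in\mathbb R^M$, define $$P_R=1-\Big(\frac{2\sqrt\pi}\alpha\Big)^M\sum_{\mathbf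 n}\prod_{m=1}^M\widetilde\lambda_{n_m}\sum_{l=1}^Lw_l\,I_1(\mathbf n,u_l),$$ with $I_1(\mathbf n,u_l)$ given by the closed form in 1, so that $\omega_{l,m}=\omega_m(u_l)$. Then $$P_{\mathrm{XLOS}}(K_{\mathrm{th}})=P_R+\Big(\frac{2\sqrt\pi}\alpha\Big)^M\sum_{\mathbf n}\prod_{m=1}^M\widetilde\lambda_{n_m}\Big(\sum_{l=1}^Lw_lI_1(\mathbf n,u_l)-\int_{\mathbb R^M}e^{-|u|^2}I_1(\mathbf n,u)\,du\Big),$$ that is, $P_R$ differs from $P_{\mathrm{XLOS}}$ exactly by the contribution of the cubature error. 4. If $R_1,R_2,\dots$ are rules with nonnegative weights such that, for every $d$, all but finitely many $R_k$ integrate every polynomial of degree at most $d$ exactly against $e^{-|u|^2}$ on $\mathbb R^M$, then $P_{R_k}\to P_{\mathrm{XLOS}}(K_{\mathrm{th}})$. -/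

import Mathlib

open MeasureTheory ProbabilityTheory Filter Topology

namespace XLOS

/-! ## Fox H-functions as Mellin-Barnes integrals -/

/-- Gamma parameters of a one-variable Fox H-function `H^{m,n}_{p,q}`:
`upperN = (c_j, C_j)_{j ≤ n}`, `upperRest = (c_j, C_j)_{n < j ≤ p}`,
`lowerM = (d_j, D_j)_{j ≤ m}`, `lowerRest = (d_j, D_j)_{m < j ≤ q}`. -/
structure FoxParams where
  upperN : List (ℝ × ℝ)
  upperRest : List (ℝ × ℝ)
  lowerM : List (ℝ × ℝ)
  lowerRest : List (ℝ × ℝ)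

/-- The kernel
`φ(ζ) = ∏_{j≤m} Γ(d_j - D_j ζ) ∏_{j≤n} Γ(1 - c_j + C_j ζ) /
  (∏_{j>n} Γ(c_j - C_j ζ) ∏_{j>m} Γ(1 - d_j + D_j ζ))`. -/
noncomputable def FoxParams.phi (P : FoxParams) (ζ : ℂ) : ℂ :=
  ((P.lowerM.map fun q => Complex.Gamma ((q.1 : ℂ) - (q.2 : ℂ) * ζ)).prod *
    (P.upperN.map fun q => Complex.Gamma (1 - (q.1 : ℂ) + (q.2 : ℂ) * ζ)).prod) /
  ((P.upperRest.map fun q => Complex.Gamma ((q.1 : ℂ) - (q.2 : ℂ) * ζ)).prod *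
    (P.lowerRest.map fun q => Complex.Gamma (1 - (q.1 : ℂ) + (q.2 : ℂ) * ζ)).prod)

/-- The vertical line `Re ζ = c` runs strictly between the poles of the factors
`Γ(1 - c_j + C_j ζ)` and those of the factors `Γ(d_j - D_j ζ)` of the numerator. -/
def FoxParams.Separates (P : FoxParams) (c : ℝ) : Prop :=
  (∀ q ∈ P.upperN, 0 < 1 - q.1 + q.2 * c) ∧ (∀ q ∈ P.lowerM, 0 < q.1 - q.2 * c)

/-- The Mellin-Barnes integral `(1 / 2πj) ∫ φ(ζ) x^ζ dζ` over the segment from `c - jT` to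
`c + jT` (with `ζ = c + jt`, so that `dζ = j dt`). -/
noncomputable def FoxParams.truncH (P : FoxParams) (c : ℝ) (x : ℝ) (T : ℝ) : ℂ :=
  (1 / (2 * Real.pi) : ℂ) *
    ∫ t in (-T)..T, P.phi ((c : ℂ) + t * Complex.I) * (x : ℂ) ^ ((c : ℂ) + t * Complex.I)

/-- The one-variable Fox H-function at `x`, as an improper integral over the line `Re ζ = c`. -/
noncomputable def FoxParams.H (P : FoxParams) (c : ℝ) (x : ℝ) : ℂ :=
  limUnder atTop (P.truncH c x)

/-- Parameters of an `r`-variate Fox H-function with outer superscript `0, n`: the outer lists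
`(a_j; α_j^{(1)}, …, α_j^{(r)})_{j ≤ n}`, the same for `n < j ≤ p`,
`(b_j; β_j^{(1)}, …, β_j^{(r)})_{j ≤ q}`, and the inner parameters of each variable. -/
structure MultiFoxParams (r : ℕ) where
  outerN : List (ℝ × (Fin r → ℝ))
  outerRest : List (ℝ × (Fin r → ℝ))
  outerLower : List (ℝ × (Fin r → ℝ))
  inner : Fin r → FoxParams

variable {r : ℕ}

/-- `Ψ(ζ) = ∏_{j≤n} Γ(1 - a_j + ∑_i α_j^{(i)} ζ_i) /
  (∏_{j>n} Γ(a_j - ∑_i α_j^{(i)} ζ_i) ∏_j Γ(1 - b_j + ∑_i β_j^{(i)} ζ_i))`. -/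
noncomputable def MultiFoxParams.psi (Q : MultiFoxParams r) (ζ : Fin r → ℂ) : ℂ :=
  (Q.outerN.map fun q => Complex.Gamma (1 - (q.1 : ℂ) + ∑ i, (q.2 i : ℂ) * ζ i)).prod /
  ((Q.outerRest.map fun q => Complex.Gamma ((q.1 : ℂ) - ∑ i, (q.2 i : ℂ) * ζ i)).prod *
    (Q.outerLower.map fun q => Complex.Gamma (1 - (q.1 : ℂ) + ∑ i, (q.2 i : ℂ) * ζ i)).prod)

/-- The vertical lines `Re ζ_i = c i` are a legitimate contour: all Gamma factors in the
numerator have arguments of positive real part on it. -/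
def MultiFoxParams.Separates (Q : MultiFoxParams r) (c : Fin r → ℝ) : Prop :=
  (∀ q ∈ Q.outerN, 0 < 1 - q.1 + ∑ i, q.2 i * c i) ∧ ∀ i, (Q.inner i).Separates (c i)

/-- The integrand `Ψ(ζ) ∏_i φ_i(ζ_i) x_i^{ζ_i}` at `ζ_i = c i + j (t i)`. -/
noncomputable def MultiFoxParams.integrand (Q : MultiFoxParams r) (c x : Fin r → ℝ)
    (t : Fin r → ℝ) : ℂ :=
  Q.psi (fun i => (c i : ℂ) + t i * Complex.I) *
    ∏ i, ((Q.inner i).phi ((c i : ℂ) + t i * Complex.I) *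
      (x i : ℂ) ^ ((c i : ℂ) + t i * Complex.I))

/-- The multivariate Fox H-function at `x`, with contours `Re ζ_i = c i`:
`(1 / 2πj)^r ∫ ⋯ ∫ Ψ(ζ) ∏_i φ_i(ζ_i) x_i^{ζ_i} dζ_1 ⋯ dζ_r`. -/
noncomputable def MultiFoxParams.H (Q : MultiFoxParams r) (c x : Fin r → ℝ) : ℂ :=
  (1 / (2 * Real.pi) : ℂ) ^ r * ∫ t : Fin r → ℝ, Q.integrand c x t

/-! ## Point processes and the network model -/

section Processes

variable {Ω : Type*} [MeasurableSpace Ω]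

/-- Number of points of the (enumerated) point process `X` in `B`. -/
noncomputable def pointCount {E : Type*} (X : ℕ → Ω → E) (B : Set E) (ω : Ω) : ℕ∞ :=
  {i : ℕ | X i ω ∈ B}.encard

/-- The random points `X 0, X 1, …` form a Poisson point process with intensity measure `Λ`:
Poisson counts, independent over disjoint sets. -/
structure IsPoissonPointProcess {E : Type*} [MeasurableSpace E] (X : ℕ → Ω → E)
    (Λ : Measure E) (μ : Measure Ω) : Prop where
  measurable : ∀ i, Measurable (X i)
  hasLaw_count : ∀ B, MeasurableSet B → Λ B ≠ ⊤ →
    HasLaw (pointCount X B) ((poissonMeasure (Λ B).toNNReal).map (fun k : ℕ => (k : ℕ∞))) μ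
  indep_count : ∀ (k : ℕ) (B : Fin k → Set E), (∀ j, MeasurableSet (B j)) →
    Pairwise (fun i j => Disjoint (B i) (B j)) → iIndepFun (fun j => pointCount X (B j)) μ

end Processes

/-- Law of a lognormal variable whose decibel value `10 log₁₀ X` is normal with mean `m` and
standard deviation `s`. -/
noncomputable def lognormalDB (m s : ℝ) : Measure ℝ :=
  (gaussianReal m (s ^ 2).toNNReal).map (fun t => (10 : ℝ) ^ (t / 10))

/-- Parameters of an `N`-tier network. -/
structure Network (N : ℕ) where
  /-- deployment densities -/
  lam : Fin N → ℝ
  /-- transmit powers -/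
  power : Fin N → ℝ
  /-- antenna heights -/
  height : Fin N → ℝ
  /-- antenna beamwidths -/
  beam : Fin N → ℝ
  /-- shadowing means (dB) -/
  shadowMean : Fin N → ℝ
  /-- shadowing standard deviations (dB) -/
  shadowSd : Fin N → ℝ
  /-- path-loss exponent -/
  nu : ℝ
  /-- distance exponent of the K-factor -/
  alpha : ℝ
  height0 : ℝ
  beam0 : ℝ
  kappa1 : ℝ
  kappa2 : ℝ
  K0 : ℝ
  /-- standard deviation (dB) of the lognormal K-factor variations -/
  sigmaK : ℝ
  lam_pos : ∀ n, 0 < lam n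
  power_pos : ∀ n, 0 < power n
  height_pos : ∀ n, 0 < height n
  beam_pos : ∀ n, 0 < beam n
  shadowSd_nonneg : ∀ n, 0 ≤ shadowSd n
  nu_pos : 0 < nu
  alpha_pos : 0 < alpha
  height0_pos : 0 < height0
  beam0_pos : 0 < beam0
  K0_pos : 0 < K0
  sigmaK_nonneg : 0 ≤ sigmaK

namespace Network

variable {N : ℕ} (net : Network N)

/-- K-factor intercept `K_n = (h_n/h_0)^κ₁ (θ_n/θ_0)^κ₂ K_0`. -/
noncomputable def K (n : Fin N) : ℝ :=
  (net.height n / net.height0) ^ net.kappa1 * (net.beam n / net.beam0) ^ net.kappa2 * net.K0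

/-- `Ω_n = P_n^{2/ν} E[X_n^{2/ν}]`, with `X_n` the lognormal shadowing of tier `n`. -/
noncomputable def Om (n : Fin N) : ℝ :=
  net.power n ^ (2 / net.nu) *
    ∫ x, x ^ (2 / net.nu) ∂(lognormalDB (net.shadowMean n) (net.shadowSd n))

/-- Density `λ_n Ω_n` of the unit-power process of tier `n`. -/
noncomputable def lamTilde (n : Fin N) : ℝ := net.lam n * net.Om n

/-- Total density `λ_T`. -/
noncomputable def lamT : ℝ := ∑ n, net.lamTilde n

/-- `Λ_n = Ω_n / (π λ_T)`. -/
noncomputable def Lam (n : Fin N) : ℝ := net.Om n / (Real.pi * net.lamT)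

/-- Received power of a cell at `y` in the unit-power formulation. -/
noncomputable def rsrp (y : EuclideanSpace ℝ (Fin 2)) : ℝ := ‖y‖ ^ (-net.nu)

/-- K-factor `K_n γ Ω_n^{-α/2} ‖y‖^{-α}` of a tier-`n` cell at `y` with fading variable `g`. -/
noncomputable def kFactor (n : Fin N) (g : ℝ) (y : EuclideanSpace ℝ (Fin 2)) : ℝ :=
  net.K n * g * net.Om n ^ (-net.alpha / 2) * ‖y‖ ^ (-net.alpha)

section Probability

variable {Ω : Type*} [MeasurableSpace Ω]

/-- The network seen by the typical user at the origin, in the unit-power formulation.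
`Y n i` is the position of the `i`-th cell of tier `n`, `γ n i` its lognormal K-factor variable. -/
structure IsModel (Y : Fin N → ℕ → Ω → EuclideanSpace ℝ (Fin 2)) (γ : Fin N → ℕ → Ω → ℝ)
    (μ : Measure Ω) : Prop where
  ppp : ∀ n, IsPoissonPointProcess (Y n) (ENNReal.ofReal (net.lamTilde n) • volume) μ
  indep_tiers : iIndepFun (fun n ω i => Y n i ω) μ
  hasLaw_fading : ∀ n i, HasLaw (γ n i) (lognormalDB 0 net.sigmaK) μ
  indep_fading : iIndepFun (fun p : Fin N × ℕ => γ p.1 p.2) μ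
  indep_position_fading : IndepFun (fun ω n i => Y n i ω) (fun ω n i => γ n i ω) μ

/-- The monitoring set: the `M` strongest cells over all tiers, i.e. the cells than which fewer
than `M` cells are strictly stronger. -/
def monitoringSet (M : ℕ) (Y : Fin N → ℕ → Ω → EuclideanSpace ℝ (Fin 2)) (ω : Ω) :
    Set (Fin N × ℕ) :=
  {p | {q : Fin N × ℕ | net.rsrp (Y p.1 p.2 ω) < net.rsrp (Y q.1 q.2 ω)}.encard < M}

/-- XLOS service probability: some cell of the monitoring set has K-factor above `Kth`. -/
noncomputable def pXLOS (M : ℕ) (Kth : ℝ) (Y : Fin N → ℕ → Ω → EuclideanSpace ℝ (Fin 2))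
    (γ : Fin N → ℕ → Ω → ℝ) (μ : Measure Ω) : ℝ :=
  μ.real {ω | ∃ p ∈ net.monitoringSet M Y ω, Kth < net.kFactor p.1 (γ p.1 p.2 ω) (Y p.1 p.2 ω)}

end Probability

/-! ## The integral `I₁` and its closed form -/

/-- Parameters of `H^{0,1}_{1,1}[ · | (1,1); (0,1)]`. -/
def stepParams : FoxParams where
  upperN := [(1, 1)]
  upperRest := []
  lowerM := []
  lowerRest := [(0, 1)]

/-- `ω = 10^{√2 σ_K u / 10}`, for an abscissa `u`. -/
noncomputable def nodeGain (u : ℝ) : ℝ := (10 : ℝ) ^ (Real.sqrt 2 * net.sigmaK * u / 10)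

variable {M : ℕ}

/-- Integrand of `I₁` for the tiers `n`, the abscissas `u` and the contours `Re ζ_m = a m`. -/
noncomputable def I1Integrand [NeZero M] (Kth : ℝ) (a : Fin M → ℝ) (n : Fin M → Fin N)
    (u : Fin M → ℝ) (z : Fin M → ℝ) : ℂ :=
  (∏ m, ((z m ^ (2 / net.alpha - 1) : ℝ) : ℂ) *
      stepParams.H (a m)
        (Kth * net.Om (n m) ^ (net.alpha / 2) * z m / (net.nodeGain (u m) * net.K (n m)))) *
    ((Real.exp (-Real.pi * net.lamT *
      z ⟨M - 1, Nat.sub_lt (NeZero.pos M) Nat.one_pos⟩ ^ (2 / net.alpha)) : ℝ) : ℂ)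

/-- The region `0 ≤ z_1 ≤ z_2 ≤ … ≤ z_M`. -/
def orderedRegion (M : ℕ) : Set (Fin M → ℝ) := {z | (∀ m, 0 ≤ z m) ∧ Monotone z}

/-- `I₁ = ∫_{0 ≤ z_1 ≤ … ≤ z_M} ∏_m z_m^{2/α-1} H^{0,1}_{1,1}[…] e^{-π λ_T z_M^{2/α}} dz`. -/
noncomputable def I1 [NeZero M] (Kth : ℝ) (a : Fin M → ℝ) (n : Fin M → Fin N)
    (u : Fin M → ℝ) : ℂ :=
  ∫ z in orderedRegion M, net.I1Integrand Kth a n u z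

/-- Parameters of the `M`-variate Fox H-function `H^{0,M: 0,1; …; 0,1}_{M,M-1: 1,1; …; 1,1}`
(the indices `i : Fin (M - 1)` and `m : Fin M` are the one-based ones minus one). -/
noncomputable def closedParams (M : ℕ) : MultiFoxParams M where
  outerN :=
    List.ofFn (fun i : Fin (M - 1) =>
      (1 - 2 * ((i : ℝ) + 1) / net.alpha, fun m : Fin M => if (m : ℕ) ≤ i then 1 else 0)) ++
    [(1 - (M : ℝ), fun _ => net.alpha / 2)]
  outerRest := []
  outerLower :=
    List.ofFn (fun i : Fin (M - 1) =>
      (-(2 * ((i : ℝ) + 1) / net.alpha), fun m : Fin M => if (m : ℕ) ≤ i then 1 else 0))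
  inner := fun _ => stepParams

/-- Arguments `K_th Λ_{n_m}^{α/2} / (ω_m K_{n_m})`. -/
noncomputable def foxArg (Kth : ℝ) (n : Fin M → Fin N) (u : Fin M → ℝ) (m : Fin M) : ℝ :=
  Kth * net.Lam (n m) ^ (net.alpha / 2) / (net.nodeGain (u m) * net.K (n m))

/-- `(α/2) (π λ_T)^{-M} H[…]`, with contours `Re ζ_m = c m`. -/
noncomputable def closedI1 (Kth : ℝ) (c : Fin M → ℝ) (n : Fin M → Fin N) (u : Fin M → ℝ) : ℂ :=
  ((net.alpha / 2 * ((Real.pi * net.lamT) ^ M)⁻¹ : ℝ) : ℂ) *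
    (net.closedParams M).H c (net.foxArg Kth n u)

/-- The prefactor `(2√π/α)^M` and the sum over tier assignments `n` with weights
`∏_m λ̃_{n_m}`, applied to a function `J` of the tier assignment. -/
noncomputable def tierSum (M : ℕ) (J : (Fin M → Fin N) → ℂ) : ℂ :=
  ((2 * Real.sqrt Real.pi / net.alpha : ℝ) : ℂ) ^ M *
    ∑ n : Fin M → Fin N, ((∏ m, net.lamTilde (n m) : ℝ) : ℂ) * J n

end Network

/-! ## Gaussian-weight cubature -/

/-- The Gaussian weight `e^{-(u_1² + … + u_M²)}`. -/
noncomputable def gaussWeight {M : ℕ} (u : Fin M → ℝ) : ℝ := Real.exp (-∑ m, u m ^ 2)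

/-- A cubature rule on `ℝ^M`: `L` weights and `L` nodes. -/
structure Cubature (M : ℕ) where
  L : ℕ
  w : Fin L → ℝ
  node : Fin L → Fin M → ℝ

namespace Cubature

variable {M : ℕ}

/-- `∑_l w_l g(u_l)`. -/
noncomputable def apply (R : Cubature M) (g : (Fin M → ℝ) → ℂ) : ℂ :=
  ∑ l, (R.w l : ℂ) * g (R.node l)

/-- The rule integrates all polynomials of degree at most `d` exactly against the Gaussian
weight; for `d = 0` this is `∑_l w_l = π^{M/2}`. -/
def ExactTo (R : Cubature M) (d : ℕ) : Prop :=
  ∀ p : MvPolynomial (Fin M) ℝ, p.totalDegree ≤ d →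
    ∑ l, R.w l * MvPolynomial.eval (R.node l) p =
      ∫ u : Fin M → ℝ, gaussWeight u * MvPolynomial.eval u p

/-- Cubature error `∑_l w_l g(u_l) - ∫ e^{-|u|²} g(u) du`. -/
noncomputable def error (R : Cubature M) (g : (Fin M → ℝ) → ℂ) : ℂ :=
  R.apply g - ∫ u : Fin M → ℝ, (gaussWeight u : ℂ) * g u

end Cubature

end XLOS

open MeasureTheory ProbabilityTheory Filter Topology

namespace XLOS

/-! ## Inverse Mellin transforms of elementary functions -/

section Mellin

open Complex

/-! Put β = 2/α and Λ = πλ_T. Both sides of the closed form are evaluated as one real quantity,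
`closedVal`: the integral against e^{-w} dw of the ordered integral of the thresholded powers
z_m^{β-1} below the height (w/Λ)^{1/β}. Since Γ(ζ)/Γ(1+ζ) = 1/ζ, the one-variable H-function is
Perron's integral, the indicator of x > 1 away from the jump (`stepParams_H_of_ne_one`). Writing
e^{-Λ z_M^β} as the integral of e^{-w} over w ≥ Λ z_M^β then turns I₁ into `closedVal` by Tonelli
(`closedVal_eq_lintegral_region`). In the M-variate kernel each Gamma quotient collapses to the
inverse of a shifted partial sum, and the shift from Γ(M + S/β) to Γ(M + 1 + S/β), with S the sum of
all variables, supplies the last one (`closedParams_integrand`). What remains is a bounded Gamma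
factor times ∏ 1/((iβ + ζ_1 + ⋯ + ζ_i) ζ_i), absolutely integrable one variable at a time.
Integrating out the last variable replaces a contour by a real variable, so induction yields the
ordered integral (`integral_mbKer_eq_ordInt`); the Gamma factor is the exponential weight
(`integral_Gamma_mul_mbKer`).

For the probability, the complementary event is that the M strongest cells all have K-factor at most
K_th ("good" cells in the general part). A cell is located by its level Λ‖y‖², the mean number of
closer cells; let Q(t) be the mean number of good cells of level below t. Expanding the generating
functional in a counting variable gives probability e^{-t} Q(s)^M / M! that exactly M cells lie
below s, all good, and none in [s,t) (`measure_count_good`). Hence the event that the M strongest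
are good and the M-th level falls in [s,t) has probability e^{-t}(Q(t)^M - Q(s)^M)/M! up to (t-s)²,
because a discrepancy forces two cells into the shell. Adding over fine partitions and letting the
level tend to infinity gives 1 - P_XLOS = ∫ e^{-w} Q(w)^M / M! dw (`measure_strongestGood`), with no
density of order statistics. Finally Q is the primitive of a density which is a sum over tiers and a
Gaussian integral over abscissas; Q^M/M! is an ordered integral of that density, and multilinearity
expands it into the sum over tier assignments of integrals of `closedVal`
(`sum_tierWeight_mul_lintegral`).

The formula with cubature error is then an identity. For convergence, the rules are tested on
characters: the Taylor polynomial of e^{iL} of degree below 2j is integrated exactly, and its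
remainder is at most L^{2j}/(2j)!, again a polynomial, whose Gaussian integral tends to 0 as j
grows. Lévy's continuity theorem upgrades this to bounded continuous functions
(`tendsto_cubature_apply`), and u ↦ I₁ is one. -/

lemma integrable_inv_sq_add_sq {c : ℝ} (hc : 0 < c) (τ : ℝ) :
    Integrable fun t : ℝ => (c ^ 2 + (t + τ) ^ 2)⁻¹ := by
  have h : Integrable fun t : ℝ => (c ^ 2 + t ^ 2)⁻¹ := by
    have h1 := (integrable_inv_one_add_sq.comp_div hc.ne').const_mul (c ^ 2)⁻¹
    refine h1.congr (Eventually.of_forall fun t => ?_)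
    simp only
    rw [← mul_inv]
    congr 1
    field_simp
  exact h.comp_add_right τ

lemma integral_inv_sq_add_sq_shift (c τ : ℝ) :
    ∫ t : ℝ, (c ^ 2 + (t + τ) ^ 2)⁻¹ = ∫ t : ℝ, (c ^ 2 + t ^ 2)⁻¹ :=
  integral_add_right_eq_self (μ := volume) (fun t : ℝ => (c ^ 2 + t ^ 2)⁻¹) τ

/-- The point `c + j t` of a vertical line. -/
noncomputable def vline (c t : ℝ) : ℂ := (c : ℂ) + t * I

@[simp] lemma vline_re (c t : ℝ) : (vline c t).re = c := by simp [vline]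

@[simp] lemma vline_im (c t : ℝ) : (vline c t).im = t := by simp [vline]

@[fun_prop] lemma continuous_vline (c : ℝ) : Continuous (vline c) := by
  unfold vline; fun_prop

lemma vline_ne_zero {c : ℝ} (hc : 0 < c) (t : ℝ) : vline c t ≠ 0 := fun h => by
  have := congrArg Complex.re h
  simp at this
  exact hc.ne' this

lemma add_vline_ne_zero {c : ℝ} (hc : 0 < c) {p : ℂ} (hp : 0 ≤ p.re) (t : ℝ) :
    p + vline c t ≠ 0 := fun h => by
  have := congrArg Complex.re h
  simp at this
  linarith

lemma sq_norm_add_vline (p : ℂ) (c t : ℝ) :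
    ‖p + vline c t‖ ^ 2 = (p.re + c) ^ 2 + (t + p.im) ^ 2 := by
  rw [Complex.sq_norm, Complex.normSq_apply]
  simp
  ring

lemma inv_sq_norm_add_vline_le {c : ℝ} (hc : 0 < c) {p : ℂ} (hp : 0 ≤ p.re) (t : ℝ) :
    (‖p + vline c t‖ ^ 2)⁻¹ ≤ (c ^ 2 + (t + p.im) ^ 2)⁻¹ := by
  rw [sq_norm_add_vline]
  gcongr
  linarith

/-- The norm of `1 / (s (p + s))` on the vertical line, bounded by integrable functions. -/
lemma norm_inv_mul_inv_le {c : ℝ} (hc : 0 < c) {p : ℂ} (hp : 0 ≤ p.re) (t : ℝ) :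
    ‖(p + vline c t)⁻¹ * (vline c t)⁻¹‖ ≤
      (c ^ 2 + (t + p.im) ^ 2)⁻¹ + (c ^ 2 + (t + 0) ^ 2)⁻¹ := by
  have h1 := inv_sq_norm_add_vline_le hc hp t
  have h2 := inv_sq_norm_add_vline_le hc (p := 0) le_rfl t
  rw [zero_add, Complex.zero_im] at h2
  rw [norm_mul, norm_inv, norm_inv]
  rw [← inv_pow] at h1 h2
  -- Arithmetic-geometric mean: the product of the two inverse norms is at most the sum of their
  -- squares, which separates the two poles.
  nlinarith [sq_nonneg (‖p + vline c t‖⁻¹ - ‖vline c t‖⁻¹), sq_nonneg (‖p + vline c t‖⁻¹),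
    sq_nonneg (‖vline c t‖⁻¹)]

lemma continuous_inv_mul_inv {c : ℝ} (hc : 0 < c) {p : ℂ} (hp : 0 ≤ p.re) :
    Continuous fun t : ℝ => (p + vline c t)⁻¹ * (vline c t)⁻¹ :=
  ((continuous_const.add (continuous_vline c)).inv₀ (add_vline_ne_zero hc hp)).mul
    ((continuous_vline c).inv₀ (vline_ne_zero hc))

lemma integrable_inv_mul_inv {c : ℝ} (hc : 0 < c) {p : ℂ} (hp : 0 ≤ p.re) :
    Integrable fun t : ℝ => (p + vline c t)⁻¹ * (vline c t)⁻¹ :=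
  Integrable.mono' ((integrable_inv_sq_add_sq hc p.im).add (integrable_inv_sq_add_sq hc 0))
    (continuous_inv_mul_inv hc hp).aestronglyMeasurable
    (Eventually.of_forall fun t => norm_inv_mul_inv_le hc hp t)

/-- Translation invariance removes the imaginary part of `p`, so the bound is uniform in `p`. This
uniformity makes the iterated integration in `integrable_mbKer` possible, where `p` depends on the
preceding variables. -/
lemma integral_norm_inv_mul_inv_le {c : ℝ} (hc : 0 < c) {p : ℂ} (hp : 0 ≤ p.re) :
    ∫ t : ℝ, ‖(p + vline c t)⁻¹ * (vline c t)⁻¹‖ ≤ 2 * ∫ t : ℝ, (c ^ 2 + t ^ 2)⁻¹ := by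
  refine (integral_mono (integrable_inv_mul_inv hc hp).norm
    ((integrable_inv_sq_add_sq hc p.im).add (integrable_inv_sq_add_sq hc 0))
    (fun t => norm_inv_mul_inv_le hc hp t)).trans_eq ?_
  simp only [Pi.add_apply]
  rw [integral_add (integrable_inv_sq_add_sq hc p.im) (integrable_inv_sq_add_sq hc 0),
    integral_inv_sq_add_sq_shift, integral_inv_sq_add_sq_shift]
  ring

lemma norm_ofReal_cpow_vline {x : ℝ} (hx : 0 < x) (c t : ℝ) :
    ‖(x : ℂ) ^ vline c t‖ = x ^ c := by
  rw [Complex.norm_cpow_eq_rpow_re_of_pos hx, vline_re]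

lemma continuous_cpow_vline {x : ℝ} (hx : 0 < x) (c : ℝ) :
    Continuous fun t => (x : ℂ) ^ vline c t :=
  (continuous_vline c).const_cpow (Or.inl (by exact_mod_cast hx.ne'))

lemma inv_cpow_neg_vline {x : ℝ} (hx : 0 < x) (s : ℂ) :
    ((x⁻¹ : ℝ) : ℂ) ^ (-s) = (x : ℂ) ^ s := by
  rw [Complex.cpow_neg, Complex.ofReal_inv, Complex.inv_cpow, inv_inv]
  rw [Complex.arg_ofReal_of_nonneg hx.le]
  exact Real.pi_pos.ne

/-- If `f` has Mellin transform `F` on the line `Re s = c` and everything converges, then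
`f (1/x)` is the inverse Mellin integral of `F` at `1/x`. -/
lemma integral_cpow_vline_eq {f : ℝ → ℂ} {F : ℂ → ℂ} {c x : ℝ} (hx : 0 < x)
    (hf : ∀ t, HasMellin f (vline c t) (F (vline c t)))
    (hF : Integrable fun t => F (vline c t)) (hcont : ContinuousAt f x⁻¹) :
    (1 / (2 * Real.pi) : ℂ) * ∫ t : ℝ, F (vline c t) * (x : ℂ) ^ vline c t = f x⁻¹ := by
  have h0 : MellinConvergent f c := by
    have := (hf 0).1
    simpa [vline] using this
  have hv : VerticalIntegrable (mellin f) c := by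
    refine hF.congr (Eventually.of_forall fun t => ?_)
    exact ((hf t).2).symm
  rw [← mellinInv_mellin_eq c f (inv_pos.mpr hx) h0 hv hcont, mellinInv]
  have : ∀ y : ℝ, ((x⁻¹ : ℝ) : ℂ) ^ (-((c : ℂ) + y * I)) • mellin f (c + y * I) =
      F (vline c y) * (x : ℂ) ^ vline c y := fun y => by
    rw [inv_cpow_neg_vline hx, smul_eq_mul, mul_comm]
    exact congrArg₂ _ (hf y).2 rfl
  simp_rw [this]
  simp

/-- `(1/2πj) ∫ x^s / ((p+s) s) ds`. -/
lemma integral_cpow_div_mul {c x : ℝ} (hc : 0 < c) (hx : 0 < x) {p : ℂ} (hp : 0 < p.re) :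
    (1 / (2 * Real.pi) : ℂ) *
      ∫ t : ℝ, ((p + vline c t)⁻¹ * (vline c t)⁻¹) * (x : ℂ) ^ vline c t =
      if 1 < x then (1 - (x : ℂ) ^ (-p)) / p else 0 := by
  have hp0 : p ≠ 0 := fun h => by simp [h] at hp
  -- Partial fractions: 1/((p+s)s) = (1/s - 1/(s+p))/p, and the two terms are the Mellin transforms
  -- of 1 and y^p on (0,1].
  set f : ℝ → ℂ := fun y => p⁻¹ • (Set.indicator (Set.Ioc 0 1) (fun _ => (1 : ℂ)) y -
    Set.indicator (Set.Ioc 0 1) (fun y : ℝ => (y : ℂ) ^ p) y) with hfdef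
  have hM : ∀ t, HasMellin f (vline c t) ((p + vline c t)⁻¹ * (vline c t)⁻¹) := fun t => by
    have h1 := hasMellin_one_Ioc (s := vline c t) (by simpa using hc)
    have h2 := hasMellin_cpow_Ioc p (s := vline c t) (by simp; linarith)
    have h3 := hasMellin_sub h1.1 h2.1
    refine ⟨h3.1.const_smul p⁻¹, ?_⟩
    rw [mellin_const_smul, h3.2, h1.2, h2.2, smul_eq_mul]
    have := vline_ne_zero hc t
    have := add_vline_ne_zero hc hp.le t
    have : vline c t + p ≠ 0 := by rwa [add_comm]
    field_simp
    ring
  -- The indicators jump at 1 but their difference does not; the form with `min y 1` exhibits the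
  -- continuity that Mellin inversion requires.
  have hval : ∀ y : ℝ, 0 < y → f y = (1 - ((min y 1 : ℝ) : ℂ) ^ p) / p := fun y hy => by
    by_cases h : y ≤ 1
    · simp [hfdef, hy, h, div_eq_inv_mul]
    · simp [hfdef, h, (not_le.mp h).le]
  have hcont : ContinuousAt f x⁻¹ := by
    have hxi : 0 < x⁻¹ := inv_pos.mpr hx
    have : ContinuousAt (fun y : ℝ => (1 - ((min y 1 : ℝ) : ℂ) ^ p) / p) x⁻¹ := by
      refine (continuousAt_const.sub ?_).div_const p
      have hmin : (0 : ℝ) < min x⁻¹ 1 := lt_min hxi one_pos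
      exact ContinuousAt.comp (f := fun y : ℝ => min y 1) (g := fun y : ℝ => (y : ℂ) ^ p)
        (Complex.continuousAt_ofReal_cpow_const _ p (Or.inl hp))
        (continuous_id.min continuous_const).continuousAt
    refine this.congr ?_
    filter_upwards [lt_mem_nhds hxi] with y hy using (hval y hy).symm
  rw [integral_cpow_vline_eq (F := fun s => (p + s)⁻¹ * s⁻¹) hx hM
    (integrable_inv_mul_inv hc hp.le) hcont, hval _ (inv_pos.mpr hx)]
  split_ifs with h
  · rw [min_eq_left (inv_le_one_of_one_le₀ h.le), ← inv_cpow_neg_vline (inv_pos.mpr hx), inv_inv]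
  · rw [min_eq_right ((one_le_inv₀ hx).mpr (not_lt.mp h))]
    simp

/-- Inserting a logarithm differentiates the Mellin transform in s, and the indicator of (0,1] has
transform 1/s. -/
lemma hasMellin_neg_log_indicator {s : ℂ} (hs : 0 < s.re) :
    HasMellin (fun y : ℝ => -(Real.log y • Set.indicator (Set.Ioc 0 1) (fun _ => (1 : ℂ)) y)) s
      (s⁻¹ * s⁻¹) := by
  set g : ℝ → ℂ := Set.indicator (Set.Ioc 0 1) (fun _ => (1 : ℂ)) with hg
  have hint : Integrable g := by
    refine (integrable_indicator_iff measurableSet_Ioc).mpr ?_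
    exact integrableOn_const (by simp)
  -- The function vanishes beyond 1, so any decay exponent above Re s is allowed; it is bounded near
  -- 0, so exponent 0 < Re s works there.
  have h := mellin_hasDerivAt_of_isBigO_rpow (f := g) (s := s) (a := s.re + 1) (b := 0)
    (hint.locallyIntegrable.locallyIntegrableOn _)
    (by
      refine (Asymptotics.isBigO_zero _ _).congr' ?_ EventuallyEq.rfl
      filter_upwards [eventually_gt_atTop 1] with y hy
      simp [hg, hy])
    (by linarith)
    (by
      refine Asymptotics.IsBigO.of_bound 1 (Eventually.of_forall fun y => ?_)
      simp only [neg_zero, Real.rpow_zero, hg]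
      refine (norm_indicator_le_norm_self _ _).trans ?_
      simp) hs
  have hd : HasDerivAt (mellin g) (-(s⁻¹ * s⁻¹)) s := by
    have h1 : HasDerivAt (fun z : ℂ => z⁻¹) (-(s⁻¹ * s⁻¹)) s := by
      have := hasDerivAt_inv (x := s) (by rintro rfl; simp at hs)
      rwa [sq, mul_inv] at this
    refine h1.congr_of_eventuallyEq ?_
    filter_upwards [(isOpen_lt continuous_const Complex.continuous_re).mem_nhds hs] with z hz
    rw [(hasMellin_one_Ioc hz).2, one_div]
  refine ⟨?_, ?_⟩
  · have := h.1.const_smul (-1 : ℂ)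
    simpa using this
  · have h2 := h.2.unique hd
    have := mellin_const_smul (fun t => Real.log t • g t) s (-1 : ℂ)
    simp only [neg_smul, one_smul] at this
    rw [this, h2, neg_neg]

/-- `(1/2πj) ∫ x^s / s² ds = log⁺ x`. -/
lemma integral_cpow_div_sq {c x : ℝ} (hc : 0 < c) (hx : 0 < x) :
    (1 / (2 * Real.pi) : ℂ) *
      ∫ t : ℝ, ((vline c t)⁻¹ * (vline c t)⁻¹) * (x : ℂ) ^ vline c t =
      if 1 < x then (Real.log x : ℂ) else 0 := by
  set f : ℝ → ℂ := fun y => -(Real.log y • Set.indicator (Set.Ioc 0 1) (fun _ => (1 : ℂ)) y)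
    with hfdef
  have hval : ∀ y : ℝ, 0 < y → f y = ((-Real.log (min y 1) : ℝ) : ℂ) := fun y hy => by
    by_cases h : y ≤ 1
    · simp [hfdef, hy, h]
    · simp [hfdef, h, (not_le.mp h).le]
  have hcont : ContinuousAt f x⁻¹ := by
    have hxi : 0 < x⁻¹ := inv_pos.mpr hx
    have : ContinuousAt (fun y : ℝ => ((-Real.log (min y 1) : ℝ) : ℂ)) x⁻¹ := by
      have hmin : (0 : ℝ) < min x⁻¹ 1 := lt_min hxi one_pos
      refine Complex.continuous_ofReal.continuousAt.comp ?_
      exact ((continuous_id.min continuous_const).continuousAt.log hmin.ne').neg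
    refine this.congr ?_
    filter_upwards [lt_mem_nhds hxi] with y hy using (hval y hy).symm
  have hF : Integrable fun t => (vline c t)⁻¹ * (vline c t)⁻¹ := by
    simpa using integrable_inv_mul_inv hc (p := 0) le_rfl
  rw [integral_cpow_vline_eq (F := fun s => s⁻¹ * s⁻¹) hx
    (fun t => hasMellin_neg_log_indicator (by simpa using hc)) hF hcont]
  refine (hval _ (inv_pos.mpr hx)).trans ?_
  split_ifs with h
  · rw [min_eq_left (inv_le_one_of_one_le₀ h.le), Real.log_inv, neg_neg]
  · rw [min_eq_right ((one_le_inv₀ hx).mpr (not_lt.mp h))]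
    simp

lemma tendsto_inv_norm_vline (c : ℝ) (l : Filter ℝ) (hl : Tendsto (fun t : ℝ => |t|) l atTop) :
    Tendsto (fun t => ‖(vline c t)⁻¹‖) l (𝓝 0) := by
  simp_rw [norm_inv]
  refine tendsto_inv_atTop_zero.comp (tendsto_atTop_mono (fun t => ?_) hl)
  simpa using Complex.abs_im_le_norm (vline c t)

/-- **Perron's formula** away from the jump. -/
lemma tendsto_integral_cpow_div {c x : ℝ} (hc : 0 < c) (hx : 0 < x) (hx1 : x ≠ 1) :
    Tendsto (fun T : ℝ => (1 / (2 * Real.pi) : ℂ) *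
      ∫ t in (-T)..T, (vline c t)⁻¹ * (x : ℂ) ^ vline c t) atTop
      (𝓝 (if 1 < x then 1 else 0)) := by
  set a : ℂ := (Real.log x : ℂ) with ha
  have ha0 : a ≠ 0 := by
    rw [ha]
    exact_mod_cast Real.log_ne_zero_of_pos_of_ne_one hx hx1
  have hxc : (x : ℂ) ≠ 0 := by exact_mod_cast hx.ne'
  have hcs := continuous_cpow_vline hx c
  have hci : Continuous fun t => (vline c t)⁻¹ := (continuous_vline c).inv₀ (vline_ne_zero hc)
  have hline : ∀ t, HasDerivAt (vline c) I t := fun t => by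
    have := ((Complex.ofRealCLM.hasDerivAt (x := t)).mul_const I).const_add (c : ℂ)
    rw [Complex.ofRealCLM_apply, Complex.ofReal_one, one_mul] at this
    exact this
  have hderiv : ∀ t, HasDerivAt (fun t => (vline c t)⁻¹ * (x : ℂ) ^ vline c t)
      (I * a * ((vline c t)⁻¹ * (x : ℂ) ^ vline c t) -
        I * ((vline c t)⁻¹ * (vline c t)⁻¹ * (x : ℂ) ^ vline c t)) t := fun t => by
    have h1 := (hline t).fun_inv (vline_ne_zero hc t)
    have h2 := HasDerivAt.comp t ((hasDerivAt_id (vline c t)).const_cpow (c := (x : ℂ)) (Or.inl hxc)) (hline t)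
    refine (h1.mul h2).congr_deriv ?_
    simp only [id_eq, Function.comp_apply]
    rw [ha, Complex.ofReal_log hx.le, div_eq_mul_inv, sq, mul_inv]
    ring
  -- Integration by parts trades the conditionally convergent 1/s for the absolutely convergent
  -- 1/s²; the boundary terms vanish in the limit. Dividing by log x is where x ≠ 1 enters.
  have hkey : ∀ T : ℝ, (∫ t in (-T)..T, (vline c t)⁻¹ * (x : ℂ) ^ vline c t) =
      (I * a)⁻¹ * ((vline c T)⁻¹ * (x : ℂ) ^ vline c T -
        (vline c (-T))⁻¹ * (x : ℂ) ^ vline c (-T)) +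
      a⁻¹ * ∫ t in (-T)..T, (vline c t)⁻¹ * (vline c t)⁻¹ * (x : ℂ) ^ vline c t := fun T => by
    have hF := intervalIntegral.integral_eq_sub_of_hasDerivAt (a := -T) (b := T)
      (fun t _ => hderiv t)
      (Continuous.intervalIntegrable (by fun_prop) _ _)
    rw [intervalIntegral.integral_sub (Continuous.intervalIntegrable (by fun_prop) _ _)
      (Continuous.intervalIntegrable (by fun_prop) _ _),
      intervalIntegral.integral_const_mul, intervalIntegral.integral_const_mul] at hF
    rw [← hF]
    have := Complex.I_ne_zero
    field_simp
    ring
  have hb : ∀ l : Filter ℝ, Tendsto (fun t : ℝ => |t|) l atTop →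
      Tendsto (fun t => (vline c t)⁻¹ * (x : ℂ) ^ vline c t) l (𝓝 0) := fun l hl => by
    rw [tendsto_zero_iff_norm_tendsto_zero]
    have := (tendsto_inv_norm_vline c l hl).mul_const (x ^ c)
    rw [zero_mul] at this
    refine this.congr fun t => ?_
    rw [norm_mul, norm_ofReal_cpow_vline hx]
  have hb1 := hb atTop tendsto_abs_atTop_atTop
  have hb2 := (hb atBot tendsto_abs_atBot_atTop).comp tendsto_neg_atTop_atBot
  have hint : Integrable fun t => (vline c t)⁻¹ * (vline c t)⁻¹ * (x : ℂ) ^ vline c t := by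
    have hF : Integrable fun t => (vline c t)⁻¹ * (vline c t)⁻¹ := by
      simpa using integrable_inv_mul_inv hc (p := 0) le_rfl
    refine hF.mul_bdd (c := x ^ c) hcs.aestronglyMeasurable
      (Eventually.of_forall fun t => (norm_ofReal_cpow_vline hx c t).le)
  have h3 := intervalIntegral_tendsto_integral hint tendsto_neg_atTop_atBot tendsto_id
  have h4 := (((hb1.sub hb2).const_mul (I * a)⁻¹).add (h3.const_mul a⁻¹)).const_mul
    (1 / (2 * Real.pi) : ℂ)
  have hlim : (1 / (2 * Real.pi) : ℂ) * ((I * a)⁻¹ * (0 - 0) +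
      a⁻¹ * ∫ t : ℝ, (vline c t)⁻¹ * (vline c t)⁻¹ * (x : ℂ) ^ vline c t) =
      if 1 < x then 1 else 0 := by
    have := integral_cpow_div_sq hc hx
    rw [sub_zero, mul_zero, zero_add, mul_left_comm, this]
    split_ifs
    · rw [← ha, inv_mul_cancel₀ ha0]
    · simp
  rw [hlim] at h4
  refine h4.congr fun T => ?_
  rw [hkey T]
  simp

/-- The symmetric truncation pairs t with -t, and 1/(c+jt) + 1/(c-jt) = 2c/(c²+t²) is integrable.
Only convergence is needed at the jump, since I₁ meets the jump on a null set. -/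
lemma exists_tendsto_integral_inv_vline {c : ℝ} (hc : 0 < c) :
    ∃ l : ℂ, Tendsto (fun T : ℝ => ∫ t in (-T)..T, (vline c t)⁻¹) atTop (𝓝 l) := by
  have hci : Continuous fun t => (vline c t)⁻¹ := (continuous_vline c).inv₀ (vline_ne_zero hc)
  have hint : Integrable fun t : ℝ => ((c * (c ^ 2 + (t + 0) ^ 2)⁻¹ : ℝ) : ℂ) :=
    ((integrable_inv_sq_add_sq hc 0).const_mul c).ofReal
  refine ⟨_, (intervalIntegral_tendsto_integral hint tendsto_neg_atTop_atBot tendsto_id).congr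
    fun T => ?_⟩
  have h1 : ∫ t in (-T)..T, (vline c t)⁻¹ = ∫ t in (-T)..T, (vline c (-t))⁻¹ := by
    rw [intervalIntegral.integral_comp_neg (fun t => (vline c t)⁻¹), neg_neg]
  have h2 : ∀ t : ℝ, ((c * (c ^ 2 + (t + 0) ^ 2)⁻¹ : ℝ) : ℂ) =
      ((vline c t)⁻¹ + (vline c (-t))⁻¹) / 2 := fun t => by
    have e1 := vline_ne_zero hc t
    have e2 := vline_ne_zero hc (-t)
    have e3 : ((c : ℂ) ^ 2 + (t : ℂ) ^ 2) = vline c t * vline c (-t) := by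
      simp only [vline, Complex.ofReal_neg]
      ring_nf
      rw [Complex.I_sq]
      ring
    push_cast
    rw [add_zero, e3, inv_add_inv e1 e2]
    field_simp
    simp only [vline, Complex.ofReal_neg]
    ring
  simp_rw [h2]
  have hci' : Continuous fun t => (vline c (-t))⁻¹ := hci.comp continuous_neg
  rw [intervalIntegral.integral_div, intervalIntegral.integral_add
    (hci.intervalIntegrable _ _) (hci'.intervalIntegrable _ _)]
  simp only [id_eq]
  rw [← h1]
  ring

end Mellin

/-! ## The step function as a one-variable H-function -/

namespace Network

/-- The functional equation of Gamma; it reduces the H-function to Perron's integral. -/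
lemma stepParams_phi {ζ : ℂ} (hζ : 0 < ζ.re) : stepParams.phi ζ = ζ⁻¹ := by
  have h0 : ζ ≠ 0 := by rintro rfl; simp at hζ
  have hG : Complex.Gamma ζ ≠ 0 := Complex.Gamma_ne_zero_of_re_pos hζ
  simp only [FoxParams.phi, stepParams, List.map_nil, List.prod_nil, List.map_cons, List.prod_cons,
    mul_one, one_mul]
  push_cast
  rw [show (1 : ℂ) - 1 + 1 * ζ = ζ by ring, show (1 : ℂ) - 0 + 1 * ζ = ζ + 1 by ring,
    Complex.Gamma_add_one _ h0]
  field_simp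

lemma stepParams_separates {c : ℝ} (hc : 0 < c) : stepParams.Separates c := by
  simp [FoxParams.Separates, stepParams, hc]

lemma stepParams_truncH {c : ℝ} (hc : 0 < c) (x T : ℝ) :
    stepParams.truncH c x T = (1 / (2 * Real.pi) : ℂ) *
      ∫ t in (-T)..T, (vline c t)⁻¹ * (x : ℂ) ^ vline c t := by
  unfold FoxParams.truncH
  congr 1
  refine intervalIntegral.integral_congr fun t _ => ?_
  have : (c : ℂ) + t * Complex.I = vline c t := rfl
  simp only [this]
  rw [stepParams_phi (by simpa using hc)]

lemma stepParams_H_of_ne_one {c x : ℝ} (hc : 0 < c) (hx : 0 < x) (hx1 : x ≠ 1) :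
    stepParams.H c x = if 1 < x then 1 else 0 := by
  refine Tendsto.limUnder_eq ?_
  simp_rw [funext (stepParams_truncH hc x)]
  exact tendsto_integral_cpow_div hc hx hx1

lemma tendsto_stepParams_truncH {c x : ℝ} (hc : 0 < c) (hx : 0 < x) :
    Tendsto (stepParams.truncH c x) atTop (𝓝 (stepParams.H c x)) := by
  refine tendsto_nhds_limUnder ?_
  rw [funext (stepParams_truncH hc x)]
  by_cases hx1 : x = 1
  · obtain ⟨l, hl⟩ := exists_tendsto_integral_inv_vline hc
    refine ⟨_, (hl.const_mul (1 / (2 * Real.pi) : ℂ)).congr fun T => ?_⟩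
    simp [hx1]
  · exact ⟨_, tendsto_integral_cpow_div hc hx hx1⟩

end Network

end XLOS

namespace XLOS

/-! ## Splitting off the last coordinate -/

section Snoc

variable (k : ℕ)

/-- The measurable equivalence `t ↦ ((t_1, …, t_k), t_{k+1})`. -/
noncomputable def initLast : (Fin (k + 1) → ℝ) ≃ᵐ (Fin k → ℝ) × ℝ :=
  (MeasurableEquiv.piFinSuccAbove (fun _ => ℝ) (Fin.last k)).trans MeasurableEquiv.prodComm

lemma initLast_apply (t : Fin (k + 1) → ℝ) :
    initLast k t = (fun i => t i.castSucc, t (Fin.last k)) := by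
  simp only [initLast, MeasurableEquiv.trans_apply, MeasurableEquiv.prodComm,
    MeasurableEquiv.piFinSuccAbove]
  ext i
  · simp [Fin.init]
  · simp

lemma measurePreserving_initLast : MeasurePreserving (initLast k) :=
  (Measure.measurePreserving_swap).comp (volume_preserving_piFinSuccAbove (fun _ => ℝ) (Fin.last k))

variable {k}

lemma lintegral_initLast (G : (Fin k → ℝ) × ℝ → ENNReal) :
    ∫⁻ t : Fin (k + 1) → ℝ, G (fun i => t i.castSucc, t (Fin.last k)) = ∫⁻ p, G p := by
  simp_rw [← initLast_apply]
  exact (measurePreserving_initLast k).lintegral_comp_emb (initLast k).measurableEmbedding G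

lemma integral_initLast (G : (Fin k → ℝ) × ℝ → ℂ) :
    ∫ t : Fin (k + 1) → ℝ, G (fun i => t i.castSucc, t (Fin.last k)) = ∫ p, G p := by
  simp_rw [← initLast_apply]
  exact (measurePreserving_initLast k).integral_comp (initLast k).measurableEmbedding G

lemma integrable_initLast {G : (Fin k → ℝ) × ℝ → ℂ} :
    (Integrable fun t : Fin (k + 1) → ℝ => G (fun i => t i.castSucc, t (Fin.last k))) ↔
      Integrable G := by
  simp_rw [← initLast_apply]
  exact (measurePreserving_initLast k).integrable_comp_emb (initLast k).measurableEmbedding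

end Snoc

/-! ## Iterated integrals over ordered variables -/

/-- `∫_{0 < z_1 ≤ … ≤ z_k ≤ y} ∏ f_m(z_m) dz`, as an iterated integral. -/
noncomputable def ordInt : (k : ℕ) → (Fin k → ℝ → ENNReal) → ℝ → ENNReal
  | 0, _, _ => 1
  | k + 1, f, y => ∫⁻ z in Set.Ioc 0 y, f (Fin.last k) z * ordInt k (fun m => f m.castSucc) z

@[simp] lemma ordInt_zero (f : Fin 0 → ℝ → ENNReal) (y : ℝ) : ordInt 0 f y = 1 := rfl

lemma ordInt_succ {k : ℕ} (f : Fin (k + 1) → ℝ → ENNReal) (y : ℝ) :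
    ordInt (k + 1) f y =
      ∫⁻ z in Set.Ioc 0 y, f (Fin.last k) z * ordInt k (fun m => f m.castSucc) z := rfl

lemma ordInt_mono_right {k : ℕ} (f : Fin k → ℝ → ENNReal) : Monotone (ordInt k f) := by
  cases k with
  | zero => exact monotone_const
  | succ k => exact fun y y' h => lintegral_mono_set (Set.Ioc_subset_Ioc_right h)

/-- Dropping the ordering constraint enlarges the region to a cube. -/
lemma ordInt_le_prod {k : ℕ} {f : Fin k → ℝ → ENNReal} (hf : ∀ m, Measurable (f m)) (y : ℝ) :
    ordInt k f y ≤ ∏ m, ∫⁻ z in Set.Ioc 0 y, f m z := by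
  induction k with
  | zero => simp
  | succ k ih =>
    rw [Fin.prod_univ_castSucc, mul_comm, ordInt_succ, ← lintegral_mul_const _ (hf _)]
    refine setLIntegral_mono' measurableSet_Ioc fun z hz => ?_
    gcongr
    exact (ordInt_mono_right _ hz.2).trans (ih fun m => hf _)

/-- The parameter space `A` will carry the abscissas over which ordered integrals are averaged;
joint measurability with the height is what Tonelli asks for there. -/
lemma measurable_ordInt {A : Type*} [MeasurableSpace A] {k : ℕ} {F : Fin k → A → ℝ → ENNReal}
    (hF : ∀ m, Measurable fun q : A × ℝ => F m q.1 q.2) :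
    Measurable fun q : A × ℝ => ordInt k (fun m => F m q.1) q.2 := by
  induction k with
  | zero => exact measurable_const
  | succ k ih =>
    have ih' := ih (F := fun m => F m.castSucc) (fun m => hF _)
    simp_rw [ordInt_succ, ← lintegral_indicator measurableSet_Ioc]
    refine Measurable.lintegral_prod_right'
      (f := fun r : (A × ℝ) × ℝ => (Set.Ioc 0 r.1.2).indicator (fun z =>
        F (Fin.last k) r.1.1 z * ordInt k (fun m => F m.castSucc r.1.1) z) r.2) ?_
    have hS : MeasurableSet {r : (A × ℝ) × ℝ | r.2 ∈ Set.Ioc 0 r.1.2} :=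
      (measurableSet_lt measurable_const measurable_snd).inter
        (measurableSet_le measurable_snd (measurable_snd.comp measurable_fst))
    have hm : Measurable fun r : (A × ℝ) × ℝ =>
        F (Fin.last k) r.1.1 r.2 * ordInt k (fun m => F m.castSucc r.1.1) r.2 :=
      ((hF (Fin.last k)).comp ((measurable_fst.comp measurable_fst).prodMk measurable_snd)).mul
        (ih'.comp ((measurable_fst.comp measurable_fst).prodMk measurable_snd))
    exact hm.indicator hS

lemma measurable_ordInt_right {k : ℕ} {f : Fin k → ℝ → ENNReal} (hf : ∀ m, Measurable (f m)) :
    Measurable (ordInt k f) :=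
  (measurable_ordInt (A := Unit) (F := fun m _ => f m) fun m => (hf m).comp measurable_snd).comp
    (measurable_const (a := ()) |>.prodMk measurable_id)

/-! ## The Mellin-Barnes kernel of the ordered integral -/

/-- `∏_{i ≤ k} 1 / ((iβ + ζ_1 + ⋯ + ζ_i) ζ_i)`. -/
noncomputable def mbKer (β : ℝ) : (k : ℕ) → (Fin k → ℂ) → ℂ
  | 0, _ => 1
  | k + 1, ζ => mbKer β k (fun i => ζ i.castSucc) *
      (((((k : ℝ) + 1) * β : ℝ) + ∑ m : Fin k, ζ m.castSucc + ζ (Fin.last k))⁻¹ *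
        (ζ (Fin.last k))⁻¹)

lemma mbKer_succ (β : ℝ) {k : ℕ} (ζ : Fin (k + 1) → ℂ) :
    mbKer β (k + 1) ζ = mbKer β k (fun i => ζ i.castSucc) *
      (((((k : ℝ) + 1) * β : ℝ) + ∑ m : Fin k, ζ m.castSucc + ζ (Fin.last k))⁻¹ *
        (ζ (Fin.last k))⁻¹) := rfl

/-- The recursive form serves induction on the number of contours; this product form is the one that
the Gamma quotients produce. -/
lemma mbKer_eq_prod (β : ℝ) {k : ℕ} (ζ : Fin k → ℂ) :
    mbKer β k ζ = (∏ i : Fin k, (((((i : ℕ) : ℝ) + 1) * β : ℝ) +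
      ∑ m : Fin k, if m ≤ i then ζ m else 0)⁻¹) * ∏ i, (ζ i)⁻¹ := by
  induction k with
  | zero => simp [mbKer]
  | succ k ih =>
    rw [mbKer_succ, ih, Fin.prod_univ_castSucc, Fin.prod_univ_castSucc (fun i => (ζ i)⁻¹)]
    have h1 : ∀ i : Fin k, (∑ m : Fin (k + 1), if m ≤ i.castSucc then ζ m else 0) =
        ∑ m : Fin k, if m ≤ i then ζ m.castSucc else 0 := fun i => by
      rw [Fin.sum_univ_castSucc]
      simp
    have h2 : (∑ m : Fin (k + 1), if m ≤ Fin.last k then ζ m else 0) =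
        ∑ m : Fin k, ζ m.castSucc + ζ (Fin.last k) := by
      rw [Fin.sum_univ_castSucc]
      simp [Fin.le_last]
    simp only [h1, h2, Fin.val_castSucc, Fin.val_last]
    rw [← add_assoc]
    ring

section MB

variable {β : ℝ}

lemma re_pole (hβ : 0 < β) {k : ℕ} {c : Fin k → ℝ} (hc : ∀ m, 0 < c m) (t : Fin k → ℝ) :
    0 < (((((k : ℝ) + 1) * β : ℝ) : ℂ) + ∑ m : Fin k, vline (c m) (t m)).re := by
  simp only [Complex.add_re, Complex.ofReal_re, Complex.re_sum, vline_re]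
  have := Finset.sum_nonneg fun m (_ : m ∈ Finset.univ) => (hc m).le
  positivity

lemma measurable_mbKer (β : ℝ) (k : ℕ) : Measurable (mbKer β k) := by
  induction k with
  | zero => exact measurable_const
  | succ k ih =>
    simp_rw [funext (mbKer_succ β (k := k))]
    refine (ih.comp (by fun_prop)).mul ?_
    fun_prop

/-- Integrating the norm over the last variable costs a constant independent of the others, so
integrability passes from k to k + 1 variables. -/
lemma integrable_mbKer (hβ : 0 < β) {k : ℕ} {c : Fin k → ℝ} (hc : ∀ m, 0 < c m) :
    Integrable fun t : Fin k → ℝ => mbKer β k fun m => vline (c m) (t m) := by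
  induction k with
  | zero => simp only [mbKer]; exact integrable_const _
  | succ k ih =>
    have ih' := ih (c := fun m => c m.castSucc) (fun m => hc _)
    set p : (Fin k → ℝ) → ℂ := fun t => ((((k : ℝ) + 1) * β : ℝ) : ℂ) +
      ∑ m : Fin k, vline (c m.castSucc) (t m) with hp
    have hpre : ∀ t, 0 ≤ (p t).re := fun t => (re_pole hβ (fun m => hc _) t).le
    have hpm : Measurable p := by fun_prop
    set c' := c (Fin.last k) with hc'
    refine integrable_initLast (G := fun q => (mbKer β k fun m => vline (c m.castSucc) (q.1 m)) *
      ((p q.1 + vline c' q.2)⁻¹ * (vline c' q.2)⁻¹)) |>.mpr ?_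
    have hmeas : AEStronglyMeasurable (fun q : (Fin k → ℝ) × ℝ =>
        (mbKer β k fun m => vline (c m.castSucc) (q.1 m)) *
        ((p q.1 + vline c' q.2)⁻¹ * (vline c' q.2)⁻¹)) := by
      refine Measurable.aestronglyMeasurable ?_
      refine Measurable.mul ((measurable_mbKer β k).comp (by fun_prop)) ?_
      fun_prop
    refine (integrable_prod_iff hmeas).mpr ⟨Eventually.of_forall fun t => ?_, ?_⟩
    · exact (integrable_inv_mul_inv (hc (Fin.last k)) (hpre t)).const_mul
        (mbKer β k fun m => vline (c m.castSucc) (t m))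
    · refine Integrable.mono' (ih'.norm.mul_const (2 * ∫ s : ℝ, (c' ^ 2 + s ^ 2)⁻¹))
        hmeas.norm.integral_prod_right' (Eventually.of_forall fun t => ?_)
      rw [Real.norm_of_nonneg (integral_nonneg fun _ => norm_nonneg _)]
      simp only [norm_mul (mbKer _ _ _)]
      rw [integral_const_mul]
      exact mul_le_mul_of_nonneg_left (integral_norm_inv_mul_inv_le (hc _) (hpre t))
        (norm_nonneg _)

lemma measurable_prod_cpow_vline {k : ℕ} (c : Fin k → ℝ) :
    Measurable fun q : (Fin k → ℝ) × (Fin k → ℝ) =>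
      ∏ m, ((q.1 m : ℝ) : ℂ) ^ vline (c m) (q.2 m) :=
  Finset.measurable_fun_prod _ fun m _ => by fun_prop

lemma norm_prod_cpow_vline {k : ℕ} {X : Fin k → ℝ} (hX : ∀ m, 0 < X m) (c t : Fin k → ℝ) :
    ‖∏ m, (X m : ℂ) ^ vline (c m) (t m)‖ = ∏ m, X m ^ c m := by
  rw [norm_prod]
  exact Finset.prod_congr rfl fun m _ => norm_ofReal_cpow_vline (hX m) _ _

lemma integrable_mbKer_mul (hβ : 0 < β) {k : ℕ} {c X : Fin k → ℝ} (hc : ∀ m, 0 < c m) (hX : ∀ m, 0 < X m) :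
    Integrable fun t : Fin k → ℝ => (mbKer β k fun m => vline (c m) (t m)) *
      ∏ m, (X m : ℂ) ^ vline (c m) (t m) :=
  (integrable_mbKer hβ hc).mul_bdd (c := ∏ m, X m ^ c m)
    ((measurable_prod_cpow_vline c).comp
      (measurable_const (a := X) |>.prodMk measurable_id)).aestronglyMeasurable
    (Eventually.of_forall fun t => (norm_prod_cpow_vline hX c t).le)


/-- `z^{β-1}` above the threshold `1/x`, zero below. -/
noncomputable def stepPow (β x z : ℝ) : ℝ := if 1 < z * x then z ^ (β - 1) else 0

lemma stepPow_nonneg {x z : ℝ} (hz : 0 ≤ z) : 0 ≤ stepPow β x z := by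
  unfold stepPow; split_ifs <;> positivity

lemma stepPow_le {x z : ℝ} (hz : 0 ≤ z) : stepPow β x z ≤ z ^ (β - 1) := by
  unfold stepPow; split_ifs <;> [exact le_rfl; positivity]

@[fun_prop]
lemma Measurable.stepPow {A : Type*} [MeasurableSpace A] {x z : A → ℝ} (hx : Measurable x)
    (hz : Measurable z) : Measurable fun a => stepPow β (x a) (z a) := by
  unfold XLOS.stepPow
  exact Measurable.ite (measurableSet_lt measurable_const (hz.mul hx)) (hz.pow_const _)
    measurable_const

/-- `∫_0^y 1{z x > 1} z^{p-1} dz`. -/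
lemma integral_stepPow_mul_cpow {x y : ℝ} (hx : 0 < x) (hy : 0 < y) {p : ℂ} (hp : 0 < p.re) :
    ∫ z in Set.Ioc 0 y, (stepPow β x z : ℂ) * (z : ℂ) ^ (p - β) =
      (y : ℂ) ^ p * if 1 < y * x then (1 - ((y * x : ℝ) : ℂ) ^ (-p)) / p else 0 := by
  have hp0 : p ≠ 0 := fun h => by simp [h] at hp
  have hxi : 0 < x⁻¹ := inv_pos.mpr hx
  have hlt : ∀ z, 1 < z * x ↔ x⁻¹ < z := fun z => (inv_lt_iff_one_lt_mul₀ hx).symm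
  have h1 : ∀ z ∈ Set.Ioc 0 y, (stepPow β x z : ℂ) * (z : ℂ) ^ (p - β) =
      (Set.Ioi x⁻¹).indicator (fun z : ℝ => (z : ℂ) ^ (p - 1)) z := fun z hz => by
    have hz0 : (z : ℂ) ≠ 0 := by exact_mod_cast hz.1.ne'
    simp only [stepPow, Set.indicator, Set.mem_Ioi, ← hlt]
    split_ifs
    · rw [Complex.ofReal_cpow hz.1.le, ← Complex.cpow_add _ _ hz0]
      congr 1
      push_cast
      ring
    · simp
  rw [setIntegral_congr_fun measurableSet_Ioc h1, setIntegral_indicator measurableSet_Ioi]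
  split_ifs with h
  · have h' := (hlt y).mp h
    have hset : Set.Ioc 0 y ∩ Set.Ioi x⁻¹ = Set.Ioc x⁻¹ y := by
      ext z
      simp only [Set.mem_inter_iff, Set.mem_Ioc, Set.mem_Ioi]
      exact ⟨fun h => ⟨h.2, h.1.2⟩, fun h => ⟨⟨hxi.trans h.1, h.2⟩, h.1⟩⟩
    rw [hset, ← intervalIntegral.integral_of_le h'.le, integral_cpow (Or.inl (by simpa using hp)),
      sub_add_cancel, mul_div_assoc', mul_sub, mul_one]
    congr 2
    rw [Complex.ofReal_mul, Complex.mul_cpow_ofReal_nonneg hy.le hx.le, ← mul_assoc,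
      ← Complex.cpow_add _ _ (by exact_mod_cast hy.ne'), add_neg_cancel, Complex.cpow_zero, one_mul,
      ← inv_cpow_neg_vline hx, neg_neg]
  · have hset : Set.Ioc 0 y ∩ Set.Ioi x⁻¹ = ∅ := by
      ext z
      simp only [Set.mem_inter_iff, Set.mem_Ioc, Set.mem_Ioi, Set.mem_empty_iff_false, iff_false]
      intro h2
      exact h ((hlt y).mpr (h2.2.trans_le h2.1.2))
    simp [hset]

end MB

end XLOS

namespace XLOS

/-! ### Ordered integrals as Mellin-Barnes integrals -/

section MB

variable {β : ℝ}

lemma integrableOn_rpow_Ioc (hβ : 0 < β) (y : ℝ) :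
    IntegrableOn (fun z : ℝ => z ^ (β - 1)) (Set.Ioc 0 y) := by
  rcases le_total y 0 with hy | hy
  · simp [Set.Ioc_eq_empty_of_le hy]
  · exact (intervalIntegrable_iff_integrableOn_Ioc_of_le hy).mp
      (intervalIntegral.intervalIntegrable_rpow' (by linarith))

/-- The factor `1{z x > 1} z^{β-1}`, as an extended nonnegative number. -/
noncomputable def stepFun (β x z : ℝ) : ENNReal := ENNReal.ofReal (stepPow β x z)

@[fun_prop]
lemma Measurable.stepFun {A : Type*} [MeasurableSpace A] {x z : A → ℝ} (hx : Measurable x)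
    (hz : Measurable z) : Measurable fun a => stepFun β (x a) (z a) :=
  (Measurable.stepPow hx hz).ennreal_ofReal

lemma lintegral_stepFun_lt_top (hβ : 0 < β) (x y : ℝ) :
    ∫⁻ z in Set.Ioc 0 y, stepFun β x z < ⊤ := by
  refine lt_of_le_of_lt (setLIntegral_mono' measurableSet_Ioc fun z hz => ?_)
    (integrableOn_rpow_Ioc hβ y).2
  unfold stepFun
  rw [← ofReal_norm, Real.norm_of_nonneg (Real.rpow_nonneg hz.1.le _)]
  exact ENNReal.ofReal_le_ofReal (stepPow_le hz.1.le)

lemma ordInt_stepFun_lt_top (hβ : 0 < β) {k : ℕ} (x : Fin k → ℝ) (y : ℝ) :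
    ordInt k (fun m => stepFun β (x m)) y < ⊤ :=
  (ordInt_le_prod (fun m => by fun_prop) y).trans_lt
    (ENNReal.prod_lt_top fun m _ => lintegral_stepFun_lt_top hβ (x m) y)

lemma prod_cpow_mul {k : ℕ} {x : Fin k → ℝ} (hx : ∀ m, 0 < x m) {z : ℝ} (hz : 0 < z)
    (ζ : Fin k → ℂ) : ∏ m, ((z * x m : ℝ) : ℂ) ^ ζ m =
      (z : ℂ) ^ (∑ m, ζ m) * ∏ m, (x m : ℂ) ^ ζ m := by
  have hz0 : (z : ℂ) ≠ 0 := by exact_mod_cast hz.ne'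
  have h1 : (z : ℂ) ^ (∑ m, ζ m) = ∏ m, (z : ℂ) ^ ζ m := by
    simp_rw [Complex.cpow_def_of_ne_zero hz0, Finset.mul_sum, Complex.exp_sum]
  rw [h1, ← Finset.prod_mul_distrib]
  refine Finset.prod_congr rfl fun m _ => ?_
  rw [Complex.ofReal_mul, Complex.mul_cpow_ofReal_nonneg hz.le (hx m).le]

/-- **Mellin-Barnes representation of the ordered integral.** -/
theorem integral_mbKer_eq_ordInt (hβ : 0 < β) {k : ℕ} {c x : Fin k → ℝ} (hc : ∀ m, 0 < c m)
    (hx : ∀ m, 0 < x m) {y : ℝ} (hy : 0 < y) :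
    (1 / (2 * Real.pi) : ℂ) ^ k * (y : ℂ) ^ (((k : ℝ) * β : ℝ) : ℂ) *
      ∫ t : Fin k → ℝ, (mbKer β k fun m => vline (c m) (t m)) *
        ∏ m, ((y * x m : ℝ) : ℂ) ^ vline (c m) (t m) =
      ((ordInt k (fun m => stepFun β (x m)) y).toReal : ℂ) := by
  induction k generalizing y with
  | zero => simp [mbKer, Measure.real, volume_pi]
  | succ k ih =>
    set c' := c (Fin.last k) with hc'
    set x' := x (Fin.last k) with hx'
    have hx0 : 0 < x' := hx _
    have hc0 : 0 < c' := hc _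
    set p : (Fin k → ℝ) → ℂ := fun t => ((((k : ℝ) + 1) * β : ℝ) : ℂ) +
      ∑ m : Fin k, vline (c m.castSucc) (t m) with hp
    have hpre : ∀ t, 0 < (p t).re := fun t => re_pole hβ (fun m => hc _) t
    set A : (Fin k → ℝ) → ℂ := fun t => mbKer β k fun m => vline (c m.castSucc) (t m) with hA
    have hAint : Integrable A := integrable_mbKer hβ fun m => hc _
    -- integrate the last variable
    have hsplit : ∫ t : Fin (k + 1) → ℝ, (mbKer β (k + 1) fun m => vline (c m) (t m)) *
        ∏ m, ((y * x m : ℝ) : ℂ) ^ vline (c m) (t m) =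
        ∫ t : Fin k → ℝ, A t * (∏ m, ((y * x m.castSucc : ℝ) : ℂ) ^ vline (c m.castSucc) (t m)) *
          ∫ s : ℝ, ((p t + vline c' s)⁻¹ * (vline c' s)⁻¹) * ((y * x' : ℝ) : ℂ) ^ vline c' s := by
      have hI := integrable_mbKer_mul hβ hc (X := fun m => y * x m) (fun m => mul_pos hy (hx m))
      set F : (Fin k → ℝ) × ℝ → ℂ := fun q => A q.1 *
            (∏ m, ((y * x m.castSucc : ℝ) : ℂ) ^ vline (c m.castSucc) (q.1 m)) *
            (((p q.1 + vline c' q.2)⁻¹ * (vline c' q.2)⁻¹) *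
              ((y * x' : ℝ) : ℂ) ^ vline c' q.2) with hF
      have hform : ∀ t : Fin (k + 1) → ℝ, (mbKer β (k + 1) fun m => vline (c m) (t m)) *
          ∏ m, ((y * x m : ℝ) : ℂ) ^ vline (c m) (t m) =
          F (fun i => t i.castSucc, t (Fin.last k)) :=
        fun t => by
          rw [mbKer_succ, Fin.prod_univ_castSucc]
          simp only [hF, hA, hp]
          ring
      rw [funext hform] at hI ⊢
      rw [integral_initLast, Measure.volume_eq_prod, integral_prod _ (integrable_initLast.mp hI)]
      simp only [hF, integral_const_mul]
    -- represent the result as an integral over `z`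
    have hstep : ∀ t : Fin k → ℝ, (1 / (2 * Real.pi) : ℂ) *
        (y : ℂ) ^ ((((k + 1 : ℕ) : ℝ) * β : ℝ) : ℂ) *
        (A t * (∏ m, ((y * x m.castSucc : ℝ) : ℂ) ^ vline (c m.castSucc) (t m)) *
          ∫ s : ℝ, ((p t + vline c' s)⁻¹ * (vline c' s)⁻¹) * ((y * x' : ℝ) : ℂ) ^ vline c' s) =
        ∫ z in Set.Ioc 0 y, (stepPow β x' z : ℂ) * (z : ℂ) ^ (((k : ℝ) * β : ℝ) : ℂ) *
          (A t * ∏ m, ((z * x m.castSucc : ℝ) : ℂ) ^ vline (c m.castSucc) (t m)) := fun t => by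
      have h1 : ∀ z ∈ Set.Ioc 0 y, (stepPow β x' z : ℂ) * (z : ℂ) ^ (((k : ℝ) * β : ℝ) : ℂ) *
          (A t * ∏ m, ((z * x m.castSucc : ℝ) : ℂ) ^ vline (c m.castSucc) (t m)) =
          (A t * ∏ m, (x m.castSucc : ℂ) ^ vline (c m.castSucc) (t m)) *
            ((stepPow β x' z : ℂ) * (z : ℂ) ^ (p t - β)) := fun z hz => by
        have hz0 : (z : ℂ) ≠ 0 := by exact_mod_cast hz.1.ne'
        rw [prod_cpow_mul (fun m => hx _) hz.1]
        have : p t - β = (((k : ℝ) * β : ℝ) : ℂ) + ∑ m : Fin k, vline (c m.castSucc) (t m) := by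
          simp only [hp]
          push_cast
          ring
        rw [this, Complex.cpow_add _ _ hz0]
        ring
      -- The line integral over the last variable and the integral of z^{p-1} from 1/x' to y have
      -- the same closed value up to y^p. Here p is the partial sum of the remaining variables, so
      -- one contour is exchanged for one real variable.
      rw [setIntegral_congr_fun measurableSet_Ioc h1, integral_const_mul,
        integral_stepPow_mul_cpow hx0 hy (hpre t), ← integral_cpow_div_mul hc0 (mul_pos hy hx0)
          (hpre t), prod_cpow_mul (fun m => hx _) hy]
      have hy0 : (y : ℂ) ≠ 0 := by exact_mod_cast hy.ne'
      have : (y : ℂ) ^ p t = (y : ℂ) ^ ((((k + 1 : ℕ) : ℝ) * β : ℝ) : ℂ) *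
          (y : ℂ) ^ ∑ m : Fin k, vline (c m.castSucc) (t m) := by
        rw [← Complex.cpow_add _ _ hy0]
        simp only [hp]
        push_cast
        ring
      rw [this]
      ring
    rw [hsplit, pow_succ, mul_assoc ((1 / (2 * Real.pi) : ℂ) ^ k), mul_assoc, ← integral_const_mul]
    simp_rw [hstep]
    -- exchange the integrals
    set w : ℝ → ℝ := fun z => stepPow β x' z * z ^ ((k : ℝ) * β) * ∏ m : Fin k,
      (z * x m.castSucc) ^ c m.castSucc with hw
    have hwint : Integrable w (volume.restrict (Set.Ioc 0 y)) := by
      refine Integrable.mono' ((integrableOn_rpow_Ioc hβ y).mul_const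
        (y ^ ((k : ℝ) * β) * ∏ m : Fin k, (y * x m.castSucc) ^ c m.castSucc))
        (Measurable.aestronglyMeasurable (by fun_prop)) ?_
      refine (ae_restrict_mem measurableSet_Ioc).mono fun z hz => ?_
      have hprod : ∀ m : Fin k, 0 ≤ z * x m.castSucc := fun m => mul_nonneg hz.1.le (hx _).le
      have hprod' : 0 ≤ ∏ m : Fin k, (z * x m.castSucc) ^ c m.castSucc :=
        Finset.prod_nonneg fun m _ => Real.rpow_nonneg (hprod m) _
      have hz1 := Real.rpow_nonneg hz.1.le ((k : ℝ) * β)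
      have hs := stepPow_nonneg (β := β) (x := x') hz.1.le
      simp only [hw]
      rw [Real.norm_of_nonneg (by positivity), mul_assoc]
      refine mul_le_mul (stepPow_le hz.1.le) ?_ (by positivity)
        (Real.rpow_nonneg hz.1.le _)
      refine mul_le_mul (Real.rpow_le_rpow hz.1.le hz.2 (by positivity)) ?_ hprod'
        (Real.rpow_nonneg hy.le _)
      refine Finset.prod_le_prod (fun m _ => Real.rpow_nonneg (hprod m) _) fun m _ => ?_
      exact Real.rpow_le_rpow (hprod m) (mul_le_mul_of_nonneg_right hz.2 (hx _).le) (hc _).le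
    -- On vertical lines the norm of a power depends on its base alone, so the integrand is
    -- dominated by the product of ‖A‖ and the weight `w`.
    rw [integral_integral_swap]
    swap
    · refine Integrable.mono' (hAint.norm.mul_prod hwint) ?_ ?_
      · refine Measurable.aestronglyMeasurable ?_
        refine Measurable.mul (by fun_prop) (Measurable.mul ?_ ?_)
        · exact (measurable_mbKer β k).comp (by fun_prop)
        · exact Finset.measurable_fun_prod _ fun m _ => by fun_prop
      · have : ∀ᵐ q : (Fin k → ℝ) × ℝ ∂(volume.prod (volume.restrict (Set.Ioc 0 y))),
            q.2 ∈ Set.Ioc 0 y :=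
          Measure.quasiMeasurePreserving_snd.ae (ae_restrict_mem measurableSet_Ioc)
        refine this.mono fun q hq => ?_
        have hs := stepPow_nonneg (β := β) (x := x') hq.1.le
        simp only [Function.uncurry, hw]
        rw [norm_mul, norm_mul, norm_mul, norm_prod_cpow_vline (fun m => mul_pos hq.1 (hx _)),
          Complex.norm_real, Real.norm_of_nonneg hs,
          Complex.norm_cpow_eq_rpow_re_of_pos hq.1, Complex.ofReal_re]
        exact le_of_eq (by ring)
    -- apply the induction hypothesis
    have hih : ∀ z ∈ Set.Ioc 0 y, (1 / (2 * Real.pi) : ℂ) ^ k *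
        ∫ t : Fin k → ℝ, (stepPow β x' z : ℂ) * (z : ℂ) ^ (((k : ℝ) * β : ℝ) : ℂ) *
          (A t * ∏ m, ((z * x m.castSucc : ℝ) : ℂ) ^ vline (c m.castSucc) (t m)) =
        (((stepFun β x' z * ordInt k (fun m => stepFun β (x m.castSucc)) z).toReal : ℝ) : ℂ) :=
      fun z hz => by
        rw [integral_const_mul, ENNReal.toReal_mul, stepFun,
          ENNReal.toReal_ofReal (stepPow_nonneg hz.1.le), Complex.ofReal_mul (stepPow β x' z),
          ← ih (c := fun m => c m.castSucc) (fun m => hc _) (fun m => hx _) hz.1]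
        ring
    rw [← integral_const_mul, setIntegral_congr_fun measurableSet_Ioc hih, integral_complex_ofReal,
      integral_toReal, ordInt_succ]
    · refine Measurable.aemeasurable (Measurable.mul (by fun_prop)
        (measurable_ordInt_right fun m => by fun_prop))
    · exact Eventually.of_forall fun z => ENNReal.mul_lt_top ENNReal.ofReal_lt_top
        (ordInt_stepFun_lt_top hβ _ z)

end MB

end XLOS

namespace XLOS

/-! ### The Gamma factor as an exponential weight -/

section Closed

lemma norm_Gamma_le_Gamma_re {s : ℂ} (hs : 0 < s.re) : ‖Complex.Gamma s‖ ≤ Real.Gamma s.re := by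
  rw [Complex.Gamma_eq_integral hs, Real.Gamma_eq_integral hs, Complex.GammaIntegral]
  refine (norm_integral_le_integral_norm _).trans_eq ?_
  refine setIntegral_congr_fun measurableSet_Ioi fun x hx => ?_
  rw [norm_mul, Complex.norm_real, Real.norm_of_nonneg (Real.exp_pos _).le,
    Complex.norm_cpow_eq_rpow_re_of_pos hx]
  simp

lemma ofReal_rpow_cpow {w : ℝ} (hw : 0 < w) (a : ℝ) (s : ℂ) :
    ((w ^ a : ℝ) : ℂ) ^ s = (w : ℂ) ^ ((a : ℂ) * s) := by
  rw [Complex.cpow_def_of_ne_zero (by exact_mod_cast (Real.rpow_pos_of_pos hw a).ne'),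
    Complex.cpow_def_of_ne_zero (by exact_mod_cast hw.ne'), ← Complex.ofReal_log
    (Real.rpow_nonneg hw.le a), Real.log_rpow hw, ← Complex.ofReal_log hw.le, Complex.ofReal_mul]
  ring_nf

/-- The weighted ordered integral to which the multivariate H-function evaluates. -/
noncomputable def closedVal {M : ℕ} (β Λ : ℝ) (x : Fin M → ℝ) : ENNReal :=
  ∫⁻ w in Set.Ioi (0 : ℝ), ENNReal.ofReal (Real.exp (-w)) *
    ordInt M (fun m => stepFun β (x m)) ((w / Λ) ^ β⁻¹)

variable {M : ℕ} {β Λ : ℝ} {c x X : Fin M → ℝ}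

lemma re_Gamma_arg (hβ : 0 < β) (hc : ∀ m, 0 < c m) (t : Fin M → ℝ) :
    ((M : ℂ) + 1 + ((β⁻¹ : ℝ) : ℂ) * ∑ m, vline (c m) (t m)).re = M + 1 + β⁻¹ * ∑ m, c m ∧
      0 < M + 1 + β⁻¹ * ∑ m, c m := by
  have := Finset.sum_nonneg fun m (_ : m ∈ Finset.univ) => (hc m).le
  refine ⟨?_, by positivity⟩
  rw [Complex.add_re, Complex.re_ofReal_mul, Complex.re_sum]
  simp

lemma continuous_Gamma_arg (hβ : 0 < β) (hc : ∀ m, 0 < c m) :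
    Continuous fun t : Fin M → ℝ =>
      Complex.Gamma ((M : ℂ) + 1 + ((β⁻¹ : ℝ) : ℂ) * ∑ m, vline (c m) (t m)) := by
  refine continuous_iff_continuousAt.mpr fun t => ?_
  have hre := re_Gamma_arg hβ hc t
  have h := (Complex.differentiableAt_Gamma
      ((M : ℂ) + 1 + ((β⁻¹ : ℝ) : ℂ) * ∑ m, vline (c m) (t m)) fun n hn => by
    have h2 := hre.2
    rw [← hre.1, hn, Complex.neg_re, Complex.natCast_re] at h2
    have : (0 : ℝ) ≤ n := Nat.cast_nonneg n
    linarith).continuousAt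
  exact ContinuousAt.comp (f := fun t : Fin M → ℝ => (M : ℂ) + 1 + ((β⁻¹ : ℝ) : ℂ) *
    ∑ m, vline (c m) (t m)) h (Continuous.continuousAt (by fun_prop))

/-- Since |Γ(s)| ≤ Γ(Re s) and Re s is constant on the contours, the Gamma factor is merely bounded;
its decay is not needed. -/
lemma integrable_Gamma_mul_mbKer (hβ : 0 < β) (hc : ∀ m, 0 < c m) (hX : ∀ m, 0 < X m) :
    Integrable fun t : Fin M → ℝ =>
      Complex.Gamma ((M : ℂ) + 1 + ((β⁻¹ : ℝ) : ℂ) * ∑ m, vline (c m) (t m)) *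
        ((mbKer β M fun m => vline (c m) (t m)) * ∏ m, (X m : ℂ) ^ vline (c m) (t m)) :=
  (integrable_mbKer_mul hβ hc hX).bdd_mul (c := Real.Gamma (M + 1 + β⁻¹ * ∑ m, c m))
    (continuous_Gamma_arg hβ hc).aestronglyMeasurable
    (Eventually.of_forall fun t => by
      have hre := re_Gamma_arg hβ hc t
      have := norm_Gamma_le_Gamma_re (hre.1 ▸ hre.2)
      rwa [hre.1] at this)

/-- The Gamma factor integrates the Mellin-Barnes representation of the ordered integral. -/
theorem integral_Gamma_mul_mbKer (hβ : 0 < β) (hΛ : 0 < Λ) (hc : ∀ m, 0 < c m)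
    (hx : ∀ m, 0 < x m) (hX : ∀ m, X m = x m * Λ ^ (-β⁻¹)) :
    (1 / (2 * Real.pi) : ℂ) ^ M * ∫ t : Fin M → ℝ,
      Complex.Gamma ((M : ℂ) + 1 + ((β⁻¹ : ℝ) : ℂ) * ∑ m, vline (c m) (t m)) *
        ((mbKer β M fun m => vline (c m) (t m)) * ∏ m, (X m : ℂ) ^ vline (c m) (t m)) =
      ((Λ ^ M * (closedVal β Λ x).toReal : ℝ) : ℂ) := by
  have hX0 : ∀ m, 0 < X m := fun m => by rw [hX]; exact mul_pos (hx m) (Real.rpow_pos_of_pos hΛ _)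
  set B : (Fin M → ℝ) → ℂ := fun t => (mbKer β M fun m => vline (c m) (t m)) *
    ∏ m, (X m : ℂ) ^ vline (c m) (t m) with hB
  have hBint : Integrable B := integrable_mbKer_mul hβ hc hX0
  set e : (Fin M → ℝ) → ℂ := fun t => (M : ℂ) + ((β⁻¹ : ℝ) : ℂ) * ∑ m, vline (c m) (t m) with he
  have hG : ∀ t : Fin M → ℝ,
      -- In Euler's integral the variables occur as w^{(ζ_1 + ⋯ + ζ_M)/β}, which rescales every
      -- argument X_m to w^{1/β} X_m.
      Complex.Gamma ((M : ℂ) + 1 + ((β⁻¹ : ℝ) : ℂ) * ∑ m, vline (c m) (t m)) * B t =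
      ∫ w in Set.Ioi (0 : ℝ), ((Real.exp (-w) : ℝ) : ℂ) * ((w : ℂ) ^ e t * B t) := fun t => by
    have hre := re_Gamma_arg hβ hc t
    rw [Complex.Gamma_eq_integral (hre.1 ▸ hre.2), Complex.GammaIntegral, ← integral_mul_const]
    refine setIntegral_congr_fun measurableSet_Ioi fun w _ => ?_
    simp only [he]
    rw [mul_assoc]
    congr 3
    ring
  have hrc : ∀ t, (e t).re = M + β⁻¹ * ∑ m, c m := fun t => by
    have := (re_Gamma_arg hβ hc t).1
    simp only [he]
    rw [add_right_comm, Complex.add_re, Complex.one_re] at this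
    linarith
  rw [integral_congr_ae (Eventually.of_forall hG), integral_integral_swap]
  swap
  · have hg : Integrable (fun w : ℝ => Real.exp (-w) * w ^ (M + β⁻¹ * ∑ m, c m))
        (volume.restrict (Set.Ioi 0)) := by
      have := Real.GammaIntegral_convergent (s := M + 1 + β⁻¹ * ∑ m, c m)
        (re_Gamma_arg (c := c) hβ hc 0).2
      rwa [show (M : ℝ) + 1 + β⁻¹ * ∑ m, c m - 1 = M + β⁻¹ * ∑ m, c m by ring] at this
    refine Integrable.mono' (hBint.norm.mul_prod hg) ?_ ?_
    · refine Measurable.aestronglyMeasurable ?_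
      refine Measurable.mul (by fun_prop) (Measurable.mul (by fun_prop)
        (Measurable.mul ?_ ?_))
      · exact (measurable_mbKer β M).comp (by fun_prop)
      · exact Finset.measurable_fun_prod _ fun m _ => by fun_prop
    · have : ∀ᵐ q : (Fin M → ℝ) × ℝ ∂(volume.prod (volume.restrict (Set.Ioi 0))),
          q.2 ∈ Set.Ioi (0 : ℝ) :=
        Measure.quasiMeasurePreserving_snd.ae (ae_restrict_mem measurableSet_Ioi)
      refine this.mono fun q hq => ?_
      simp only [Function.uncurry]
      rw [norm_mul, norm_mul, Complex.norm_real, Real.norm_of_nonneg (Real.exp_pos _).le,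
        Complex.norm_cpow_eq_rpow_re_of_pos hq, hrc]
      exact le_of_eq (by ring)
  rw [← integral_const_mul]
  have hpt : ∀ w ∈ Set.Ioi (0 : ℝ), (1 / (2 * Real.pi) : ℂ) ^ M *
      ∫ t : Fin M → ℝ, ((Real.exp (-w) : ℝ) : ℂ) * ((w : ℂ) ^ e t * B t) =
      ((Λ ^ M * (ENNReal.ofReal (Real.exp (-w)) *
        ordInt M (fun m => stepFun β (x m)) ((w / Λ) ^ β⁻¹)).toReal : ℝ) : ℂ) := fun w hw => by
    have hw : 0 < w := hw
    have hw0 : (w : ℂ) ≠ 0 := by exact_mod_cast hw.ne'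
    have hwΛ : 0 < w / Λ := div_pos hw hΛ
    have hy : 0 < (w / Λ) ^ β⁻¹ := Real.rpow_pos_of_pos hwΛ _
    have hwβ : 0 < w ^ β⁻¹ := Real.rpow_pos_of_pos hw _
    have hkey := integral_mbKer_eq_ordInt hβ hc hx hy
    -- At the height y = (w/Λ)^{1/β} the prefactor y^{Mβ} is (w/Λ)^M; compared with the w^M of
    -- Euler's integral it leaves the constant Λ^M.
    have hyM : (((w / Λ) ^ β⁻¹ : ℝ) : ℂ) ^ (((M : ℝ) * β : ℝ) : ℂ) = ((w / Λ) ^ M : ℝ) := by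
      rw [← Complex.ofReal_cpow hy.le, ← Real.rpow_mul hwΛ.le, mul_left_comm,
        inv_mul_cancel₀ hβ.ne', mul_one, Real.rpow_natCast]
    have hyx : ∀ m, (w / Λ) ^ β⁻¹ * x m = w ^ β⁻¹ * X m := fun m => by
      rw [hX, Real.div_rpow hw.le hΛ.le, Real.rpow_neg hΛ.le]
      ring
    have hBt : ∀ t, (w : ℂ) ^ e t * B t = (w : ℂ) ^ M * ((mbKer β M fun m => vline (c m) (t m)) *
        ∏ m, (((w / Λ) ^ β⁻¹ * x m : ℝ) : ℂ) ^ vline (c m) (t m)) := fun t => by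
      simp_rw [hyx]
      rw [prod_cpow_mul hX0 hwβ, ofReal_rpow_cpow hw]
      simp only [he, hB]
      rw [Complex.cpow_add _ _ hw0, Complex.cpow_natCast]
      ring
    simp_rw [hBt]
    rw [integral_const_mul, integral_const_mul, ENNReal.toReal_mul,
      ENNReal.toReal_ofReal (Real.exp_pos _).le, Complex.ofReal_mul, Complex.ofReal_mul, ← hkey,
      hyM]
    have hΛ0 : (Λ : ℂ) ≠ 0 := by exact_mod_cast hΛ.ne'
    generalize (∫ t : Fin M → ℝ, (mbKer β M fun m => vline (c m) (t m)) *
        ∏ m, (((w / Λ) ^ β⁻¹ * x m : ℝ) : ℂ) ^ vline (c m) (t m)) = J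
    push_cast
    rw [div_pow (w : ℂ)]
    field_simp
  rw [setIntegral_congr_fun measurableSet_Ioi hpt, integral_complex_ofReal, integral_const_mul,
    integral_toReal, closedVal]
  · refine Measurable.aemeasurable (Measurable.mul (by fun_prop) ?_)
    exact (measurable_ordInt_right fun m => by fun_prop).comp (by fun_prop)
  · exact Eventually.of_forall fun z => ENNReal.mul_lt_top ENNReal.ofReal_lt_top
      (ordInt_stepFun_lt_top hβ _ _)

/-- A bound for `closedVal` that does not depend on the thresholds. -/
lemma exists_closedVal_le (hβ : 0 < β) (hΛ : 0 < Λ) (M : ℕ) :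
    ∃ C : ENNReal, C < ⊤ ∧ ∀ x : Fin M → ℝ, closedVal β Λ x ≤ C := by
  refine ⟨∫⁻ w in Set.Ioi (0 : ℝ), ENNReal.ofReal (Real.exp (-w) *
    (((w / Λ) / β) ^ M)), ?_, fun x => ?_⟩
  · have := Real.GammaIntegral_convergent (s := M + 1) (by positivity)
    simp only [add_sub_cancel_right, Real.rpow_natCast] at this
    have := (this.mul_const ((Λ * β)⁻¹ ^ M)).lintegral_lt_top
    refine lt_of_eq_of_lt (lintegral_congr fun w => ?_) this
    congr 1
    rw [mul_assoc, ← mul_pow]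
    congr 2
    field_simp
  · refine setLIntegral_mono' measurableSet_Ioi fun w hw => ?_
    have hw : 0 < w := hw
    have hy : 0 ≤ (w / Λ) ^ β⁻¹ := by positivity
    rw [ENNReal.ofReal_mul (Real.exp_pos _).le]
    gcongr
    -- Without ordering and thresholds each factor integrates to y^β/β = w/(Λβ), whose M-th power
    -- has a finite exponential integral.
    refine (ordInt_le_prod (fun m => by fun_prop) _).trans ?_
    rw [ENNReal.ofReal_pow (by positivity)]
    refine (Finset.prod_le_pow_card _ _ (ENNReal.ofReal (w / Λ / β)) fun m _ => ?_).trans_eq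
      (by simp)
    have hint := integrableOn_rpow_Ioc hβ ((w / Λ) ^ β⁻¹)
    calc ∫⁻ z in Set.Ioc 0 ((w / Λ) ^ β⁻¹), stepFun β (x m) z
        ≤ ∫⁻ z in Set.Ioc 0 ((w / Λ) ^ β⁻¹), ENNReal.ofReal (z ^ (β - 1)) :=
          setLIntegral_mono' measurableSet_Ioc fun z hz =>
            ENNReal.ofReal_le_ofReal (stepPow_le hz.1.le)
      _ = ENNReal.ofReal (∫ z in Set.Ioc 0 ((w / Λ) ^ β⁻¹), z ^ (β - 1)) := by
          rw [ofReal_integral_eq_lintegral_ofReal hint]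
          exact (ae_restrict_mem measurableSet_Ioc).mono fun z hz => Real.rpow_nonneg hz.1.le _
      _ = ENNReal.ofReal (w / Λ / β) := by
          rw [← intervalIntegral.integral_of_le hy, integral_rpow (Or.inl (by linarith)),
            sub_add_cancel, ← Real.rpow_mul (by positivity), inv_mul_cancel₀ hβ.ne',
            Real.rpow_one, Real.zero_rpow hβ.ne', sub_zero]

end Closed

end XLOS

namespace XLOS

/-! ### Network constants and the collapse of the M-variate kernel -/

namespace Network

variable {N : ℕ} (net : Network N)

/-- A power moment of a lognormal law is the moment generating function of its Gaussian exponent,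
hence a true exponential and not the default value 0 of a divergent integral. -/
lemma Om_pos (n : Fin N) : 0 < net.Om n := by
  refine mul_pos (Real.rpow_pos_of_pos (net.power_pos n) _) ?_
  rw [lognormalDB, integral_map (by fun_prop) (by fun_prop)]
  have h1 : ∀ t : ℝ, ((10 : ℝ) ^ (t / 10)) ^ (2 / net.nu) =
      Real.exp ((Real.log 10 / 10 * (2 / net.nu)) * t) := fun t => by
    rw [← Real.rpow_mul (by norm_num), Real.rpow_def_of_pos (by norm_num)]
    congr 1
    ring
  simp_rw [h1]
  have h2 := congrFun (mgf_id_gaussianReal (μ := net.shadowMean n)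
    (v := (net.shadowSd n ^ 2).toNNReal)) (Real.log 10 / 10 * (2 / net.nu))
  simp only [mgf, id_eq] at h2
  rw [h2]
  exact Real.exp_pos _

lemma lamTilde_pos (n : Fin N) : 0 < net.lamTilde n := mul_pos (net.lam_pos n) (net.Om_pos n)

lemma lamT_pos [NeZero N] : 0 < net.lamT :=
  Finset.sum_pos (fun n _ => net.lamTilde_pos n) ⟨0, Finset.mem_univ _⟩

lemma K_pos (n : Fin N) : 0 < net.K n :=
  mul_pos (mul_pos (Real.rpow_pos_of_pos (div_pos (net.height_pos n) net.height0_pos) _)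
    (Real.rpow_pos_of_pos (div_pos (net.beam_pos n) net.beam0_pos) _)) net.K0_pos

lemma nodeGain_pos (u : ℝ) : 0 < net.nodeGain u := Real.rpow_pos_of_pos (by norm_num) _

/-- The mean number of cells in the unit disc, `π λ_T`. -/
noncomputable def rate : ℝ := Real.pi * net.lamT

lemma rate_pos [NeZero N] : 0 < net.rate := mul_pos Real.pi_pos net.lamT_pos

/-- The reciprocal threshold `K_th Ω_n^{α/2} / (ω K_n)` of tier `n`. -/
noncomputable def thr (Kth : ℝ) (n : Fin N) (u : ℝ) : ℝ :=
  Kth * net.Om n ^ (net.alpha / 2) / (net.nodeGain u * net.K n)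

lemma thr_pos {Kth : ℝ} (hK : 0 < Kth) (n : Fin N) (u : ℝ) : 0 < net.thr Kth n u :=
  div_pos (mul_pos hK (Real.rpow_pos_of_pos (net.Om_pos n) _))
    (mul_pos (net.nodeGain_pos u) (net.K_pos n))

/-- The exponent `2 / α`. -/
noncomputable def expo : ℝ := 2 / net.alpha

lemma expo_pos : 0 < net.expo := div_pos two_pos net.alpha_pos

lemma expo_inv : net.expo⁻¹ = net.alpha / 2 := by rw [expo, inv_div]

variable {M : ℕ}

/-- The scaling by Λ^{-1/β} required in `integral_Gamma_mul_mbKer`; it is why Λ_n replaces Ω_n in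
the arguments. -/
lemma foxArg_eq [NeZero N] (Kth : ℝ) (n : Fin M → Fin N) (u : Fin M → ℝ) (m : Fin M) :
    net.foxArg Kth n u m = net.thr Kth (n m) (u m) * net.rate ^ (-net.expo⁻¹) := by
  rw [foxArg, thr, Lam, expo_inv, ← rate, Real.div_rpow (net.Om_pos _).le net.rate_pos.le,
    Real.rpow_neg net.rate_pos.le]
  ring

lemma foxArg_pos [NeZero N] {Kth : ℝ} (hK : 0 < Kth) (n : Fin M → Fin N) (u : Fin M → ℝ)
    (m : Fin M) : 0 < net.foxArg Kth n u m := by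
  rw [foxArg_eq]
  exact mul_pos (net.thr_pos hK _ _) (Real.rpow_pos_of_pos net.rate_pos _)

lemma closedParams_separates {c : Fin M → ℝ} (hM : 0 < M) (hc : ∀ m, 0 < c m) :
    (net.closedParams M).Separates c := by
  have hα := net.alpha_pos
  refine ⟨fun q hq => ?_, fun m => stepParams_separates (hc m)⟩
  simp only [closedParams, List.mem_append, List.mem_ofFn, List.mem_singleton] at hq
  rcases hq with ⟨i, rfl⟩ | rfl
  · have h1 : 0 ≤ ∑ m : Fin M, (if (m : ℕ) ≤ i then (1 : ℝ) else 0) * c m :=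
      Finset.sum_nonneg fun m _ => by split_ifs <;> simp [(hc m).le]
    have h2 : 0 < 2 * ((i : ℝ) + 1) / net.alpha := by positivity
    simp only
    linarith
  · have h1 : 0 ≤ ∑ m : Fin M, net.alpha / 2 * c m :=
      Finset.sum_nonneg fun m _ => mul_nonneg (by positivity) (hc m).le
    have : (0 : ℝ) < M := by exact_mod_cast hM
    simp only
    linarith

/-- The outer Gamma quotients give the inverse partial sums for i < M only. The one for i = M comes
from Γ(M + 1 + S/β) = (M + S/β) Γ(M + S/β) with M + S/β = (α/2)(Mβ + S), which also explains the
factor α/2. -/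
lemma closedParams_integrand {c : Fin M → ℝ} (hM : 0 < M) (hc : ∀ m, 0 < c m)
    (X t : Fin M → ℝ) :
    ((net.alpha / 2 : ℝ) : ℂ) * (net.closedParams M).integrand c X t =
      Complex.Gamma ((M : ℂ) + 1 + ((net.expo⁻¹ : ℝ) : ℂ) * ∑ m, vline (c m) (t m)) *
        ((mbKer net.expo M fun m => vline (c m) (t m)) *
          ∏ m, (X m : ℂ) ^ vline (c m) (t m)) := by
  obtain ⟨k, rfl⟩ : ∃ k, M = k + 1 := ⟨M - 1, by omega⟩
  have hα := net.alpha_pos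
  have hβ := net.expo_pos
  have hv : ∀ m, (c m : ℂ) + t m * Complex.I = vline (c m) (t m) := fun m => rfl
  set ζ : Fin (k + 1) → ℂ := fun m => vline (c m) (t m) with hζ
  have hζre : ∀ m, (ζ m).re = c m := fun m => vline_re _ _
  -- the partial sums
  set W : Fin k → ℂ := fun i => (((((i : ℕ) : ℝ) + 1) * net.expo : ℝ) : ℂ) +
    ∑ m, if m ≤ i.castSucc then ζ m else 0 with hW
  have hWre : ∀ i, 0 < (W i).re := fun i => by
    simp only [hW, Complex.add_re, Complex.ofReal_re, Complex.re_sum]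
    have : 0 ≤ ∑ m, (if m ≤ i.castSucc then ζ m else 0).re :=
      Finset.sum_nonneg fun m _ => by split_ifs <;> simp [hζre, (hc m).le]
    positivity
  set S : ℂ := ∑ m, ζ m with hS
  have hSre : 0 < S.re := by
    rw [hS, Complex.re_sum]
    exact Finset.sum_pos (fun m _ => by rw [hζre]; exact hc m) ⟨0, Finset.mem_univ _⟩
  have hmb : mbKer net.expo (k + 1) ζ = (∏ i, (W i)⁻¹) *
      ((((k : ℝ) + 1) * net.expo : ℝ) + S)⁻¹ * ∏ m, (ζ m)⁻¹ := by
    rw [mbKer_eq_prod, Fin.prod_univ_castSucc]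
    simp [hW, hS, Fin.le_last]
  have hpsi : (net.closedParams (k + 1)).psi ζ =
      (∏ i, (W i)⁻¹) * Complex.Gamma ((k : ℂ) + 1 + ((net.expo⁻¹ : ℝ) : ℂ) * S) := by
    have e1 : ∀ i : Fin k, (1 : ℂ) - ((1 - 2 * ((i : ℝ) + 1) / net.alpha : ℝ) : ℂ) +
        ∑ m : Fin (k + 1), ((if (m : ℕ) ≤ i then (1 : ℝ) else 0 : ℝ) : ℂ) * ζ m = W i := fun i => by
      simp only [hW, expo]
      congr 1
      · push_cast; ring
      · refine Finset.sum_congr rfl fun m _ => ?_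
        simp only [Fin.le_def, Fin.val_castSucc]
        split_ifs <;> simp
    have e2 : ∀ i : Fin k, (1 : ℂ) - ((-(2 * ((i : ℝ) + 1) / net.alpha) : ℝ) : ℂ) +
        ∑ m : Fin (k + 1), ((if (m : ℕ) ≤ i then (1 : ℝ) else 0 : ℝ) : ℂ) * ζ m =
        W i + 1 := fun i => by
      rw [← e1]
      push_cast
      ring
    have e3 : (1 : ℂ) - ((1 - ((k + 1 : ℕ) : ℝ) : ℝ) : ℂ) +
        ∑ m : Fin (k + 1), ((net.alpha / 2 : ℝ) : ℂ) * ζ m =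
        (k : ℂ) + 1 + ((net.expo⁻¹ : ℝ) : ℂ) * S := by
      rw [← Finset.mul_sum, expo_inv]
      push_cast
      ring
    simp only [MultiFoxParams.psi, closedParams, List.map_append, List.prod_append, List.map_ofFn,
      List.prod_ofFn, List.map_cons, List.map_nil, List.prod_cons, List.prod_nil, mul_one,
      one_mul, Function.comp_def, Nat.add_sub_cancel]
    have hprod : (∏ i, Complex.Gamma (W i)) / ∏ i, Complex.Gamma (W i + 1) = ∏ i, (W i)⁻¹ := by
      rw [← Finset.prod_div_distrib]
      refine Finset.prod_congr rfl fun i _ => ?_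
      have h0 : W i ≠ 0 := fun h => by have := hWre i; simp [h] at this
      have hG := Complex.Gamma_ne_zero_of_re_pos (hWre i)
      rw [Complex.Gamma_add_one _ h0]
      field_simp
    rw [← hprod]
    have e1' : (∏ i, Complex.Gamma (W i)) = ∏ i : Fin k, Complex.Gamma ((1 : ℂ) -
      ((1 - 2 * ((i : ℝ) + 1) / net.alpha : ℝ) : ℂ) +
        ∑ m : Fin (k + 1), ((if (m : ℕ) ≤ i then (1 : ℝ) else 0 : ℝ) : ℂ) * ζ m) := by
      simp_rw [e1]
    have e2' : (∏ i, Complex.Gamma (W i + 1)) = ∏ i : Fin k, Complex.Gamma ((1 : ℂ) -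
      ((-(2 * ((i : ℝ) + 1) / net.alpha) : ℝ) : ℂ) +
        ∑ m : Fin (k + 1), ((if (m : ℕ) ≤ i then (1 : ℝ) else 0 : ℝ) : ℂ) * ζ m) := by
      simp_rw [e2]
    rw [e1', e2', ← e3, div_mul_eq_mul_div]
    rfl
  have hD : ((((k : ℝ) + 1) * net.expo : ℝ) : ℂ) + S ≠ 0 := fun h => by
    have := congrArg Complex.re h
    simp only [Complex.add_re, Complex.ofReal_re, Complex.zero_re] at this
    have h2 : 0 < ((k : ℝ) + 1) * net.expo := by positivity
    linarith
  have hβ0 : (net.expo : ℂ) ≠ 0 := by exact_mod_cast hβ.ne'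
  have hfac : (k : ℂ) + 1 + ((net.expo⁻¹ : ℝ) : ℂ) * S =
      ((net.alpha / 2 : ℝ) : ℂ) * (((((k : ℝ) + 1) * net.expo : ℝ) : ℂ) + S) := by
    rw [← expo_inv]
    push_cast
    field_simp
  have hne : (k : ℂ) + 1 + ((net.expo⁻¹ : ℝ) : ℂ) * S ≠ 0 := by
    rw [hfac]
    refine mul_ne_zero ?_ hD
    exact_mod_cast (by positivity : net.alpha / 2 ≠ 0)
  have hGam : Complex.Gamma (((k + 1 : ℕ) : ℂ) + 1 + ((net.expo⁻¹ : ℝ) : ℂ) * S) =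
      ((net.alpha / 2 : ℝ) : ℂ) * (((((k : ℝ) + 1) * net.expo : ℝ) : ℂ) + S) *
        Complex.Gamma ((k : ℂ) + 1 + ((net.expo⁻¹ : ℝ) : ℂ) * S) := by
    rw [← hfac, ← Complex.Gamma_add_one _ hne]
    congr 1
    push_cast
    ring
  have hinner : ∏ i, (((net.closedParams (k + 1)).inner i).phi (ζ i) * (X i : ℂ) ^ ζ i) =
      (∏ i, (ζ i)⁻¹) * ∏ i, (X i : ℂ) ^ ζ i := by
    rw [← Finset.prod_mul_distrib]
    refine Finset.prod_congr rfl fun i _ => ?_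
    congr 1
    exact stepParams_phi (by rw [hζre]; exact hc i)
  simp only [MultiFoxParams.integrand, hv]
  change _ * ((net.closedParams (k + 1)).psi ζ *
    ∏ i, (((net.closedParams (k + 1)).inner i).phi (ζ i) * (X i : ℂ) ^ ζ i)) = _
  have hX : ∏ m, (X m : ℂ) ^ vline (c m) (t m) = ∏ i, (X i : ℂ) ^ ζ i := rfl
  rw [hpsi, hinner, hGam, hmb, hX]
  linear_combination (-(((net.alpha / 2 : ℝ) : ℂ) * (∏ i, (W i)⁻¹) *
    Complex.Gamma ((k : ℂ) + 1 + ((net.expo⁻¹ : ℝ) : ℂ) * S) * (∏ i, (ζ i)⁻¹) *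
    ∏ i, (X i : ℂ) ^ ζ i)) * mul_inv_cancel₀ hD

lemma integrable_closedParams_integrand {c X : Fin M → ℝ} (hM : 0 < M) (hc : ∀ m, 0 < c m)
    (hX : ∀ m, 0 < X m) : Integrable ((net.closedParams M).integrand c X) := by
  have hα : ((net.alpha / 2 : ℝ) : ℂ) ≠ 0 := by exact_mod_cast (half_pos net.alpha_pos).ne'
  refine (integrable_const_mul_iff (isUnit_iff_ne_zero.mpr hα) _).mp ?_
  simp_rw [net.closedParams_integrand hM hc]
  exact integrable_Gamma_mul_mbKer net.expo_pos hc hX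

/-- The closed form, as an ordered integral. -/
theorem closedI1_eq [NeZero N] {Kth : ℝ} (hK : 0 < Kth) {c : Fin M → ℝ} (hM : 0 < M)
    (hc : ∀ m, 0 < c m) (n : Fin M → Fin N) (u : Fin M → ℝ) :
    net.closedI1 Kth c n u =
      (((closedVal net.expo net.rate fun m => net.thr Kth (n m) (u m)).toReal : ℝ) : ℂ) := by
  have hΛ0 : (net.rate : ℂ) ≠ 0 := by exact_mod_cast net.rate_pos.ne'
  have hkey := integral_Gamma_mul_mbKer net.expo_pos net.rate_pos hc
    (fun m => net.thr_pos hK (n m) (u m)) (net.foxArg_eq Kth n u)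
  simp_rw [← net.closedParams_integrand hM hc] at hkey
  rw [integral_const_mul] at hkey
  rw [closedI1, ← rate, MultiFoxParams.H, Complex.ofReal_mul]
  rw [Complex.ofReal_mul] at hkey
  have : (((net.rate ^ M)⁻¹ : ℝ) : ℂ) * ((net.rate ^ M : ℝ) : ℂ) = 1 := by
    rw [← Complex.ofReal_mul, inv_mul_cancel₀ (pow_pos net.rate_pos M).ne', Complex.ofReal_one]
  linear_combination (((net.rate ^ M)⁻¹ : ℝ) : ℂ) * hkey + this *
    (((closedVal net.expo net.rate fun m => net.thr Kth (n m) (u m)).toReal : ℝ) : ℂ)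

end Network

end XLOS

namespace XLOS

/-! ### Integrals over the ordered region -/

section Region

open Network

/-- The ordered region below the height `y`. -/
def orderedBelow (k : ℕ) (y : ℝ) : Set (Fin k → ℝ) := {z | z ∈ orderedRegion k ∧ ∀ m, z m ≤ y}

lemma mem_orderedRegion_succ {k : ℕ} (z : Fin (k + 1) → ℝ) :
    z ∈ orderedRegion (k + 1) ↔
      0 ≤ z (Fin.last k) ∧ (fun i => z i.castSucc) ∈ orderedBelow k (z (Fin.last k)) := by
  constructor
  · rintro ⟨h0, hm⟩
    exact ⟨h0 _, ⟨fun m => h0 _, fun i j h => hm (Fin.castSucc_le_castSucc_iff.mpr h)⟩,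
      fun m => hm (Fin.le_last _)⟩
  · rintro ⟨h0, ⟨h1, hm⟩, h2⟩
    refine ⟨fun m => ?_, fun i j h => ?_⟩
    · induction m using Fin.lastCases with
      | last => exact h0
      | cast m => exact h1 m
    · induction j using Fin.lastCases with
      | last =>
        induction i using Fin.lastCases with
        | last => exact le_rfl
        | cast i => exact h2 i
      | cast j =>
        induction i using Fin.lastCases with
        | last => exact absurd h (not_le.mpr (Fin.castSucc_lt_last j))
        | cast i => exact hm (Fin.castSucc_le_castSucc_iff.mp h)

lemma measurableSet_orderedRegion (k : ℕ) : MeasurableSet (orderedRegion k) := by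
  have : orderedRegion k = (⋂ m, {z | 0 ≤ z m}) ∩ ⋂ i, ⋂ j, {z | i ≤ j → z i ≤ z j} := by
    ext z
    simp [orderedRegion, Monotone]
  rw [this]
  refine MeasurableSet.inter (MeasurableSet.iInter fun m =>
    measurableSet_le measurable_const (measurable_pi_apply m)) (MeasurableSet.iInter fun i =>
    MeasurableSet.iInter fun j => ?_)
  by_cases h : i ≤ j
  · simpa [h] using measurableSet_le (measurable_pi_apply (X := fun _ => ℝ) i) (measurable_pi_apply j)
  · simp [h]

lemma measurableSet_orderedBelow_uncurry (k : ℕ) :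
    MeasurableSet {q : (Fin k → ℝ) × ℝ | q.1 ∈ orderedBelow k q.2} := by
  have : {q : (Fin k → ℝ) × ℝ | q.1 ∈ orderedBelow k q.2} =
      (Prod.fst ⁻¹' orderedRegion k) ∩ ⋂ m, {q | q.1 m ≤ q.2} := by
    ext q
    simp [orderedBelow]
  rw [this]
  exact (measurable_fst (measurableSet_orderedRegion k)).inter (MeasurableSet.iInter fun m =>
    measurableSet_le (by fun_prop) (by fun_prop))

lemma measurableSet_orderedBelow (k : ℕ) (y : ℝ) : MeasurableSet (orderedBelow k y) :=
  (measurable_id.prodMk measurable_const) (measurableSet_orderedBelow_uncurry k)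

/-- The hypothesis `hA` is the next lemma for one variable fewer, so the present one can be its
induction step. The weight `h` on the largest variable serves both as a cut-off and as the
exponential in I₁. -/
lemma lintegral_orderedRegion_of {k : ℕ} {f : Fin (k + 1) → ℝ → ENNReal} {h : ℝ → ENNReal}
    (hf : ∀ m, Measurable (f m)) (hh : Measurable h)
    (hA : ∀ t, 0 ≤ t → ∫⁻ z in orderedBelow k t, ∏ m, f m.castSucc (z m) =
      ordInt k (fun m => f m.castSucc) t) :
    ∫⁻ z in orderedRegion (k + 1), (∏ m, f m (z m)) * h (z (Fin.last k)) =
      ∫⁻ t in Set.Ioi 0, f (Fin.last k) t * h t * ordInt k (fun m => f m.castSucc) t := by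
  set S : Set ((Fin k → ℝ) × ℝ) := {q | q.1 ∈ orderedBelow k q.2} with hS
  have hSm : MeasurableSet S := measurableSet_orderedBelow_uncurry k
  set P : (Fin k → ℝ) × ℝ → ENNReal := fun q => ∏ m, f m.castSucc (q.1 m) with hP
  have hPm : Measurable P := Finset.measurable_fun_prod _ fun m _ => (hf _).comp (by fun_prop)
  set G : (Fin k → ℝ) × ℝ → ENNReal := fun q => (Set.Ici (0 : ℝ)).indicator (fun t =>
    f (Fin.last k) t * h t) q.2 * S.indicator P q with hG
  have hGm : Measurable G :=
    ((((hf _).mul hh).indicator measurableSet_Ici).comp measurable_snd).mul (hPm.indicator hSm)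
  have h1 : ∀ z : Fin (k + 1) → ℝ, (orderedRegion (k + 1)).indicator
      (fun z => (∏ m, f m (z m)) * h (z (Fin.last k))) z =
      G (fun i => z i.castSucc, z (Fin.last k)) := fun z => by
    by_cases hz : z ∈ orderedRegion (k + 1)
    · have hz' := (mem_orderedRegion_succ z).mp hz
      simp only [hG, hP]
      rw [Set.indicator_of_mem hz, Set.indicator_of_mem (Set.mem_Ici.mpr hz'.1),
        Set.indicator_of_mem (show _ ∈ S from hz'.2), Fin.prod_univ_castSucc]
      ring
    · rw [Set.indicator_of_notMem hz]
      rw [mem_orderedRegion_succ, not_and_or] at hz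
      rcases hz with hz | hz
      · simp only [hG]
        rw [Set.indicator_of_notMem (by simpa using hz), zero_mul]
      · simp only [hG]
        rw [Set.indicator_of_notMem (show _ ∉ S from hz), mul_zero]
  rw [← lintegral_indicator (measurableSet_orderedRegion _), lintegral_congr h1, lintegral_initLast,
    Measure.volume_eq_prod, lintegral_prod_symm _ hGm.aemeasurable, restrict_Ioi_eq_restrict_Ici,
    ← lintegral_indicator measurableSet_Ici]
  refine lintegral_congr fun t => ?_
  simp only [hG]
  have hm : Measurable fun z => S.indicator P (z, t) :=
    (hPm.indicator hSm).comp (measurable_id.prodMk measurable_const)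
  rw [lintegral_const_mul _ hm]
  by_cases ht : 0 ≤ t
  · rw [Set.indicator_of_mem (Set.mem_Ici.mpr ht), Set.indicator_of_mem (Set.mem_Ici.mpr ht),
      ← hA t ht, ← lintegral_indicator (measurableSet_orderedBelow k t)]
    rfl
  · rw [Set.indicator_of_notMem (by simpa using ht), Set.indicator_of_notMem (by simpa using ht),
      zero_mul]

lemma lintegral_orderedBelow {k : ℕ} {f : Fin k → ℝ → ENNReal} (hf : ∀ m, Measurable (f m))
    {y : ℝ} (hy : 0 ≤ y) : ∫⁻ z in orderedBelow k y, ∏ m, f m (z m) = ordInt k f y := by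
  induction k generalizing y with
  | zero =>
    have : orderedBelow 0 y = Set.univ := by
      ext z
      simp [orderedBelow, orderedRegion, Monotone]
    simp [this, volume_pi]
  | succ k ih =>
    -- Cutting off the largest coordinate at `y` bounds all of them.
    have h1 := lintegral_orderedRegion_of (h := (Set.Iic y).indicator 1) hf
      (measurable_one.indicator measurableSet_Iic) (fun t ht => ih (fun m => hf _) ht)
    have h2 : orderedBelow (k + 1) y = orderedRegion (k + 1) ∩ {z | z (Fin.last k) ≤ y} := by
      ext z
      exact ⟨fun h => ⟨h.1, h.2 _⟩, fun h => ⟨h.1, fun _ => (h.1.2 (Fin.le_last _)).trans h.2⟩⟩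
    have hm : MeasurableSet {z : Fin (k + 1) → ℝ | z (Fin.last k) ≤ y} :=
      measurableSet_le (by fun_prop) measurable_const
    rw [h2, Set.inter_comm, ← Measure.restrict_restrict hm, ← lintegral_indicator hm]
    refine Eq.trans (lintegral_congr fun z => ?_) (h1.trans ?_)
    · by_cases hz : z (Fin.last k) ≤ y <;> simp [Set.indicator, hz]
    · rw [ordInt_succ, ← Set.Ioi_inter_Iic, Set.inter_comm,
        ← Measure.restrict_restrict measurableSet_Iic, ← lintegral_indicator measurableSet_Iic]
      refine lintegral_congr fun t => ?_
      by_cases ht : t ≤ y <;> simp [Set.indicator, ht]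

lemma lintegral_orderedRegion {k : ℕ} {f : Fin (k + 1) → ℝ → ENNReal} {h : ℝ → ENNReal}
    (hf : ∀ m, Measurable (f m)) (hh : Measurable h) :
    ∫⁻ z in orderedRegion (k + 1), (∏ m, f m (z m)) * h (z (Fin.last k)) =
      ∫⁻ t in Set.Ioi 0, f (Fin.last k) t * h t * ordInt k (fun m => f m.castSucc) t :=
  lintegral_orderedRegion_of hf hh fun _ ht => lintegral_orderedBelow (fun _ => hf _) ht

lemma lintegral_exp_neg_Ici (a : ℝ) :
    ∫⁻ w in Set.Ici a, ENNReal.ofReal (Real.exp (-w)) = ENNReal.ofReal (Real.exp (-a)) := by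
  rw [← restrict_Ioi_eq_restrict_Ici, ← ofReal_integral_eq_lintegral_ofReal, integral_exp_neg_Ioi]
  · exact integrableOn_exp_neg_Ioi a
  · exact Eventually.of_forall fun _ => (Real.exp_pos _).le

/-- The exponential weight of the largest variable turns `closedVal` into a region integral. -/
lemma closedVal_eq_lintegral_region {k : ℕ} {β Λ : ℝ} (hβ : 0 < β) (hΛ : 0 < Λ)
    (x : Fin (k + 1) → ℝ) :
    ∫⁻ z in orderedRegion (k + 1), (∏ m, stepFun β (x m) (z m)) *
      ENNReal.ofReal (Real.exp (-(Λ * z (Fin.last k) ^ β))) = closedVal β Λ x := by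
  rw [lintegral_orderedRegion (h := fun t => ENNReal.ofReal (Real.exp (-(Λ * t ^ β))))
    (fun _ => by fun_prop) (by fun_prop), closedVal]
  have hm := measurable_ordInt_right (f := fun m => stepFun β (x (Fin.castSucc m)))
    (fun _ => by fun_prop)
  set g : ℝ → ENNReal := fun t => stepFun β (x (Fin.last k)) t *
    ordInt k (fun m => stepFun β (x m.castSucc)) t with hg
  have hgm : Measurable g := Measurable.mul (by fun_prop) hm
  have hS : MeasurableSet {q : ℝ × ℝ | Λ * q.1 ^ β ≤ q.2} :=
    measurableSet_le (by fun_prop) (by fun_prop)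
  -- The exponential is its own tail integral. After exchanging the integrals, Λ t^β ≤ w becomes the
  -- height restriction t ≤ (w/Λ)^{1/β}.
  have h1 : ∀ t, stepFun β (x (Fin.last k)) t * ENNReal.ofReal (Real.exp (-(Λ * t ^ β))) *
      ordInt k (fun m => stepFun β (x m.castSucc)) t =
      ∫⁻ w, (Set.Ici (Λ * t ^ β)).indicator (fun w => ENNReal.ofReal (Real.exp (-w))) w * g t :=
    fun t => by
      rw [lintegral_mul_const _ (Measurable.indicator (by fun_prop) measurableSet_Ici),
        lintegral_indicator measurableSet_Ici, lintegral_exp_neg_Ici]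
      simp only [hg]
      ring
  simp_rw [h1]
  rw [lintegral_lintegral_swap, ← lintegral_indicator measurableSet_Ioi]
  swap
  · refine Measurable.aemeasurable (Measurable.mul ?_ (hgm.comp measurable_fst))
    exact Measurable.indicator (f := fun q : ℝ × ℝ => ENNReal.ofReal (Real.exp (-q.2)))
      (by fun_prop) hS
  refine lintegral_congr fun w => ?_
  by_cases hw : 0 < w
  · rw [Set.indicator_of_mem (Set.mem_Ioi.mpr hw), ordInt_succ,
      ← lintegral_const_mul _ hgm, ← Set.Ioi_inter_Iic, Set.inter_comm,
      ← Measure.restrict_restrict measurableSet_Iic, ← lintegral_indicator measurableSet_Iic]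
    refine setLIntegral_congr_fun measurableSet_Ioi fun t ht => ?_
    have ht : 0 < t := ht
    have hiff : Λ * t ^ β ≤ w ↔ t ≤ (w / Λ) ^ β⁻¹ := by
      rw [Real.le_rpow_inv_iff_of_pos ht.le (by positivity) hβ, le_div_iff₀ hΛ, mul_comm]
    by_cases h : t ≤ (w / Λ) ^ β⁻¹
    · simp [Set.indicator, h, hiff.mpr h, hg]
    · simp [Set.indicator, h, hiff]
  · rw [Set.indicator_of_notMem (by simpa using hw)]
    refine (setLIntegral_congr_fun measurableSet_Ioi fun t ht => ?_).trans lintegral_zero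
    have ht : 0 < t := ht
    have : ¬ Λ * t ^ β ≤ w := fun h => hw ((by positivity : 0 < Λ * t ^ β).trans_le h)
    simp [Set.indicator, this]

end Region

end XLOS

namespace XLOS

/-! ### The closed form of I₁ and its regularity in the abscissas -/

namespace Network

variable {N : ℕ} (net : Network N) {M : ℕ}

lemma ae_coord_ne (a : Fin M → ℝ) : ∀ᵐ z : Fin M → ℝ, ∀ m, z m ≠ a m := by
  refine ae_all_iff.mpr fun m => ?_
  exact (Measure.quasiMeasurePreserving_eval (μ := fun _ : Fin M => (volume : Measure ℝ)) m).ae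
    (measure_eq_zero_iff_ae_notMem.mp (measure_singleton (a m)))

/-- The real-valued form of the integrand of `I₁`. -/
noncomputable def I1Real (Kth : ℝ) {k : ℕ} (n : Fin (k + 1) → Fin N) (u z : Fin (k + 1) → ℝ) : ℝ :=
  (∏ m, stepPow net.expo (net.thr Kth (n m) (u m)) (z m)) *
    Real.exp (-(net.rate * z (Fin.last k) ^ net.expo))

/-- Perron's formula covers positive arguments other than 1; the exceptional points form finitely
many coordinate hyperplanes, a null set. -/
lemma I1Integrand_ae_eq {Kth : ℝ} (hK : 0 < Kth) {k : ℕ} {a : Fin (k + 1) → ℝ}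
    (ha : ∀ m, 0 < a m) (n : Fin (k + 1) → Fin N) (u : Fin (k + 1) → ℝ) :
    net.I1Integrand Kth a n u =ᵐ[volume.restrict (orderedRegion (k + 1))]
      fun z => ((net.I1Real Kth n u z : ℝ) : ℂ) := by
  filter_upwards [ae_restrict_of_ae (ae_coord_ne (M := k + 1) 0),
    ae_restrict_of_ae (ae_coord_ne (M := k + 1) fun m => (net.thr Kth (n m) (u m))⁻¹),
    ae_restrict_mem (measurableSet_orderedRegion _)] with z h0 h1 hz
  have hpos : ∀ m, 0 < z m := fun m => lt_of_le_of_ne (hz.1 m) (h0 m).symm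
  have hne : ∀ m, z m * net.thr Kth (n m) (u m) ≠ 1 := fun m h =>
    h1 m (eq_inv_of_mul_eq_one_left h)
  have harg : ∀ m, Kth * net.Om (n m) ^ (net.alpha / 2) * z m /
      (net.nodeGain (u m) * net.K (n m)) = z m * net.thr Kth (n m) (u m) := fun m => by
    rw [thr]
    ring
  have hlast : (⟨k + 1 - 1, Nat.sub_lt (NeZero.pos (k + 1)) Nat.one_pos⟩ : Fin (k + 1)) =
      Fin.last k := rfl
  rw [I1Integrand, I1Real, hlast, Complex.ofReal_mul, Complex.ofReal_prod]
  congr 1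
  · refine Finset.prod_congr rfl fun m _ => ?_
    rw [harg, stepParams_H_of_ne_one (ha m) (mul_pos (hpos m) (net.thr_pos hK _ _)) (hne m),
      stepPow, expo]
    split_ifs <;> simp
  · rw [rate, expo]
    ring_nf

lemma I1Real_nonneg (Kth : ℝ) {k : ℕ} (n : Fin (k + 1) → Fin N) (u : Fin (k + 1) → ℝ)
    {z : Fin (k + 1) → ℝ} (hz : z ∈ orderedRegion (k + 1)) : 0 ≤ net.I1Real Kth n u z :=
  mul_nonneg (Finset.prod_nonneg fun m _ => stepPow_nonneg (hz.1 m)) (Real.exp_pos _).le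

lemma measurable_I1Real (Kth : ℝ) {k : ℕ} (n : Fin (k + 1) → Fin N) (u : Fin (k + 1) → ℝ) :
    Measurable (net.I1Real Kth n u) :=
  (Finset.measurable_fun_prod _ fun m _ => by fun_prop).mul (by fun_prop)

lemma lintegral_I1Real [NeZero N] (Kth : ℝ) {k : ℕ} (n : Fin (k + 1) → Fin N)
    (u : Fin (k + 1) → ℝ) :
    ∫⁻ z in orderedRegion (k + 1), ENNReal.ofReal (net.I1Real Kth n u z) =
      closedVal net.expo net.rate fun m => net.thr Kth (n m) (u m) := by
  rw [← closedVal_eq_lintegral_region net.expo_pos net.rate_pos]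
  refine setLIntegral_congr_fun (measurableSet_orderedRegion _) fun z hz => ?_
  have h := Finset.prod_nonneg fun m (_ : m ∈ Finset.univ) =>
    stepPow_nonneg (β := net.expo) (x := net.thr Kth (n m) (u m)) (hz.1 m)
  rw [I1Real, ENNReal.ofReal_mul h, ENNReal.ofReal_prod_of_nonneg fun m _ => stepPow_nonneg (hz.1 m)]
  rfl

lemma closedVal_lt_top [NeZero N] (x : Fin M → ℝ) : closedVal net.expo net.rate x < ⊤ := by
  obtain ⟨C, hC, h⟩ := exists_closedVal_le net.expo_pos net.rate_pos M
  exact (h x).trans_lt hC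

/-- Both sides equal `closedVal`, which depends on neither family of contours, so `a` and `c` are
unrelated. Absolute convergence is the finiteness of `closedVal`, the integrand being almost
everywhere nonnegative. -/
theorem I1_eq_closedI1 [NeZero N] [NeZero M] {Kth : ℝ} (hK : 0 < Kth) {a c : Fin M → ℝ}
    (ha : ∀ m, 0 < a m) (hc : ∀ m, 0 < c m) (n : Fin M → Fin N) (u : Fin M → ℝ) :
    IntegrableOn (net.I1Integrand Kth a n u) (orderedRegion M) ∧
      net.I1 Kth a n u = net.closedI1 Kth c n u := by
  rw [net.closedI1_eq hK (NeZero.pos M) hc]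
  obtain ⟨k, rfl⟩ : ∃ k, M = k + 1 := ⟨M - 1, (Nat.succ_pred_eq_of_pos (NeZero.pos M)).symm⟩
  have hae := net.I1Integrand_ae_eq hK ha n u
  have hnn : 0 ≤ᵐ[volume.restrict (orderedRegion (k + 1))] net.I1Real Kth n u :=
    (ae_restrict_mem (measurableSet_orderedRegion _)).mono fun z hz =>
      net.I1Real_nonneg Kth n u hz
  have hsm := (net.measurable_I1Real Kth n u).aestronglyMeasurable
    (μ := volume.restrict (orderedRegion (k + 1)))
  have hint : Integrable (net.I1Real Kth n u) (volume.restrict (orderedRegion (k + 1))) := by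
    refine ⟨hsm, (hasFiniteIntegral_iff_ofReal hnn).mpr ?_⟩
    rw [lintegral_I1Real]
    exact net.closedVal_lt_top _
  refine ⟨hint.ofReal.congr hae.symm, ?_⟩
  rw [I1]
  refine (integral_congr_ae hae).trans ?_
  rw [integral_complex_ofReal, integral_eq_lintegral_of_nonneg_ae hnn hsm, lintegral_I1Real]

/-! ### Dependence on the abscissas -/

lemma continuous_foxArg (Kth : ℝ) (n : Fin M → Fin N) (m : Fin M) :
    Continuous fun u => net.foxArg Kth n u m := by
  unfold foxArg nodeGain
  refine Continuous.div continuous_const ?_ fun u => ?_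
  · refine Continuous.mul ?_ continuous_const
    exact Continuous.rpow continuous_const (by fun_prop) fun _ => Or.inl (by norm_num)
  · exact (mul_pos (net.nodeGain_pos _) (net.K_pos _)).ne'

/-- Dominated convergence on fixed contours: the arguments affect the norm of the integrand only
through the factor ∏ X_m^{c_m}, which is continuous in `u` and so locally bounded. -/
theorem continuous_closedI1 [NeZero N] {Kth : ℝ} (hK : 0 < Kth) {c : Fin M → ℝ} (hM : 0 < M)
    (hc : ∀ m, 0 < c m) (n : Fin M → Fin N) : Continuous (net.closedI1 Kth c n) := by
  unfold closedI1 MultiFoxParams.H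
  refine continuous_const.mul (continuous_const.mul ?_)
  refine continuous_iff_continuousAt.mpr fun u₀ => ?_
  set P : (Fin M → ℝ) → ℝ := fun u => ∏ m, net.foxArg Kth n u m ^ c m with hP
  have hPc : Continuous P := continuous_finsetProd _ fun m _ =>
    (net.continuous_foxArg Kth n m).rpow_const fun _ => Or.inr (hc m).le
  have hnorm : ∀ u t, ‖(net.closedParams M).integrand c (net.foxArg Kth n u) t‖ =
      ‖(net.closedParams M).integrand c (fun _ => 1) t‖ * P u := fun u t => by
    have h1 : ∀ X : Fin M → ℝ, (∀ m, 0 < X m) →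
        ‖(net.closedParams M).integrand c X t‖ =
        ‖(net.closedParams M).psi fun i => vline (c i) (t i)‖ *
          ‖∏ i, ((net.closedParams M).inner i).phi (vline (c i) (t i))‖ * ∏ m, X m ^ c m :=
      fun X hX => by
        rw [← norm_prod_cpow_vline hX c t, ← norm_mul, ← norm_mul, mul_assoc,
          ← Finset.prod_mul_distrib]
        rfl
    rw [h1 _ (net.foxArg_pos hK n u), h1 _ fun _ => one_pos]
    simp [hP]
  refine continuousAt_of_dominated (bound := fun t =>
    ‖(net.closedParams M).integrand c (fun _ => 1) t‖ * (P u₀ + 1)) ?_ ?_ ?_ ?_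
  · exact Eventually.of_forall fun u =>
      (net.integrable_closedParams_integrand hM hc (net.foxArg_pos hK n u)).aestronglyMeasurable
  · filter_upwards [hPc.continuousAt.eventually (gt_mem_nhds (lt_add_one (P u₀)))] with u hu
    refine Eventually.of_forall fun t => ?_
    rw [hnorm]
    exact mul_le_mul_of_nonneg_left hu.le (norm_nonneg _)
  · exact (net.integrable_closedParams_integrand hM hc fun _ => one_pos).norm.mul_const _
  · refine Eventually.of_forall fun t => Continuous.continuousAt ?_
    unfold MultiFoxParams.integrand
    refine continuous_const.mul (continuous_finsetProd _ fun m _ => continuous_const.mul ?_)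
    refine Continuous.cpow (Complex.continuous_ofReal.comp (net.continuous_foxArg Kth n m))
      continuous_const fun u => ?_
    exact Complex.ofReal_mem_slitPlane.mpr (net.foxArg_pos hK n u m)

/-- The contour estimate is not uniform in `u` when σ_K > 0; the real representation is, because
dropping the thresholds removes `u` altogether. -/
lemma exists_norm_closedI1_le [NeZero N] {Kth : ℝ} (hK : 0 < Kth) {c : Fin M → ℝ} (hM : 0 < M)
    (hc : ∀ m, 0 < c m) (n : Fin M → Fin N) : ∃ C, ∀ u, ‖net.closedI1 Kth c n u‖ ≤ C := by
  obtain ⟨C, hC, h⟩ := exists_closedVal_le net.expo_pos net.rate_pos M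
  refine ⟨C.toReal, fun u => ?_⟩
  rw [net.closedI1_eq hK hM hc, Complex.norm_real, Real.norm_of_nonneg ENNReal.toReal_nonneg]
  exact ENNReal.toReal_mono hC.ne (h _)

end Network

/-! ### The Gaussian weight -/

section GaussWeight

variable {M : ℕ}

lemma gaussWeight_eq_prod (u : Fin M → ℝ) : gaussWeight u = ∏ m, Real.exp (-u m ^ 2) := by
  rw [gaussWeight, ← Real.exp_sum, Finset.sum_neg_distrib]

lemma gaussWeight_pos (u : Fin M → ℝ) : 0 < gaussWeight u := Real.exp_pos _

lemma integrable_gaussWeight : Integrable (gaussWeight : (Fin M → ℝ) → ℝ) := by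
  simp_rw [funext gaussWeight_eq_prod]
  have := integrable_exp_neg_mul_sq (b := 1) one_pos
  simp only [neg_mul, one_mul] at this
  exact Integrable.fintype_prod (f := fun _ x => Real.exp (-x ^ 2)) fun _ => this

lemma integrable_gaussWeight_mul {g : (Fin M → ℝ) → ℂ} (hg : Continuous g) {C : ℝ}
    (hC : ∀ u, ‖g u‖ ≤ C) : Integrable fun u => (gaussWeight u : ℂ) * g u :=
  integrable_gaussWeight.ofReal.mul_bdd (c := C) hg.aestronglyMeasurable
    (Eventually.of_forall hC)

end GaussWeight

end XLOS

namespace XLOS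

/-! ## Convergence of cubature rules -/

section Cubature

/-- The remainder of order d + 1 vanishes at 0 and its derivative is i times the remainder of order
d; integrating the bound t^d/d! gives the next one. -/
lemma norm_exp_I_sub_taylor_le_of_nonneg (d : ℕ) {x : ℝ} (hx : 0 ≤ x) :
    ‖Complex.exp (x * Complex.I) - ∑ j ∈ Finset.range d, (x * Complex.I) ^ j / (j.factorial : ℂ)‖ ≤
      x ^ d / d.factorial := by
  induction d generalizing x with
  | zero => simp [Complex.norm_exp_ofReal_mul_I]
  | succ d ih =>
    set g : ℝ → ℂ := fun t => Complex.exp (t * Complex.I) -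
      ∑ j ∈ Finset.range d, (t * Complex.I) ^ j / (j.factorial : ℂ) with hg
    set G : ℝ → ℂ := fun t => Complex.exp (t * Complex.I) -
      ∑ j ∈ Finset.range (d + 1), (t * Complex.I) ^ j / (j.factorial : ℂ) with hG
    have hline : ∀ t : ℝ, HasDerivAt (fun t : ℝ => (t : ℂ) * Complex.I) Complex.I t := fun t => by
      simpa using (Complex.ofRealCLM.hasDerivAt (x := t)).mul_const Complex.I
    have hderiv : ∀ t, HasDerivAt G (Complex.I * g t) t := fun t => by
      have h1 : HasDerivAt (fun t : ℝ => Complex.exp (t * Complex.I))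
          (Complex.exp (t * Complex.I) * Complex.I) t := (hline t).cexp
      have h2 : HasDerivAt (fun t : ℝ => ∑ j ∈ Finset.range (d + 1),
          ((t : ℂ) * Complex.I) ^ j / (j.factorial : ℂ)) (∑ j ∈ Finset.range (d + 1),
          ((j : ℂ) * ((t : ℂ) * Complex.I) ^ (j - 1) * Complex.I) / (j.factorial : ℂ)) t :=
        HasDerivAt.fun_sum fun j _ => ((hline t).fun_pow j).div_const _
      refine (h1.sub h2).congr_deriv ?_
      rw [Finset.sum_range_succ']
      simp only [hg, Nat.cast_zero, zero_mul, zero_div, add_zero, Nat.add_sub_cancel]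
      rw [mul_sub, Finset.mul_sum, mul_comm (Complex.exp _)]
      congr 1
      refine Finset.sum_congr rfl fun j _ => ?_
      rw [Nat.factorial_succ]
      have h3 : (j.factorial : ℂ) ≠ 0 := by exact_mod_cast j.factorial_ne_zero
      have h4 : (j : ℂ) + 1 ≠ 0 := by exact_mod_cast j.succ_ne_zero
      push_cast
      field_simp
    have hgc : Continuous g := by fun_prop
    have hFTC := intervalIntegral.integral_eq_sub_of_hasDerivAt (a := 0) (b := x)
      (fun t _ => hderiv t) (Continuous.intervalIntegrable (by fun_prop) _ _)
    have hG0 : G 0 = 0 := by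
      simp only [hG]
      rw [Finset.sum_range_succ']
      simp
    rw [hG0, sub_zero] at hFTC
    change ‖G x‖ ≤ _
    rw [← hFTC]
    calc ‖∫ t in (0 : ℝ)..x, Complex.I * g t‖ ≤ ∫ t in (0 : ℝ)..x, t ^ d / d.factorial := by
          refine intervalIntegral.norm_integral_le_of_norm_le hx ?_
            (Continuous.intervalIntegrable (by fun_prop) _ _)
          refine Eventually.of_forall fun t ht => ?_
          rw [norm_mul, Complex.norm_I, one_mul]
          exact ih ht.1.le
      _ = x ^ (d + 1) / (d + 1).factorial := by
          rw [intervalIntegral.integral_div, integral_pow, Nat.factorial_succ]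
          push_cast
          have h3 : (d.factorial : ℝ) ≠ 0 := by exact_mod_cast d.factorial_ne_zero
          have h4 : (d : ℝ) + 1 ≠ 0 := by exact_mod_cast d.succ_ne_zero
          field_simp
          simp

/-- The Taylor remainder of `e^{ix}`. -/
lemma norm_exp_I_sub_taylor_le (d : ℕ) (x : ℝ) :
    ‖Complex.exp (x * Complex.I) - ∑ j ∈ Finset.range d, (x * Complex.I) ^ j / (j.factorial : ℂ)‖ ≤
      |x| ^ d / d.factorial := by
  rcases le_total 0 x with hx | hx
  · rw [abs_of_nonneg hx]
    exact norm_exp_I_sub_taylor_le_of_nonneg d hx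
  · rw [abs_of_nonpos hx]
    refine le_trans (le_of_eq ?_) (norm_exp_I_sub_taylor_le_of_nonneg d (neg_nonneg.mpr hx))
    -- Conjugation exchanges the remainders at x and -x.
    rw [← Complex.norm_conj]
    simp only [map_sub, map_sum, map_div₀, map_pow, map_mul, Complex.conj_I, Complex.conj_ofReal,
      ← Complex.exp_conj, map_natCast, Complex.ofReal_neg, neg_mul, mul_neg]

variable {M : ℕ}

/-- By |t_m u_m| ≤ (t_m² + u_m²)/2 half of the Gaussian exponent survives. The exponential dominates
all |L|^d/d! at once, which gives integrability of the moments and their limit. -/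
lemma integrable_gaussWeight_mul_exp_abs (t : Fin M → ℝ) :
    Integrable fun u : Fin M → ℝ => gaussWeight u * Real.exp |∑ m, t m * u m| := by
  have h1 : ∀ s : ℝ, Integrable fun x : ℝ => Real.exp (s ^ 2 / 2) * Real.exp (-(1 / 2) * x ^ 2) :=
    fun s => (integrable_exp_neg_mul_sq (by norm_num)).const_mul _
  refine Integrable.mono' (Integrable.fintype_prod (f := fun m x =>
    Real.exp (t m ^ 2 / 2) * Real.exp (-(1 / 2) * x ^ 2)) fun m => h1 (t m)) ?_ ?_
  · refine Measurable.aestronglyMeasurable ?_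
    unfold gaussWeight
    fun_prop
  · refine Eventually.of_forall fun u => ?_
    rw [Real.norm_of_nonneg (by unfold gaussWeight; positivity), gaussWeight, ← Real.exp_add]
    simp_rw [← Real.exp_add]
    rw [← Real.exp_sum]
    refine Real.exp_le_exp.mpr ?_
    have h2 : |∑ m, t m * u m| ≤ ∑ m, |t m| * |u m| := by
      simp_rw [← abs_mul]
      exact Finset.abs_sum_le_sum_abs _ _
    refine (add_le_add_right h2 _).trans ?_
    rw [← Finset.sum_neg_distrib, ← Finset.sum_add_distrib]
    refine Finset.sum_le_sum fun m _ => ?_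
    nlinarith [sq_nonneg (|t m| - |u m|), sq_abs (t m), sq_abs (u m)]

lemma integrable_gaussWeight_mul_pow (t : Fin M → ℝ) (d : ℕ) :
    Integrable fun u : Fin M → ℝ => gaussWeight u * (∑ m, t m * u m) ^ d := by
  refine Integrable.mono' ((integrable_gaussWeight_mul_exp_abs t).const_mul d.factorial) ?_ ?_
  · refine Measurable.aestronglyMeasurable ?_
    unfold gaussWeight
    fun_prop
  · refine Eventually.of_forall fun u => ?_
    have hg : 0 < gaussWeight u := Real.exp_pos _
    have := Real.pow_div_factorial_le_exp _ (abs_nonneg (∑ m, t m * u m)) d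
    rw [div_le_iff₀ (by positivity)] at this
    rw [norm_mul, Real.norm_of_nonneg hg.le, norm_pow, Real.norm_eq_abs]
    calc gaussWeight u * |∑ m, t m * u m| ^ d
        ≤ gaussWeight u * (Real.exp |∑ m, t m * u m| * d.factorial) :=
          mul_le_mul_of_nonneg_left this hg.le
      _ = _ := by ring

lemma tendsto_gaussWeight_moment (t : Fin M → ℝ) :
    Tendsto (fun d : ℕ => ∫ u : Fin M → ℝ, gaussWeight u *
      (|∑ m, t m * u m| ^ d / d.factorial)) atTop (𝓝 0) := by
  have := tendsto_integral_of_dominated_convergence (μ := (volume : Measure (Fin M → ℝ)))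
    (F := fun (d : ℕ) u => gaussWeight u * (|∑ m, t m * u m| ^ d / d.factorial)) (f := fun _ => 0)
    (fun u => gaussWeight u * Real.exp |∑ m, t m * u m|)
    (fun d => Measurable.aestronglyMeasurable (by unfold gaussWeight; fun_prop))
    (integrable_gaussWeight_mul_exp_abs t)
    (fun d => Eventually.of_forall fun u => by
      have hg : 0 < gaussWeight u := Real.exp_pos _
      rw [Real.norm_of_nonneg (by positivity)]
      exact mul_le_mul_of_nonneg_left (Real.pow_div_factorial_le_exp _ (abs_nonneg _) d) hg.le)
    (Eventually.of_forall fun u => by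
      have := (FloorSemiring.tendsto_pow_div_factorial_atTop |∑ m, t m * u m|).const_mul
        (gaussWeight u)
      rwa [mul_zero] at this)
  rwa [integral_zero] at this

lemma Cubature.ExactTo.pow {R : Cubature M} {d : ℕ} (h : R.ExactTo d) (t : Fin M → ℝ) {j : ℕ}
    (hj : j ≤ d) : ∑ l, R.w l * (∑ m, t m * R.node l m) ^ j =
      ∫ u : Fin M → ℝ, gaussWeight u * (∑ m, t m * u m) ^ j := by
  have := h ((∑ m, MvPolynomial.C (t m) * MvPolynomial.X m) ^ j) (by
    refine (MvPolynomial.totalDegree_pow _ _).trans ?_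
    have h1 : (∑ m, MvPolynomial.C (t m) * MvPolynomial.X m :
        MvPolynomial (Fin M) ℝ).totalDegree ≤ 1 := by
      refine (MvPolynomial.totalDegree_finsetSum _ _).trans (Finset.sup_le fun m _ => ?_)
      refine (MvPolynomial.totalDegree_mul _ _).trans ?_
      simp [MvPolynomial.totalDegree_C, MvPolynomial.totalDegree_X]
    calc j * _ ≤ j * 1 := Nat.mul_le_mul_left _ h1
      _ ≤ d := by omega)
  simpa using this

/-- Exactness controls the error on characters. -/
lemma Cubature.ExactTo.norm_character_le {R : Cubature M} (hw : ∀ l, 0 ≤ R.w l) {j : ℕ}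
    (h : R.ExactTo (2 * j)) (t : Fin M → ℝ) :
    ‖R.apply (fun u => Complex.exp ((∑ m, t m * u m : ℝ) * Complex.I)) -
      ∫ u : Fin M → ℝ, (gaussWeight u : ℂ) * Complex.exp ((∑ m, t m * u m : ℝ) * Complex.I)‖ ≤
      2 * ∫ u : Fin M → ℝ, gaussWeight u * (|∑ m, t m * u m| ^ (2 * j) / (2 * j).factorial) := by
  set L : (Fin M → ℝ) → ℝ := fun u => ∑ m, t m * u m with hL
  set T : (Fin M → ℝ) → ℂ := fun u => ∑ i ∈ Finset.range (2 * j),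
    (L u * Complex.I) ^ i / (i.factorial : ℂ) with hT
  set E : (Fin M → ℝ) → ℂ := fun u => Complex.exp (L u * Complex.I) with hE
  have e1 : ∀ u, (gaussWeight u : ℂ) * T u = ∑ i ∈ Finset.range (2 * j),
      (Complex.I ^ i / (i.factorial : ℂ)) * ((gaussWeight u * L u ^ i : ℝ) : ℂ) := fun u => by
    rw [Finset.mul_sum]
    refine Finset.sum_congr rfl fun i _ => ?_
    push_cast
    ring
  have hTR : R.apply T = ∫ u : Fin M → ℝ, (gaussWeight u : ℂ) * T u := by
    simp_rw [e1]
    rw [integral_finsetSum _ fun i _ =>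
      ((integrable_gaussWeight_mul_pow t i).ofReal).const_mul _]
    simp_rw [integral_const_mul, integral_complex_ofReal]
    rw [Cubature.apply]
    simp only [hT, Finset.mul_sum]
    rw [Finset.sum_comm]
    refine Finset.sum_congr rfl fun i hi => ?_
    rw [← h.pow t (Finset.mem_range.mp hi).le]
    push_cast
    rw [Finset.mul_sum]
    refine Finset.sum_congr rfl fun l _ => ?_
    simp only [hL]
    push_cast
    ring
  have hrem : ∀ u, ‖E u - T u‖ ≤ |L u| ^ (2 * j) / (2 * j).factorial := fun u =>
    norm_exp_I_sub_taylor_le _ _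
  -- The even order makes the remainder bound a polynomial of degree 2j, so the rule with its
  -- nonnegative weights integrates it exactly. The same moment then bounds both errors, whence the
  -- factor 2.
  have hsq : ∀ u, |L u| ^ (2 * j) = L u ^ (2 * j) := fun u => (even_two_mul j).pow_abs _
  have hEint : Integrable fun u : Fin M → ℝ => (gaussWeight u : ℂ) * E u :=
    integrable_gaussWeight_mul (C := 1) (by fun_prop) fun u => by
      simp [hE, Complex.norm_exp_ofReal_mul_I]
  have hTint : Integrable fun u : Fin M → ℝ => (gaussWeight u : ℂ) * T u := by
    simp_rw [e1]
    exact integrable_finsetSum _ fun i _ =>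
      ((integrable_gaussWeight_mul_pow t i).ofReal).const_mul _
  have h1 : ‖R.apply E - R.apply T‖ ≤ ∫ u : Fin M → ℝ,
      gaussWeight u * (|L u| ^ (2 * j) / (2 * j).factorial) := by
    have h2 : ∫ u : Fin M → ℝ, gaussWeight u * (|L u| ^ (2 * j) / (2 * j).factorial) =
        ∑ l, R.w l * (|L (R.node l)| ^ (2 * j) / (2 * j).factorial) := by
      simp_rw [hsq, ← mul_div_assoc]
      rw [integral_div, ← h.pow t le_rfl, Finset.sum_div]
    rw [h2, Cubature.apply, Cubature.apply, ← Finset.sum_sub_distrib]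
    refine norm_sum_le_of_le _ fun l _ => ?_
    rw [← mul_sub, norm_mul, Complex.norm_real, Real.norm_of_nonneg (hw l)]
    exact mul_le_mul_of_nonneg_left (hrem _) (hw l)
  have h3 : ‖(∫ u : Fin M → ℝ, (gaussWeight u : ℂ) * E u) -
      ∫ u : Fin M → ℝ, (gaussWeight u : ℂ) * T u‖ ≤ ∫ u : Fin M → ℝ,
      gaussWeight u * (|L u| ^ (2 * j) / (2 * j).factorial) := by
    rw [← integral_sub hEint hTint]
    refine norm_integral_le_of_norm_le ?_ (Eventually.of_forall fun u => ?_)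
    · simp_rw [hsq, ← mul_div_assoc]
      exact (integrable_gaussWeight_mul_pow t _).div_const _
    · have hg : 0 < gaussWeight u := Real.exp_pos _
      rw [← mul_sub, norm_mul, Complex.norm_real, Real.norm_of_nonneg hg.le]
      exact mul_le_mul_of_nonneg_left (hrem _) hg.le
  calc _ = ‖(R.apply E - R.apply T) - ((∫ u : Fin M → ℝ, (gaussWeight u : ℂ) * E u) -
      ∫ u : Fin M → ℝ, (gaussWeight u : ℂ) * T u)‖ := by
        rw [hTR]
        congr 1
        ring
    _ ≤ _ := (norm_sub_le _ _).trans (by rw [two_mul]; exact add_le_add h1 h3)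

lemma tendsto_cubature_character {R : ℕ → Cubature M} (hw : ∀ k l, 0 ≤ (R k).w l)
    (hR : ∀ d : ℕ, ∀ᶠ k in atTop, (R k).ExactTo d) (t : Fin M → ℝ) :
    Tendsto (fun k => (R k).apply fun u => Complex.exp ((∑ m, t m * u m : ℝ) * Complex.I)) atTop
      (𝓝 (∫ u : Fin M → ℝ, (gaussWeight u : ℂ) *
        Complex.exp ((∑ m, t m * u m : ℝ) * Complex.I))) := by
  rw [Metric.tendsto_nhds]
  intro ε hε
  have h1 := ((tendsto_gaussWeight_moment t).comp
    (tendsto_id.const_mul_atTop' (zero_lt_two' ℕ))).const_mul 2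
  rw [mul_zero] at h1
  obtain ⟨j, hj⟩ := (h1.eventually (gt_mem_nhds hε)).exists
  filter_upwards [hR (2 * j)] with k hk
  rw [dist_eq_norm]
  exact (hk.norm_character_le (hw k) t).trans_lt hj

end Cubature

end XLOS

namespace XLOS

/-! ### From characters to bounded continuous functions -/

section CubatureLimit

variable {M : ℕ}

/-- The total mass of the Gaussian weight. -/
noncomputable def gaussMass (M : ℕ) : ℝ := ∫ u : Fin M → ℝ, gaussWeight u

lemma gaussMass_pos : 0 < gaussMass M := by
  refine (integral_pos_iff_support_of_nonneg (fun u => (gaussWeight_pos u).le)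
    integrable_gaussWeight).mpr ?_
  have : Function.support (gaussWeight : (Fin M → ℝ) → ℝ) = Set.univ := by
    ext u
    simp [(gaussWeight_pos u).ne']
  rw [this]
  exact isOpen_univ.measure_pos _ ⟨0, trivial⟩

/-- The normalised Gaussian law on Euclidean space. -/
noncomputable def gaussLaw (M : ℕ) : Measure (EuclideanSpace ℝ (Fin M)) :=
  ((volume : Measure (Fin M → ℝ)).withDensity fun u =>
    ENNReal.ofReal (gaussWeight u / gaussMass M)).map (WithLp.toLp 2)

/-- The normalised discrete law of a cubature rule on Euclidean space. -/
noncomputable def Cubature.law (R : Cubature M) : Measure (EuclideanSpace ℝ (Fin M)) :=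
  ∑ l, ENNReal.ofReal (R.w l / gaussMass M) • Measure.dirac (WithLp.toLp 2 (R.node l))

lemma measurable_gaussWeight : Measurable (gaussWeight : (Fin M → ℝ) → ℝ) := by
  unfold gaussWeight; fun_prop

instance : IsProbabilityMeasure (gaussLaw M) := by
  refine @Measure.isProbabilityMeasure_map _ _ _ _ _ ?_ _ (by fun_prop)
  refine ⟨?_⟩
  rw [withDensity_apply _ MeasurableSet.univ, Measure.restrict_univ,
    ← ofReal_integral_eq_lintegral_ofReal (integrable_gaussWeight.div_const _)
      (Eventually.of_forall fun u => div_nonneg (gaussWeight_pos _).le gaussMass_pos.le),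
    integral_div, ← gaussMass, div_self gaussMass_pos.ne', ENNReal.ofReal_one]

lemma Cubature.isProbabilityMeasure_law {R : Cubature M} (hw : ∀ l, 0 ≤ R.w l)
    (h : R.ExactTo 0) : IsProbabilityMeasure R.law := by
  refine ⟨?_⟩
  have h1 : ∑ l, R.w l = gaussMass M := by simpa [gaussMass] using h.pow 0 le_rfl
  simp only [Cubature.law, Measure.coe_finsetSum, Finset.sum_apply, Measure.smul_apply,
    measure_univ, smul_eq_mul, mul_one]
  rw [← ENNReal.ofReal_sum_of_nonneg fun l _ => div_nonneg (hw l) gaussMass_pos.le,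
    ← Finset.sum_div, h1, div_self gaussMass_pos.ne', ENNReal.ofReal_one]

lemma integral_gaussLaw (f : EuclideanSpace ℝ (Fin M) → ℂ) :
    ∫ v, f v ∂(gaussLaw M) = (gaussMass M : ℂ)⁻¹ *
      ∫ u : Fin M → ℝ, (gaussWeight u : ℂ) * f (WithLp.toLp 2 u) := by
  rw [gaussLaw, ← MeasurableEquiv.coe_toLp, integral_map_equiv,
    integral_withDensity_eq_integral_toReal_smul
      ((measurable_gaussWeight.div_const _).ennreal_ofReal)
      (Eventually.of_forall fun _ => ENNReal.ofReal_lt_top), ← integral_const_mul]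
  refine integral_congr_ae (Eventually.of_forall fun u => ?_)
  simp only [MeasurableEquiv.coe_toLp]
  rw [ENNReal.toReal_ofReal (div_nonneg (gaussWeight_pos _).le gaussMass_pos.le), Complex.real_smul]
  push_cast
  ring

lemma Cubature.integral_law {R : Cubature M} (hw : ∀ l, 0 ≤ R.w l)
    (f : EuclideanSpace ℝ (Fin M) → ℂ) :
    ∫ v, f v ∂(R.law) = (gaussMass M : ℂ)⁻¹ * R.apply fun u => f (WithLp.toLp 2 u) := by
  rw [Cubature.law, integral_finsetSum_measure fun l _ =>
    (integrable_dirac (by simp)).smul_measure ENNReal.ofReal_ne_top, Cubature.apply, Finset.mul_sum]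
  refine Finset.sum_congr rfl fun l _ => ?_
  rw [integral_smul_measure, integral_dirac,
    ENNReal.toReal_ofReal (div_nonneg (hw l) gaussMass_pos.le), Complex.real_smul]
  push_cast
  ring

/-- Cubature rules with nonnegative weights and increasing degree of exactness converge on
bounded continuous functions. -/
theorem tendsto_cubature_apply {R : ℕ → Cubature M} (hw : ∀ k l, 0 ≤ (R k).w l)
    (hR : ∀ d : ℕ, ∀ᶠ k in atTop, (R k).ExactTo d) {g : (Fin M → ℝ) → ℂ} (hg : Continuous g)
    {C : ℝ} (hC : ∀ u, ‖g u‖ ≤ C) :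
    Tendsto (fun k => (R k).apply g) atTop
      (𝓝 (∫ u : Fin M → ℝ, (gaussWeight u : ℂ) * g u)) := by
  obtain ⟨k₀, hk₀⟩ := eventually_atTop.mp (hR 0)
  -- Exactness in degree 0 fixes the total mass, so the shifted rules normalise to probability
  -- measures.
  refine (tendsto_add_atTop_iff_nat k₀).mp ?_
  have hP : ∀ k, IsProbabilityMeasure (R (k + k₀)).law := fun k =>
    Cubature.isProbabilityMeasure_law (hw _) (hk₀ _ (Nat.le_add_left _ _))
  set ν : ℕ → ProbabilityMeasure (EuclideanSpace ℝ (Fin M)) := fun k => ⟨(R (k + k₀)).law, hP k⟩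
    with hν
  set ν₀ : ProbabilityMeasure (EuclideanSpace ℝ (Fin M)) := ⟨gaussLaw M, inferInstance⟩ with hν₀
  have hchar : ∀ t : EuclideanSpace ℝ (Fin M),
      Tendsto (fun k => charFun (ν k : Measure (EuclideanSpace ℝ (Fin M))) t) atTop
        (𝓝 (charFun (ν₀ : Measure (EuclideanSpace ℝ (Fin M))) t)) := fun t => by
    have hin : ∀ u : Fin M → ℝ, inner ℝ (WithLp.toLp 2 u) t = ∑ m, t m * u m := fun u => by
      simp [PiLp.inner_apply]
    simp only [charFun_apply, hν, hν₀, ProbabilityMeasure.coe_mk]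
    simp_rw [Cubature.integral_law (hw _), integral_gaussLaw, hin]
    exact ((tendsto_add_atTop_iff_nat k₀).mpr
      (tendsto_cubature_character hw hR fun m => t m)).const_mul _
  -- Lévy's continuity theorem; tightness of the rules is not shown separately.
  have hlim := ProbabilityMeasure.tendsto_of_tendsto_charFun hchar
  rw [ProbabilityMeasure.tendsto_iff_forall_integral_rclike_tendsto ℂ] at hlim
  have hgc : Continuous fun v : EuclideanSpace ℝ (Fin M) => g (WithLp.ofLp v) :=
    hg.comp (PiLp.continuous_ofLp 2 _)
  have h1 := hlim (BoundedContinuousFunction.ofNormedAddCommGroup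
    (fun v : EuclideanSpace ℝ (Fin M) => g (WithLp.ofLp v)) hgc C fun v => hC _)
  simp only [BoundedContinuousFunction.coe_ofNormedAddCommGroup, hν, hν₀,
    ProbabilityMeasure.coe_mk] at h1
  simp_rw [Cubature.integral_law (hw _), integral_gaussLaw] at h1
  have hm : (gaussMass M : ℂ) ≠ 0 := by exact_mod_cast gaussMass_pos.ne'
  have h2 := h1.const_mul (gaussMass M : ℂ)
  simpa only [mul_inv_cancel_left₀ hm] using h2

end CubatureLimit

end XLOS

namespace XLOS

/-! ## The generating functional of a Poisson point process -/

section InfProd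

variable {ι : Type*}

/-- The infinite product of a family of numbers in `[0, 1]`. -/
noncomputable def infProd (x : ι → ENNReal) : ENNReal := ⨅ s : Finset ι, ∏ i ∈ s, x i

lemma prod_le_prod_of_subset_of_le_one {x : ι → ENNReal} (hx : ∀ i, x i ≤ 1) {s t : Finset ι}
    (h : s ⊆ t) : ∏ i ∈ t, x i ≤ ∏ i ∈ s, x i := by
  classical
  rw [← Finset.prod_sdiff h]
  exact mul_le_of_le_one_left' (Finset.prod_le_one' fun i _ => hx i)

lemma antitone_finset_prod {x : ι → ENNReal} (hx : ∀ i, x i ≤ 1) :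
    Antitone fun s : Finset ι => ∏ i ∈ s, x i :=
  fun _ _ h => prod_le_prod_of_subset_of_le_one hx h

lemma infProd_eq_prod {x : ι → ENNReal} (hx : ∀ i, x i ≤ 1) {S : Finset ι}
    (hS : ∀ i, i ∉ S → x i = 1) : infProd x = ∏ i ∈ S, x i := by
  classical
  refine le_antisymm (iInf_le _ S) (le_iInf fun s => ?_)
  calc ∏ i ∈ S, x i = ∏ i ∈ s ∪ S, x i :=
        Finset.prod_subset Finset.subset_union_right fun i _ hi => hS i hi
    _ ≤ ∏ i ∈ s, x i := prod_le_prod_of_subset_of_le_one hx Finset.subset_union_left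

lemma infProd_le_one (x : ι → ENNReal) : infProd x ≤ 1 :=
  (iInf_le _ ∅).trans (by simp)

lemma infProd_mono {x y : ι → ENNReal} (h : ∀ i, x i ≤ y i) : infProd x ≤ infProd y :=
  iInf_mono fun _ => Finset.prod_le_prod' fun i _ => h i

lemma prod_iInf_of_antitone {x : ℕ → ι → ENNReal} (hx : ∀ n i, x n i ≤ 1)
    (hanti : Antitone x) (s : Finset ι) :
    ∏ i ∈ s, ⨅ n, x n i = ⨅ n, ∏ i ∈ s, x n i := by
  have h1 : Tendsto (fun n => ∏ i ∈ s, x n i) atTop (𝓝 (∏ i ∈ s, ⨅ n, x n i)) := by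
    refine ENNReal.tendsto_finsetProd_of_ne_top s (fun i _ => ?_) fun i _ => ?_
    · exact tendsto_atTop_iInf fun n m h => hanti h i
    · exact ((iInf_le _ 0).trans_lt ((hx 0 i).trans_lt ENNReal.one_lt_top)).ne
  refine tendsto_nhds_unique h1 (tendsto_atTop_iInf fun n m h => ?_)
  exact Finset.prod_le_prod' fun i _ => hanti h i

/-- With the infinite product defined as an infimum of finite products, passing to a decreasing
limit is an exchange of two infima. -/
lemma infProd_iInf_of_antitone {x : ℕ → ι → ENNReal} (hx : ∀ n i, x n i ≤ 1)
    (hanti : Antitone x) : infProd (fun i => ⨅ n, x n i) = ⨅ n, infProd (x n) := by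
  unfold infProd
  rw [iInf_comm]
  exact iInf_congr fun s => prod_iInf_of_antitone hx hanti s

lemma Measurable.infProd [Countable ι] {A : Type*} [MeasurableSpace A] {x : A → ι → ENNReal}
    (hx : ∀ i, Measurable fun a => x a i) : Measurable fun a => infProd (x a) :=
  Measurable.iInf fun _ => Finset.measurable_fun_prod _ fun i _ => hx i

/-- An infinite product over a product index set. -/
lemma infProd_prod {N : ℕ} {x : Fin N × ℕ → ENNReal} (hx : ∀ p, x p ≤ 1) :
    infProd x = ∏ n, infProd fun i => x (n, i) := by
  have h1 : Tendsto (fun k : ℕ => ∏ n, ∏ i ∈ Finset.range k, x (n, i)) atTop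
      (𝓝 (∏ n, infProd fun i => x (n, i))) := by
    refine ENNReal.tendsto_finsetProd_of_ne_top _ (fun n _ => ?_) fun n _ => ?_
    · exact (tendsto_atTop_iInf (antitone_finset_prod fun i => hx (n, i))).comp
        tendsto_finset_range
    · exact ((infProd_le_one _).trans_lt ENNReal.one_lt_top).ne
  have h2 : Tendsto (fun k : ℕ => ∏ n, ∏ i ∈ Finset.range k, x (n, i)) atTop (𝓝 (infProd x)) := by
    have h3 : Tendsto (fun k : ℕ => (Finset.univ : Finset (Fin N)) ×ˢ Finset.range k) atTop
        atTop := by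
      refine tendsto_atTop_finset_of_monotone (fun a b h => ?_) fun p => ⟨p.2 + 1, ?_⟩
      · exact Finset.product_subset_product le_rfl (Finset.range_mono h)
      · simp
    refine ((tendsto_atTop_iInf (antitone_finset_prod hx)).comp h3).congr fun k => ?_
    simp [Finset.prod_product]
  exact tendsto_nhds_unique h2 h1

end InfProd

section PPP

variable {Ω : Type*} [MeasurableSpace Ω] {μ : Measure Ω} {E : Type*} [MeasurableSpace E]

/-- The terms are e^{-r(1-v)} times the Poisson weights of mean rv, which sum to 1. -/
lemma lintegral_pow_poissonMeasure (r : NNReal) {v : ENNReal} (hv : v ≤ 1) :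
    ∫⁻ k, v ^ k ∂(poissonMeasure r) = ENNReal.ofReal (Real.exp (-(r * (1 - v.toReal)))) := by
  have hvt : v ≠ ⊤ := (hv.trans_lt ENNReal.one_lt_top).ne
  have hs : HasSum (fun k : ℕ => Real.exp (-r) * r ^ k / k.factorial * v.toReal ^ k)
      (Real.exp (-(r * (1 - v.toReal)))) := by
    have h := (hasSum_one_poissonMeasure (r * v.toNNReal)).mul_left
      (Real.exp (-(r * (1 - v.toReal))))
    rw [mul_one] at h
    refine h.congr_fun fun k => ?_
    have : Real.exp (-(r * (1 - v.toReal))) * Real.exp (-((r * v.toNNReal : NNReal) : ℝ)) =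
        Real.exp (-r) := by
      rw [← Real.exp_add]
      congr 1
      push_cast
      ring
    rw [← this]
    push_cast
    ring
  rw [lintegral_countable']
  have h1 : ∀ k : ℕ, v ^ k * poissonMeasure r {k} =
      ENNReal.ofReal (Real.exp (-r) * r ^ k / k.factorial * v.toReal ^ k) := fun k => by
    rw [poissonMeasure_singleton, mul_comm, ENNReal.ofReal_mul (by positivity),
      ENNReal.ofReal_pow ENNReal.toReal_nonneg, ENNReal.ofReal_toReal hvt]
  simp_rw [h1]
  rw [← ENNReal.ofReal_tsum_of_nonneg (fun k => by positivity) hs.summable, hs.tsum_eq]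

namespace IsPoissonPointProcess

variable {X : ℕ → Ω → E} {Λ : Measure E}

lemma ae_pointCount_ne_top (h : IsPoissonPointProcess X Λ μ) {B : Set E} (hB : MeasurableSet B)
    (hΛ : Λ B ≠ ⊤) : ∀ᵐ ω ∂μ, pointCount X B ω ≠ ⊤ := by
  refine ((h.hasLaw_count B hB hΛ).ae_iff (p := fun n => n ≠ ⊤) .of_discrete).mpr ?_
  rw [ae_map_iff .of_discrete .of_discrete]
  exact Eventually.of_forall fun k => ENat.natCast_ne_top k

/-- `toNat` sends an infinite count to 0; this is harmless because the law of the count lives on the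
finite values. -/
lemma lintegral_pow_pointCount (h : IsPoissonPointProcess X Λ μ) {B : Set E}
    (hB : MeasurableSet B) (hΛ : Λ B ≠ ⊤) {v : ENNReal} (hv : v ≤ 1) :
    ∫⁻ ω, v ^ (pointCount X B ω).toNat ∂μ =
      ENNReal.ofReal (Real.exp (-((Λ B).toReal * (1 - v.toReal)))) := by
  have h1 := (h.hasLaw_count B hB hΛ).lintegral_comp (f := fun n : ℕ∞ => v ^ n.toNat)
    (Measurable.of_discrete).aemeasurable
  rw [h1, lintegral_map .of_discrete .of_discrete]
  simp only [ENat.toNat_natCast]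
  rw [lintegral_pow_poissonMeasure _ hv, ENNReal.coe_toNNReal_eq_toReal]

lemma measurable_pointCount (h : IsPoissonPointProcess X Λ μ) {B : Set E} (hB : MeasurableSet B) :
    Measurable (pointCount X B) := by
  refine measurable_encard.comp (measurable_set_iff.mpr fun i => ?_)
  exact measurableSet_setOfPred.mp ((h.measurable i) hB)

/-- The generating functional at a simple function. -/
lemma lintegral_infProd_simpleFunc (h : IsPoissonPointProcess X Λ μ) [IsProbabilityMeasure μ]
    (g : SimpleFunc E ENNReal) (hg : ∀ y, g y ≤ 1) {B : Set E} (hB : MeasurableSet B)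
    (hΛ : Λ B ≠ ⊤) (hgB : ∀ y, y ∉ B → g y = 1) :
    ∫⁻ ω, infProd (fun i => g (X i ω)) ∂μ =
      ENNReal.ofReal (Real.exp (-(∫⁻ y, (1 - g y) ∂Λ).toReal)) := by
  classical
  -- The value 1 contributes nothing to the product, and its fibre, which contains the complement of
  -- `B`, may have infinite mass.
  set V : Finset ENNReal := g.range.erase 1 with hV
  set e := V.equivFin with he
  set v : Fin V.card → ENNReal := fun j => (e.symm j : ENNReal) with hv
  have hvV : ∀ j, v j ∈ V := fun j => (e.symm j).2
  have hv1 : ∀ j, v j ≠ 1 := fun j => (Finset.mem_erase.mp (hvV j)).1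
  have hvle : ∀ j, v j ≤ 1 := fun j => by
    obtain ⟨y, hy⟩ := SimpleFunc.mem_range.mp (Finset.mem_erase.mp (hvV j)).2
    exact hy ▸ hg y
  have hvinj : Function.Injective v := Subtype.val_injective.comp e.symm.injective
  set A : Fin V.card → Set E := fun j => g ⁻¹' {v j} with hA
  have hAm : ∀ j, MeasurableSet (A j) := fun j => g.measurableSet_fiber _
  have hAB : ∀ j, A j ⊆ B := fun j y hy => by
    by_contra hyB
    exact hv1 j (hy.symm.trans (hgB y hyB))
  have hAΛ : ∀ j, Λ (A j) ≠ ⊤ := fun j => ((measure_mono (hAB j)).trans_lt hΛ.lt_top).ne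
  have hdisj : Pairwise fun i j => Disjoint (A i) (A j) := fun i j hij => by
    refine Set.disjoint_left.mpr fun y hi hj => hij (hvinj ?_)
    exact (show g y = v i from hi).symm.trans hj
  have hind := h.indep_count _ A hAm hdisj
  -- pathwise evaluation
  have hpath : ∀ᵐ ω ∂μ, infProd (fun i => g (X i ω)) =
      ∏ j, v j ^ (pointCount X (A j) ω).toNat := by
    filter_upwards [h.ae_pointCount_ne_top hB hΛ] with ω hω
    have hfin : {i : ℕ | X i ω ∈ B}.Finite := Set.encard_ne_top_iff.mp hω
    set S := hfin.toFinset with hS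
    have hmemS : ∀ i, i ∈ S ↔ X i ω ∈ B := fun i => by simp [hS]
    rw [infProd_eq_prod (fun i => hg _) (S := S)
      (fun i hi => hgB _ fun h => hi ((hmemS i).mpr h))]
    have h1 : ∏ i ∈ S, g (X i ω) = ∏ i ∈ S.filter (fun i => g (X i ω) ≠ 1), g (X i ω) :=
      (Finset.prod_filter_of_ne fun i _ h => h).symm
    have h2 : ∀ i ∈ S.filter (fun i => g (X i ω) ≠ 1), g (X i ω) ∈ V := fun i hi =>
      Finset.mem_erase.mpr ⟨(Finset.mem_filter.mp hi).2, SimpleFunc.mem_range_self _ _⟩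
    rw [h1, ← Finset.prod_fiberwise_of_maps_to h2]
    have h3 : ∏ j, v j ^ (pointCount X (A j) ω).toNat =
        ∏ w ∈ V, w ^ (pointCount X (g ⁻¹' {w}) ω).toNat := by
      rw [← Finset.prod_coe_sort V]
      exact Fintype.prod_equiv e.symm _ _ fun j => rfl
    rw [h3]
    refine Finset.prod_congr rfl fun w hw => ?_
    rw [Finset.prod_congr rfl fun i hi => (Finset.mem_filter.mp hi).2, Finset.prod_const]
    congr 1
    have h4 : {i : ℕ | X i ω ∈ g ⁻¹' {w}} =
        ((S.filter fun i => g (X i ω) ≠ 1).filter fun i => g (X i ω) = w : Finset ℕ) := by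
      ext i
      simp only [Set.mem_preimage, Set.mem_singleton_iff, Set.mem_ofPred_eq, Finset.coe_filter,
        Finset.mem_filter, hmemS]
      refine ⟨fun hi => ⟨⟨?_, ?_⟩, hi⟩, fun hi => hi.2⟩
      · by_contra hB'
        exact (Finset.mem_erase.mp hw).1 (hi.symm.trans (hgB _ hB'))
      · rw [hi]
        exact (Finset.mem_erase.mp hw).1
    rw [pointCount, h4, Set.encard_coe_eq_coe_finsetCard, ENat.toNat_natCast]
  rw [lintegral_congr_ae hpath]
  have hind' : iIndepFun (fun j ω => v j ^ (pointCount X (A j) ω).toNat) μ :=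
    hind.comp (fun j n => v j ^ n.toNat) fun j => .of_discrete
  rw [lintegral_prod_eq_prod_lintegral_of_indepFun _ _ hind' fun j =>
    (Measurable.of_discrete (f := fun n : ℕ∞ => v j ^ n.toNat)).comp
      (h.measurable_pointCount (hAm j))]
  simp_rw [h.lintegral_pow_pointCount (hAm _) (hAΛ _) (hvle _)]
  rw [← ENNReal.ofReal_prod_of_nonneg fun _ _ => (Real.exp_pos _).le, ← Real.exp_sum,
    Finset.sum_neg_distrib]
  congr 3
  -- the integral of `1 - g`
  have h5 : ∫⁻ y, (1 - g y) ∂Λ = ∑ w ∈ g.range, (1 - w) * Λ (g ⁻¹' {w}) := by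
    rw [← SimpleFunc.map_lintegral (fun w => 1 - w) g, ← SimpleFunc.lintegral_eq_lintegral]
    rfl
  have h6 : ∑ w ∈ g.range, (1 - w) * Λ (g ⁻¹' {w}) = ∑ w ∈ V, (1 - w) * Λ (g ⁻¹' {w}) := by
    refine (Finset.sum_subset (Finset.erase_subset _ _) fun w hw hw' => ?_).symm
    have : w = 1 := by
      by_contra h1
      exact hw' (Finset.mem_erase.mpr ⟨h1, hw⟩)
    simp [this]
  have h7 : ∑ w ∈ V, (1 - w) * Λ (g ⁻¹' {w}) = ∑ j, (1 - v j) * Λ (A j) := by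
    rw [← Finset.sum_coe_sort V]
    exact (Fintype.sum_equiv e.symm _ _ fun j => rfl).symm
  rw [h5, h6, h7, ENNReal.toReal_sum fun j _ => ENNReal.mul_ne_top
    (ENNReal.sub_ne_top ENNReal.one_ne_top) (hAΛ j)]
  refine Finset.sum_congr rfl fun j _ => ?_
  rw [ENNReal.toReal_mul, ENNReal.toReal_sub_of_le (hvle j) ENNReal.one_ne_top, ENNReal.toReal_one,
    mul_comm]

/-- **The generating functional of a Poisson point process.** -/
theorem lintegral_infProd (h : IsPoissonPointProcess X Λ μ) [IsProbabilityMeasure μ]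
    {g : E → ENNReal} (hgm : Measurable g) (hg : ∀ y, g y ≤ 1) {B : Set E} (hB : MeasurableSet B)
    (hΛ : Λ B ≠ ⊤) (hgB : ∀ y, y ∉ B → g y = 1) :
    ∫⁻ ω, infProd (fun i => g (X i ω)) ∂μ =
      ENNReal.ofReal (Real.exp (-(∫⁻ y, (1 - g y) ∂Λ).toReal)) := by
  set f : E → ENNReal := fun y => 1 - g y with hf
  have hfm : Measurable f := measurable_const.sub hgm
  -- Approximating 1 - g from below makes the complements decrease to g and keeps them equal to 1
  -- off `B`.
  set s : ℕ → SimpleFunc E ENNReal := SimpleFunc.eapprox f with hs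
  have hsup : ∀ y, ⨆ n, s n y = f y := fun y => SimpleFunc.iSup_eapprox_apply hfm y
  have hsle : ∀ n y, s n y ≤ f y := fun n y => hsup y ▸ le_iSup (fun n => s n y) n
  have hsmono : Monotone s := SimpleFunc.monotone_eapprox f
  set G : ℕ → SimpleFunc E ENNReal := fun n => (s n).map fun w => 1 - w with hG
  have hGval : ∀ n y, G n y = 1 - s n y := fun n y => rfl
  have hG1 : ∀ n y, G n y ≤ 1 := fun n y => tsub_le_self
  have hanti : Antitone fun n y => G n y := fun n m hnm y => tsub_le_tsub_left (hsmono hnm y) 1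
  have hginf : ∀ y, g y = ⨅ n, G n y := fun y => by
    simp_rw [hGval]
    rw [← ENNReal.sub_iSup ENNReal.one_ne_top, hsup, hf]
    exact (ENNReal.sub_sub_cancel ENNReal.one_ne_top (hg y)).symm
  have hL : Tendsto (fun n => ∫⁻ ω, infProd (fun i => G n (X i ω)) ∂μ) atTop
      (𝓝 (∫⁻ ω, infProd (fun i => g (X i ω)) ∂μ)) := by
    have hpt : ∀ ω, infProd (fun i => g (X i ω)) = ⨅ n, infProd fun i => G n (X i ω) := fun ω => by
      simp_rw [hginf]
      exact infProd_iInf_of_antitone (x := fun n i => G n (X i ω)) (fun n i => hG1 _ _)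
        fun n m hnm i => hanti hnm _
    simp_rw [hpt]
    refine lintegral_tendsto_of_tendsto_of_antitone (fun n => ?_)
      (Eventually.of_forall fun ω n m hnm => infProd_mono fun i => hanti hnm _) ?_
      (Eventually.of_forall fun ω => tendsto_atTop_iInf fun n m hnm =>
        infProd_mono fun i => hanti hnm _)
    · exact (Measurable.infProd fun i => (G n).measurable.comp (h.measurable i)).aemeasurable
    · refine ((lintegral_mono fun ω => infProd_le_one _).trans_lt ?_).ne
      simp
  have hfint : ∫⁻ y, f y ∂Λ ≠ ⊤ := by
    refine ((lintegral_mono (g := B.indicator 1) fun y => ?_).trans_lt ?_).ne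
    · by_cases hy : y ∈ B
      · simp [hf, hy]
      · simp [hf, hy, hgB y hy]
    · rw [lintegral_indicator_one hB]
      exact hΛ.lt_top
  have hR : Tendsto (fun n => ∫⁻ y, (1 - G n y) ∂Λ) atTop (𝓝 (∫⁻ y, f y ∂Λ)) := by
    have h1 : ∀ n y, 1 - G n y = s n y := fun n y =>
      ENNReal.sub_sub_cancel ENNReal.one_ne_top ((hsle n y).trans tsub_le_self)
    simp_rw [h1]
    refine lintegral_tendsto_of_tendsto_of_monotone (fun n => (s n).measurable.aemeasurable)
      (Eventually.of_forall fun y n m hnm => hsmono hnm y) (Eventually.of_forall fun y => ?_)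
    rw [← hsup]
    exact tendsto_atTop_iSup fun n m hnm => hsmono hnm y
  have hR' : Tendsto (fun n => ENNReal.ofReal (Real.exp (-(∫⁻ y, (1 - G n y) ∂Λ).toReal))) atTop
      (𝓝 (ENNReal.ofReal (Real.exp (-(∫⁻ y, f y ∂Λ).toReal)))) :=
    ENNReal.tendsto_ofReal ((Real.continuous_exp.tendsto _).comp
      ((ENNReal.tendsto_toReal hfint).comp hR).neg)
  refine tendsto_nhds_unique hL (hR'.congr fun n => ?_)
  refine (h.lintegral_infProd_simpleFunc (G n) (hG1 n) hB hΛ fun y hy => ?_).symm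
  have : s n y = 0 := le_antisymm ((hsle n y).trans (by simp [hf, hgB y hy])) zero_le
  rw [hGval, this, tsub_zero]

end IsPoissonPointProcess

end PPP

end XLOS

namespace XLOS

/-! ## Identification of power series coefficients -/

/-- Once the earlier coefficients vanish, the series is d_k θ^k + O(θ^{k+1}); dividing by θ^k and
letting θ decrease to 0 kills d_k. Only θ in (0,1] is available, as θ will be a thinning
probability. -/
lemma eq_zero_of_forall_hasSum_zero {d : ℕ → ℝ} (hd : Summable fun k => |d k|)
    (h : ∀ θ : ℝ, 0 < θ → θ ≤ 1 → HasSum (fun k => d k * θ ^ k) 0) (k : ℕ) : d k = 0 := by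
  induction k using Nat.strong_induction_on with
  | _ k ih =>
    set C := ∑' j, |d j| with hC
    have hC0 : 0 ≤ C := tsum_nonneg fun _ => abs_nonneg _
    have hbound : ∀ θ : ℝ, 0 < θ → θ ≤ 1 → |d k| ≤ θ * C := fun θ h0 h1 => by
      have h2 := (h θ h0 h1).update k 0
      have h3 : ‖0 - d k * θ ^ k + 0‖ ≤ θ ^ (k + 1) * C := by
        have h4 := h2.tsum_eq
        rw [show (0 : ℝ) - d k * θ ^ k + 0 = ∑' j, Function.update (fun k => d k * θ ^ k) k 0 j by
          rw [h4]]
        refine tsum_of_norm_bounded (hd.hasSum.mul_left (θ ^ (k + 1))) fun j => ?_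
        rcases lt_trichotomy j k with hj | rfl | hj
        · rw [Function.update_of_ne hj.ne, ih j hj]
          simp
        · simp only [Function.update_self, norm_zero]
          positivity
        · rw [Function.update_of_ne hj.ne', norm_mul, Real.norm_eq_abs, norm_pow,
            Real.norm_of_nonneg h0.le, mul_comm]
          exact mul_le_mul_of_nonneg_right (pow_le_pow_of_le_one h0.le h1 hj) (abs_nonneg _)
      rw [zero_sub, add_zero, norm_neg, norm_mul, Real.norm_eq_abs, norm_pow,
        Real.norm_of_nonneg h0.le, pow_succ, mul_assoc, mul_comm] at h3
      exact le_of_mul_le_mul_left h3 (pow_pos h0 k)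
    have hlim : Tendsto (fun n : ℕ => 1 / ((n : ℝ) + 1) * C) atTop (𝓝 (0 * C)) :=
      tendsto_one_div_add_atTop_nhds_zero_nat.mul_const C
    rw [zero_mul] at hlim
    refine abs_nonpos_iff.mp (ge_of_tendsto' hlim fun n => hbound _ (by positivity) ?_)
    rw [div_le_one (by positivity)]
    linarith [(Nat.cast_nonneg n : (0 : ℝ) ≤ n)]

lemma hasSum_exp_coeff (Q L θ : ℝ) :
    HasSum (fun k : ℕ => Real.exp (-L) * Q ^ k / k.factorial * θ ^ k)
      (Real.exp (θ * Q - L)) := by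
  have h := (NormedSpace.expSeries_div_hasSum_exp (θ * Q)).mul_left (Real.exp (-L))
  rw [← Real.exp_eq_exp_ℝ] at h
  rw [← Real.exp_add, neg_add_eq_sub] at h
  refine h.congr_fun fun k => ?_
  rw [mul_pow]
  ring

/-- Reads single probabilities off a generating function. The value θ = 1 forces the coefficients to
be finite, after which real power series can be compared. -/
lemma coeff_eq_of_tsum_eq_exp {a : ℕ → ENNReal} {Q L : ℝ} (hQ : 0 ≤ Q)
    (h : ∀ θ : NNReal, θ ≤ 1 → ∑' k, a k * (θ : ENNReal) ^ k =
      ENNReal.ofReal (Real.exp (θ * Q - L))) (k : ℕ) :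
    a k = ENNReal.ofReal (Real.exp (-L) * Q ^ k / k.factorial) := by
  have hfin : ∀ k, a k ≠ ⊤ := fun k hk => by
    have h1 := h 1 le_rfl
    have h2 : a k * ((1 : NNReal) : ENNReal) ^ k ≤ ∑' k, a k * ((1 : NNReal) : ENNReal) ^ k :=
      ENNReal.le_tsum k
    rw [h1, hk] at h2
    simp at h2
  have hsum : ∀ θ : ℝ, 0 ≤ θ → θ ≤ 1 →
      HasSum (fun k => (a k).toReal * θ ^ k) (Real.exp (θ * Q - L)) := fun θ h0 h1 => by
    lift θ to NNReal using h0
    have h2 := h θ h1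
    have h3 := ENNReal.hasSum_toReal (f := fun k => a k * (θ : ENNReal) ^ k)
      (by rw [h2]; exact ENNReal.ofReal_ne_top)
    rw [← ENNReal.tsum_toReal_eq fun k =>
      ENNReal.mul_ne_top (hfin k) (ENNReal.pow_ne_top ENNReal.coe_ne_top), h2,
      ENNReal.toReal_ofReal (Real.exp_pos _).le] at h3
    refine h3.congr_fun fun k => ?_
    rw [ENNReal.toReal_mul, ENNReal.toReal_pow]
    rfl
  have hb0 : ∀ k : ℕ, 0 ≤ Real.exp (-L) * Q ^ k / k.factorial := fun k => by positivity
  have hzero := eq_zero_of_forall_hasSum_zero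
    (d := fun k => (a k).toReal - Real.exp (-L) * Q ^ k / k.factorial) (by
      have s1 := (hsum 1 zero_le_one le_rfl).summable
      have s2 := (hasSum_exp_coeff Q L 1).summable
      simp only [one_pow, mul_one] at s1 s2
      refine Summable.of_nonneg_of_le (fun k => abs_nonneg _) (fun k => ?_) (s1.add s2)
      refine (abs_sub _ _).trans_eq ?_
      rw [abs_of_nonneg ENNReal.toReal_nonneg, abs_of_nonneg (hb0 k)])
    (fun θ h0 h1 => by
      have := (hsum θ h0.le h1).sub (hasSum_exp_coeff Q L θ)
      rw [sub_self] at this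
      exact this.congr_fun fun k => by ring) k
  rw [← ENNReal.ofReal_toReal (hfin k), sub_eq_zero.mp hzero]

/-! ## Independently marked superpositions of Poisson point processes -/

section Marked

variable {Ω : Type*} [MeasurableSpace Ω] {E : Type*} [MeasurableSpace E] {N : ℕ}

/-- Independent Poisson point processes `Y n`, `n : Fin N`, with i.i.d. marks `γ`. -/
structure IsMarkedPoisson (Y : Fin N → ℕ → Ω → E) (γ : Fin N → ℕ → Ω → ℝ)
    (Λ : Fin N → Measure E) (ρ : Measure ℝ) (μ : Measure Ω) : Prop where
  ppp : ∀ n, IsPoissonPointProcess (Y n) (Λ n) μ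
  indep_tiers : iIndepFun (fun n ω i => Y n i ω) μ
  hasLaw_mark : ∀ n i, HasLaw (γ n i) ρ μ
  indep_mark : iIndepFun (fun p : Fin N × ℕ => γ p.1 p.2) μ
  indep_position_mark : IndepFun (fun ω n i => Y n i ω) (fun ω n i => γ n i ω) μ

namespace IsMarkedPoisson

variable {Y : Fin N → ℕ → Ω → E} {γ : Fin N → ℕ → Ω → ℝ} {Λ : Fin N → Measure E}
  {ρ : Measure ℝ} {μ : Measure Ω}

lemma measurable_position (h : IsMarkedPoisson Y γ Λ ρ μ) : Measurable fun ω n i => Y n i ω :=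
  measurable_pi_lambda _ fun n => measurable_pi_lambda _ fun i => (h.ppp n).measurable i

lemma aemeasurable_mark (h : IsMarkedPoisson Y γ Λ ρ μ) : AEMeasurable (fun ω n i => γ n i ω) μ :=
  aemeasurable_pi_lambda _ fun n => aemeasurable_pi_lambda _ fun i => (h.hasLaw_mark n i).aemeasurable

lemma lintegral_infProd [IsProbabilityMeasure μ] (h : IsMarkedPoisson Y γ Λ ρ μ) {g : Fin N → E → ENNReal}
    (hgm : ∀ n, Measurable (g n)) (hg : ∀ n y, g n y ≤ 1) {B : Set E} (hB : MeasurableSet B)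
    (hΛ : ∀ n, Λ n B ≠ ⊤) (hgB : ∀ n y, y ∉ B → g n y = 1) :
    ∫⁻ ω, infProd (fun p : Fin N × ℕ => g p.1 (Y p.1 p.2 ω)) ∂μ =
      ENNReal.ofReal (Real.exp (-∑ n, (∫⁻ y, (1 - g n y) ∂(Λ n)).toReal)) := by
  have hpm : ∀ n, Measurable fun y : ℕ → E => infProd fun i => g n (y i) := fun n =>
    Measurable.infProd fun i => (hgm n).comp (measurable_pi_apply i)
  have hind : iIndepFun (fun n ω => infProd fun i => g n (Y n i ω)) μ :=
    h.indep_tiers.comp (fun n (y : ℕ → E) => infProd fun i => g n (y i)) hpm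
  simp_rw [fun ω => infProd_prod (x := fun p : Fin N × ℕ => g p.1 (Y p.1 p.2 ω)) fun p => hg _ _]
  rw [lintegral_prod_eq_prod_lintegral_of_indepFun _ _ hind fun n =>
    (hpm n).comp (measurable_pi_lambda _ fun i => (h.ppp n).measurable i)]
  simp_rw [fun n => (h.ppp n).lintegral_infProd (hgm n) (hg n) hB (hΛ n) (hgB n)]
  rw [← ENNReal.ofReal_prod_of_nonneg fun _ _ => (Real.exp_pos _).le, ← Real.exp_sum,
    Finset.sum_neg_distrib]

/-- Independence concerns finitely many marks; continuity from above along finite index sets passes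
to the infinite product. -/
lemma measure_map_mark_forall [IsProbabilityMeasure μ] (h : IsMarkedPoisson Y γ Λ ρ μ)
    [IsProbabilityMeasure ρ] {S : Fin N × ℕ → Set ℝ}
    (hS : ∀ p, MeasurableSet (S p)) :
    μ.map (fun ω n i => γ n i ω) {r | ∀ p : Fin N × ℕ, r p.1 p.2 ∈ S p} =
      infProd fun p => ρ (S p) := by
  have : IsProbabilityMeasure (μ.map fun ω n i => γ n i ω) :=
    Measure.isProbabilityMeasure_map h.aemeasurable_mark
  set T : Finset (Fin N × ℕ) → Set (Fin N → ℕ → ℝ) := fun s =>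
    {r | ∀ p ∈ s, r p.1 p.2 ∈ S p} with hT
  have hTm : ∀ s, MeasurableSet (T s) := fun s => by
    have : T s = ⋂ p ∈ s, {r | r p.1 p.2 ∈ S p} := by ext; simp [hT]
    rw [this]
    exact Finset.measurableSet_biInter _ fun p _ =>
      ((measurable_pi_apply p.2).comp (measurable_pi_apply p.1)) (hS p)
  have hanti : Antitone T := fun s t hst r hr p hp => hr p (hst hp)
  have hinter : {r : Fin N → ℕ → ℝ | ∀ p : Fin N × ℕ, r p.1 p.2 ∈ S p} = ⋂ s, T s := by
    ext r
    simp only [hT, Set.mem_iInter]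
    exact ⟨fun hr s p _ => hr p, fun hr p => hr {p} p (Finset.mem_singleton_self p)⟩
  have h1 : ∀ s, μ.map (fun ω n i => γ n i ω) (T s) = ∏ p ∈ s, ρ (S p) := fun s => by
    rw [Measure.map_apply_of_aemeasurable h.aemeasurable_mark (hTm s)]
    have h2 := h.indep_mark.measure_inter_preimage_eq_mul s fun p _ => hS p
    have h3 : (fun ω n i => γ n i ω) ⁻¹' T s = ⋂ p ∈ s, (fun ω => γ p.1 p.2 ω) ⁻¹' S p := by
      ext; simp [hT]
    rw [h3]
    refine h2.trans (Finset.prod_congr rfl fun p _ => ?_)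
    rw [← Measure.map_apply_of_aemeasurable (h.hasLaw_mark _ _).aemeasurable (hS p),
      (h.hasLaw_mark _ _).map_eq]
  have h4 := tendsto_measure_iInter_atTop (μ := μ.map fun ω n i => γ n i ω) (s := T)
    (fun s => (hTm s).nullMeasurableSet) hanti ⟨∅, measure_ne_top _ _⟩
  rw [hinter]
  refine tendsto_nhds_unique h4 ((tendsto_atTop_iInf (antitone_finset_prod fun p => ?_)).congr
    fun s => (h1 s).symm)
  exact prob_le_one

/-- Averaging over the marks. -/
lemma measure_forall_mark [IsProbabilityMeasure μ] (h : IsMarkedPoisson Y γ Λ ρ μ) [IsProbabilityMeasure ρ]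
    {D : Set (Fin N → ℕ → E)} (hD : MeasurableSet D) {good : Fin N → Set (E × ℝ)}
    (hgood : ∀ n, MeasurableSet (good n)) :
    μ {ω | (fun n i => Y n i ω) ∈ D ∧ ∀ p : Fin N × ℕ, (Y p.1 p.2 ω, γ p.1 p.2 ω) ∈ good p.1} =
      ∫⁻ ω, D.indicator 1 (fun n i => Y n i ω) *
        infProd (fun p : Fin N × ℕ => ρ {r | (Y p.1 p.2 ω, r) ∈ good p.1}) ∂μ := by
  have : IsProbabilityMeasure (μ.map fun ω n i => γ n i ω) :=
    Measure.isProbabilityMeasure_map h.aemeasurable_mark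
  set T : Set ((Fin N → ℕ → E) × (Fin N → ℕ → ℝ)) :=
    {q | q.1 ∈ D ∧ ∀ p : Fin N × ℕ, (q.1 p.1 p.2, q.2 p.1 p.2) ∈ good p.1} with hT
  have hTm : MeasurableSet T := by
    have : T = Prod.fst ⁻¹' D ∩ ⋂ p : Fin N × ℕ,
        (fun q : (Fin N → ℕ → E) × (Fin N → ℕ → ℝ) => (q.1 p.1 p.2, q.2 p.1 p.2)) ⁻¹'
          good p.1 := by
      ext; simp [hT]
    rw [this]
    exact (measurable_fst hD).inter (MeasurableSet.iInter fun p => by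
      refine Measurable.prodMk ?_ ?_ (hgood p.1) <;> fun_prop)
  have hjoint := (indepFun_iff_map_prod_eq_prod_map_map h.measurable_position.aemeasurable
    h.aemeasurable_mark).mp h.indep_position_mark
  have h1 : μ {ω | (fun n i => Y n i ω) ∈ D ∧
      ∀ p : Fin N × ℕ, (Y p.1 p.2 ω, γ p.1 p.2 ω) ∈ good p.1} =
      (μ.map fun ω => ((fun n i => Y n i ω), (fun n i => γ n i ω))) T := by
    rw [Measure.map_apply_of_aemeasurable
      (h.measurable_position.aemeasurable.prodMk h.aemeasurable_mark) hTm]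
    rfl
  rw [h1, hjoint, Measure.prod_apply hTm, lintegral_map (measurable_measure_prodMk_left hTm)
    h.measurable_position]
  refine lintegral_congr fun ω => ?_
  by_cases hω : (fun n i => Y n i ω) ∈ D
  · rw [Set.indicator_of_mem hω, Pi.one_apply, one_mul]
    have h2 := h.measure_map_mark_forall (S := fun p => {r | (Y p.1 p.2 ω, r) ∈ good p.1})
      fun p => measurable_prodMk_left (hgood p.1)
    rw [← h2]
    congr 1
    ext r
    simp [hT, hω]
  · rw [Set.indicator_of_notMem hω, zero_mul]
    convert measure_empty (μ := μ.map fun ω n i => γ n i ω)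
    ext r
    simp [hT, hω]

end IsMarkedPoisson

end Marked

end XLOS

namespace XLOS

/-! ### Joint law of counts and marks -/

section Marked

variable {Ω : Type*} [MeasurableSpace Ω] {E : Type*} [MeasurableSpace E] {N : ℕ}

/-- The indices of the points in `B`. -/
def pointsIn (Y : Fin N → ℕ → Ω → E) (B : Set E) (ω : Ω) : Set (Fin N × ℕ) :=
  {p | Y p.1 p.2 ω ∈ B}

namespace IsMarkedPoisson

variable {Y : Fin N → ℕ → Ω → E} {γ : Fin N → ℕ → Ω → ℝ} {Λ : Fin N → Measure E}
  {ρ : Measure ℝ} {μ : Measure Ω}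

lemma ae_finite_pointsIn (h : IsMarkedPoisson Y γ Λ ρ μ) {B : Set E} (hB : MeasurableSet B)
    (hΛ : ∀ n, Λ n B ≠ ⊤) : ∀ᵐ ω ∂μ, (pointsIn Y B ω).Finite := by
  filter_upwards [ae_all_iff.mpr fun n => (h.ppp n).ae_pointCount_ne_top hB (hΛ n)] with ω hω
  refine (Set.finite_iUnion fun n => (Set.encard_ne_top_iff.mp (hω n)).image
    (Prod.mk n)).subset fun p hp => Set.mem_iUnion.mpr ⟨p.1, p.2, hp, rfl⟩

lemma measurable_encard_pointsIn (h : IsMarkedPoisson Y γ Λ ρ μ) {B : Set E}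
    (hB : MeasurableSet B) : Measurable fun ω => (pointsIn Y B ω).encard := by
  refine measurable_encard.comp (measurable_set_iff.mpr fun p => ?_)
  exact measurableSet_setOfPred.mp (((h.ppp p.1).measurable p.2) hB)

/-- `B` contains `k` points, all of them good, and `S` contains none. -/
lemma measure_count_good (h : IsMarkedPoisson Y γ Λ ρ μ) [IsProbabilityMeasure μ]
    [IsProbabilityMeasure ρ] {B S : Set E} (hB : MeasurableSet B) (hS : MeasurableSet S)
    (hBS : Disjoint B S) (hΛB : ∀ n, Λ n B ≠ ⊤) (hΛS : ∀ n, Λ n S ≠ ⊤)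
    {good : Fin N → Set (E × ℝ)} (hgood : ∀ n, MeasurableSet (good n)) (k : ℕ) :
    μ {ω | ((pointsIn Y B ω).encard = k ∧ pointsIn Y S ω = ∅) ∧
      ∀ p ∈ pointsIn Y B ω, (Y p.1 p.2 ω, γ p.1 p.2 ω) ∈ good p.1} =
    ENNReal.ofReal (Real.exp (-∑ n, ((Λ n B).toReal + (Λ n S).toReal)) *
      (∑ n, (∫⁻ y in B, ρ {r | (y, r) ∈ good n} ∂(Λ n)).toReal) ^ k / k.factorial) := by
  classical
  set q : Fin N → E → ENNReal := fun n y => ρ {r | (y, r) ∈ good n} with hq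
  have hqm : ∀ n, Measurable (q n) := fun n => measurable_measure_prodMk_left (hgood n)
  have hq1 : ∀ n y, q n y ≤ 1 := fun n y => prob_le_one
  set D : ℕ → Set (Fin N → ℕ → E) := fun k =>
    {y | {p : Fin N × ℕ | y p.1 p.2 ∈ B}.encard = k ∧ {p : Fin N × ℕ | y p.1 p.2 ∈ S} = ∅}
    with hD
  have hmB : ∀ {A : Set E}, MeasurableSet A →
      Measurable fun y : Fin N → ℕ → E => {p : Fin N × ℕ | y p.1 p.2 ∈ A} := fun {A} hA =>
    measurable_set_iff.mpr fun p => measurableSet_setOfPred.mp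
      (((measurable_pi_apply p.2).comp (measurable_pi_apply p.1)) hA)
  have hDm : ∀ k, MeasurableSet (D k) := fun k => by
    have : D k = ((fun y : Fin N → ℕ → E => {p : Fin N × ℕ | y p.1 p.2 ∈ B}.encard) ⁻¹' {(k : ℕ∞)})
        ∩ ((fun y : Fin N → ℕ → E => {p : Fin N × ℕ | y p.1 p.2 ∈ S}.encard) ⁻¹' {0}) := by
      ext; simp [hD]
    rw [this]
    exact (measurable_encard.comp (hmB hB) (measurableSet_singleton _)).inter
      (measurable_encard.comp (hmB hS) (measurableSet_singleton _))
  -- Imposing no condition outside `B` makes the points there contribute the factor 1.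
  set good' : Fin N → Set (E × ℝ) := fun n => {x | x.1 ∈ B → x ∈ good n} with hgood'
  have hgood'm : ∀ n, MeasurableSet (good' n) := fun n => by
    have : good' n = (Prod.fst ⁻¹' B)ᶜ ∪ good n := by
      ext; simp [hgood', imp_iff_not_or]
    rw [this]
    exact (measurable_fst hB).compl.union (hgood n)
  have hq' : ∀ n y, ρ {r | (y, r) ∈ good' n} = if y ∈ B then q n y else 1 := fun n y => by
    by_cases hy : y ∈ B <;> simp [hgood', hy, hq]
  set a : ℕ → ENNReal := fun k => ∫⁻ ω, (D k).indicator 1 (fun n i => Y n i ω) *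
    infProd (fun p : Fin N × ℕ => if Y p.1 p.2 ω ∈ B then q p.1 (Y p.1 p.2 ω) else 1) ∂μ with ha
  have hak : μ {ω | ((pointsIn Y B ω).encard = k ∧ pointsIn Y S ω = ∅) ∧
      ∀ p ∈ pointsIn Y B ω, (Y p.1 p.2 ω, γ p.1 p.2 ω) ∈ good p.1} = a k := by
    have h1 := h.measure_forall_mark (hDm k) hgood'm
    simp_rw [hq'] at h1
    exact h1
  rw [hak]
  have hsplit : ∑ n, ((Λ n B).toReal + (Λ n S).toReal) = ∑ n, (Λ n (B ∪ S)).toReal :=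
    Finset.sum_congr rfl fun n _ => by
      rw [measure_union hBS hS, ENNReal.toReal_add (hΛB n) (hΛS n)]
  refine coeff_eq_of_tsum_eq_exp (Finset.sum_nonneg fun _ _ => ENNReal.toReal_nonneg)
    (fun θ hθ => ?_) k
  have hθ' : (θ : ENNReal) ≤ 1 := by exact_mod_cast hθ
  -- Each point of `B` carries θ times its probability of being good, and a single point of `S`
  -- annihilates the product. The generating functional at `g` is therefore the power series in θ
  -- with coefficients `a k`.
  set g : Fin N → E → ENNReal := fun n y =>
    if y ∈ B then θ * q n y else if y ∈ S then 0 else 1 with hg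
  have hg1 : ∀ n y, g n y ≤ 1 := fun n y => by
    simp only [hg]
    split_ifs
    · exact mul_le_one' hθ' (hq1 n y)
    · exact zero_le
    · exact le_rfl
  have hgm : ∀ n, Measurable (g n) := fun n =>
    Measurable.ite hB ((hqm n).const_mul _) (Measurable.ite hS measurable_const measurable_const)
  have hpath : ∀ᵐ ω ∂μ, ∑' k, (D k).indicator 1 (fun n i => Y n i ω) *
      infProd (fun p : Fin N × ℕ => if Y p.1 p.2 ω ∈ B then q p.1 (Y p.1 p.2 ω) else 1) *
        (θ : ENNReal) ^ k = infProd (fun p : Fin N × ℕ => g p.1 (Y p.1 p.2 ω)) := by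
    filter_upwards [h.ae_finite_pointsIn hB hΛB] with ω hω
    by_cases hSω : pointsIn Y S ω = ∅
    · have hmem : ∀ k, (fun n i => Y n i ω) ∈ D k ↔ k = hω.toFinset.card := fun k => by
        have : (pointsIn Y B ω).encard = hω.toFinset.card := hω.encard_eq_coe_toFinset_card
        have h2 : (fun n i => Y n i ω) ∈ D k ↔
          (pointsIn Y B ω).encard = k ∧ pointsIn Y S ω = ∅ := Iff.rfl
        rw [h2, this, and_iff_left hSω, Nat.cast_inj, eq_comm]
      rw [tsum_eq_single hω.toFinset.card fun k hk => by
        rw [Set.indicator_of_notMem (mt (hmem k).mp hk), zero_mul, zero_mul],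
        Set.indicator_of_mem ((hmem _).mpr rfl), Pi.one_apply, one_mul,
        infProd_eq_prod (x := fun p : Fin N × ℕ =>
            if Y p.1 p.2 ω ∈ B then q p.1 (Y p.1 p.2 ω) else 1) (S := hω.toFinset)
          (fun p => by split_ifs; exacts [hq1 _ _, le_rfl])
          (fun p hp => if_neg fun hp' => hp (hω.mem_toFinset.mpr hp')),
        infProd_eq_prod (S := hω.toFinset) (fun p => hg1 _ _) (fun p hp => by
          have h1 : Y p.1 p.2 ω ∉ B := fun hp' => hp (hω.mem_toFinset.mpr hp')
          have h2 : Y p.1 p.2 ω ∉ S := fun hp' => by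
            have : p ∈ pointsIn Y S ω := hp'
            rw [hSω] at this
            exact this
          simp [hg, h1, h2])]
      rw [mul_comm, ← Finset.prod_const, ← Finset.prod_mul_distrib]
      refine Finset.prod_congr rfl fun p hp => ?_
      have h1 : Y p.1 p.2 ω ∈ B := hω.mem_toFinset.mp hp
      simp [hg, h1]
    · have hmem : ∀ k, (fun n i => Y n i ω) ∉ D k := fun k hk => hSω hk.2
      simp only [Set.indicator_of_notMem (hmem _), zero_mul, tsum_zero]
      obtain ⟨p, hp⟩ := Set.nonempty_iff_ne_empty.mpr hSω
      have hpS : Y p.1 p.2 ω ∈ S := hp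
      refine (le_antisymm ((iInf_le _ {p}).trans_eq ?_) zero_le).symm
      rw [Finset.prod_singleton]
      simp [hg, hpS, hBS.notMem_of_mem_right hpS]
  have hmeas : ∀ k, AEMeasurable (fun ω => (D k).indicator 1 (fun n i => Y n i ω) *
      infProd (fun p : Fin N × ℕ => if Y p.1 p.2 ω ∈ B then q p.1 (Y p.1 p.2 ω) else 1) *
        (θ : ENNReal) ^ k) μ := fun k => by
    refine (((measurable_one.indicator (hDm k)).comp h.measurable_position).mul
      (Measurable.infProd fun p => ?_)).mul_const _ |>.aemeasurable
    exact Measurable.ite ((h.ppp p.1).measurable p.2 hB)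
      ((hqm p.1).comp ((h.ppp p.1).measurable p.2)) measurable_const
  have hsum : ∑' k, a k * (θ : ENNReal) ^ k =
      ∫⁻ ω, infProd (fun p : Fin N × ℕ => g p.1 (Y p.1 p.2 ω)) ∂μ := by
    rw [← lintegral_congr_ae hpath, lintegral_tsum hmeas]
    refine tsum_congr fun k => ?_
    rw [lintegral_mul_const' _ _ (ENNReal.pow_ne_top ENNReal.coe_ne_top)]
  rw [hsum, h.lintegral_infProd hgm hg1 (hB.union hS)
    (fun n => (measure_union_lt_top (hΛB n).lt_top (hΛS n).lt_top).ne)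
    (fun n y hy => by
      rw [Set.mem_union, not_or] at hy
      simp [hg, hy.1, hy.2]), hsplit, Finset.mul_sum, ← Finset.sum_sub_distrib,
    ← Finset.sum_neg_distrib]
  congr 2
  refine Finset.sum_congr rfl fun n _ => ?_
  have hval : ∫⁻ y, (1 - g n y) ∂(Λ n) + θ * ∫⁻ y in B, q n y ∂(Λ n) = Λ n (B ∪ S) := by
    rw [← lintegral_const_mul _ (hqm n), ← lintegral_indicator hB,
      ← lintegral_add_right _ (((hqm n).const_mul _).indicator hB),
      ← lintegral_indicator_one (hB.union hS)]
    refine lintegral_congr fun y => ?_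
    by_cases h1 : y ∈ B
    · have : θ * q n y ≤ 1 := mul_le_one' hθ' (hq1 n y)
      simp [hg, h1, tsub_add_cancel_of_le this]
    · by_cases h2 : y ∈ S <;> simp [hg, h1, h2]
  have hne : Λ n (B ∪ S) ≠ ⊤ := (measure_union_lt_top (hΛB n).lt_top (hΛS n).lt_top).ne
  have h1 : ∫⁻ y, (1 - g n y) ∂(Λ n) ≠ ⊤ := fun h0 => hne (by rw [← hval, h0, top_add])
  have h2 : θ * ∫⁻ y in B, q n y ∂(Λ n) ≠ ⊤ := fun h0 => hne (by rw [← hval, h0, add_top])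
  have := congrArg ENNReal.toReal hval
  rw [ENNReal.toReal_add h1 h2, ENNReal.toReal_mul, ENNReal.coe_toReal] at this
  linarith

end IsMarkedPoisson

end Marked

end XLOS

namespace XLOS

/-! ## Functions with quadratically small increments -/

/-- Over n + 1 equal steps the increments add up to at most C w²/(n+1). -/
lemma eq_of_quadratic_increments {f : ℝ → ℝ} {C w : ℝ} (hw : 0 ≤ w)
    (h : ∀ s t, 0 ≤ s → s ≤ t → t ≤ w → |f t - f s| ≤ C * (t - s) ^ 2) : f w = f 0 := by
  have hbound : ∀ n : ℕ, |f w - f 0| ≤ C * w ^ 2 * (1 / ((n : ℝ) + 1)) := fun n => by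
    have hn : (0 : ℝ) < n + 1 := by positivity
    have htel := Finset.sum_range_sub (fun k : ℕ => f (w * k / (n + 1))) (n + 1)
    have h1 : w * ((n + 1 : ℕ) : ℝ) / (n + 1) = w := by
      push_cast
      field_simp
    simp only [h1, Nat.cast_zero, mul_zero, zero_div] at htel
    rw [← htel]
    refine (Finset.abs_sum_le_sum_abs _ _).trans ?_
    have hstep : ∀ k ∈ Finset.range (n + 1),
        |f (w * ((k + 1 : ℕ) : ℝ) / (n + 1)) - f (w * k / (n + 1))| ≤
          C * (w / (n + 1)) ^ 2 := fun k hk => by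
      have hk' : ((k + 1 : ℕ) : ℝ) ≤ n + 1 := by exact_mod_cast Finset.mem_range.mp hk
      have h2 := h (w * k / (n + 1)) (w * ((k + 1 : ℕ) : ℝ) / (n + 1)) (by positivity)
        (by gcongr; exact Nat.le_succ k) (by
          rw [div_le_iff₀ hn]
          exact mul_le_mul_of_nonneg_left hk' hw)
      convert h2 using 2
      push_cast
      ring
    refine (Finset.sum_le_sum hstep).trans_eq ?_
    rw [Finset.sum_const, Finset.card_range, nsmul_eq_mul]
    push_cast
    field_simp
  have hlim := tendsto_one_div_add_atTop_nhds_zero_nat (𝕜 := ℝ) |>.const_mul (C * w ^ 2)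
  rw [mul_zero] at hlim
  exact sub_eq_zero.mp (abs_nonpos_iff.mp (ge_of_tendsto' hlim hbound))

/-- A function with increments `e^{-t} (G t - G s) + O((t - s)²)`. -/
lemma eq_integral_of_increments {φ G : ℝ → ℝ} {C w : ℝ} (hw : 0 ≤ w) (hφ : φ 0 = 0) (hG : G 0 = 0)
    (hC : ∀ s t, 0 ≤ s → s ≤ t → t ≤ w → |G t - G s| ≤ C * (t - s))
    (h1 : ∀ s t, 0 ≤ s → s ≤ t → Real.exp (-t) * (G t - G s) ≤ φ t - φ s)
    (h2 : ∀ s t, 0 ≤ s → s ≤ t → φ t - φ s ≤ Real.exp (-t) * (G t - G s) + (t - s) ^ 2) :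
    φ w = (∫ v in (0 : ℝ)..w, Real.exp (-v) * G v) + Real.exp (-w) * G w := by
  rcases hw.eq_or_lt with rfl | hw'
  · simp [hφ, hG]
  have hC0 : 0 ≤ C := by
    have := (abs_nonneg _).trans (hC 0 w le_rfl hw le_rfl)
    rw [sub_zero] at this
    exact nonneg_of_mul_nonneg_left this hw'
  have hcont : ContinuousOn G (Set.Icc 0 w) := by
    refine (LipschitzOnWith.of_dist_le_mul (K := C.toNNReal) fun x hx y hy => ?_).continuousOn
    rw [Real.coe_toNNReal _ hC0, Real.dist_eq, Real.dist_eq]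
    rcases le_total x y with hxy | hxy
    · rw [abs_sub_comm, abs_sub_comm x, abs_of_nonneg (sub_nonneg.mpr hxy)]
      exact hC x y hx.1 hxy hy.2
    · rw [abs_of_nonneg (sub_nonneg.mpr hxy)]
      exact hC y x hy.1 hxy hx.2
  have hint : ∀ s t, 0 ≤ s → s ≤ t → t ≤ w →
      IntervalIntegrable (fun v => Real.exp (-v) * G v) volume s t := fun s t hs hst ht => by
    refine ContinuousOn.intervalIntegrable_of_Icc hst ?_
    exact (by fun_prop : Continuous fun v : ℝ => Real.exp (-v)).continuousOn.mul
      (hcont.mono (Set.Icc_subset_Icc hs ht))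
  -- The Stieltjes integral of e^{-v} against dG, integrated by parts. Its increments match those of
  -- `φ` up to a quadratic error by the Lipschitz bound on `G`.
  set ψ : ℝ → ℝ := fun w => (∫ v in (0 : ℝ)..w, Real.exp (-v) * G v) + Real.exp (-w) * G w with hψ
  have hexp : ∀ s t : ℝ, ∫ v in s..t, Real.exp (-v) = Real.exp (-s) - Real.exp (-t) :=
    fun s t => by
      rw [intervalIntegral.integral_comp_neg (fun v => Real.exp v), integral_exp]
  have key : ∀ s t, 0 ≤ s → s ≤ t → t ≤ w →
      |ψ t - ψ s - Real.exp (-t) * (G t - G s)| ≤ C * (t - s) ^ 2 := fun s t hs hst ht => by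
    have e1 : ψ t - ψ s - Real.exp (-t) * (G t - G s) =
        ∫ v in s..t, Real.exp (-v) * (G v - G s) := by
      simp_rw [mul_sub]
      rw [intervalIntegral.integral_sub (hint s t hs hst ht) ((by fun_prop : Continuous
          fun v : ℝ => Real.exp (-v) * G s).intervalIntegrable _ _),
        intervalIntegral.integral_mul_const, hexp,
        ← intervalIntegral.integral_interval_sub_left (hint 0 t le_rfl (hs.trans hst) ht)
          (hint 0 s le_rfl hs (hst.trans ht))]
      simp only [hψ]
      ring
    rw [e1, ← Real.norm_eq_abs]
    refine (intervalIntegral.norm_integral_le_of_norm_le_const (C := C * (t - s))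
      fun v hv => ?_).trans_eq ?_
    · rw [Set.uIoc_of_le hst] at hv
      rw [norm_mul, Real.norm_of_nonneg (Real.exp_pos _).le, Real.norm_eq_abs]
      have hv0 : 0 ≤ v := hs.trans hv.1.le
      calc Real.exp (-v) * |G v - G s| ≤ 1 * |G v - G s| := by
            gcongr
            rw [Real.exp_le_one_iff]
            linarith
        _ = |G v - G s| := one_mul _
        _ ≤ C * (v - s) := hC s v hs hv.1.le (hv.2.trans ht)
        _ ≤ C * (t - s) := by gcongr; exact hv.2
    · rw [abs_of_nonneg (sub_nonneg.mpr hst)]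
      ring
  have := eq_of_quadratic_increments (f := fun v => φ v - ψ v) (C := C + 1) hw
    fun s t hs hst ht => by
      have k := abs_le.mp (key s t hs hst ht)
      have k1 := h1 s t hs hst
      have k2 := h2 s t hs hst
      have := mul_nonneg hC0 (sq_nonneg (t - s))
      rw [abs_le]
      constructor <;> linarith
  have h0 : ψ 0 = 0 := by simp [hψ, hG]
  simp only [hφ, h0, sub_zero] at this
  exact sub_eq_zero.mp this

end XLOS

namespace XLOS

/-! ### Levels, shells and the mean number of good points -/

section Marked

variable {Ω : Type*} [MeasurableSpace Ω] {E : Type*} [MeasurableSpace E] {N : ℕ}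

/-- Points of level at least `s` and below `t`. -/
def shell (l : E → ℝ) (s t : ℝ) : Set E := {y | s ≤ l y ∧ l y < t}

/-- Points of level below `t`. -/
def sublevel (l : E → ℝ) (t : ℝ) : Set E := {y | l y < t}

/-- The cells than which fewer than `M` cells have smaller level are all good. -/
def strongestGood (M : ℕ) (l : E → ℝ) (good : Fin N → Set (E × ℝ)) (Y : Fin N → ℕ → Ω → E)
    (γ : Fin N → ℕ → Ω → ℝ) : Set Ω :=
  {ω | ∀ p : Fin N × ℕ, (pointsIn Y (sublevel l (l (Y p.1 p.2 ω))) ω).encard < M →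
    (Y p.1 p.2 ω, γ p.1 p.2 ω) ∈ good p.1}

/-- Mean number of good points of level below `t`. -/
noncomputable def goodMass (Λ : Fin N → Measure E) (ρ : Measure ℝ) (l : E → ℝ)
    (good : Fin N → Set (E × ℝ)) (t : ℝ) : ℝ :=
  ∑ n, (∫⁻ y in sublevel l t, ρ {r | (y, r) ∈ good n} ∂(Λ n)).toReal

variable {Λ : Fin N → Measure E} {ρ : Measure ℝ} {l : E → ℝ} {good : Fin N → Set (E × ℝ)}

lemma measurableSet_shell (hl : Measurable l) (s t : ℝ) : MeasurableSet (shell l s t) :=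
  (measurableSet_le measurable_const hl).inter (measurableSet_lt hl measurable_const)

lemma measurableSet_sublevel (hl : Measurable l) (t : ℝ) : MeasurableSet (sublevel l t) :=
  measurableSet_lt hl measurable_const

lemma sublevel_union_shell {E : Type*} {l : E → ℝ} {s t : ℝ} (hst : s ≤ t) :
    sublevel l s ∪ shell l s t = sublevel l t := by
  ext y
  simp only [sublevel, shell, Set.mem_union, Set.mem_ofPred_eq]
  exact ⟨fun h => h.elim (fun h => h.trans_le hst) And.right,
    fun h => (lt_or_ge (l y) s).imp id fun h' => ⟨h', h⟩⟩

lemma disjoint_sublevel_shell {E : Type*} {l : E → ℝ} (s t : ℝ) : Disjoint (sublevel l s) (shell l s t) :=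
  Set.disjoint_left.mpr fun _ h h' => not_lt.mpr h'.1 h

/-- The expected number of points of level below `t` is `t`. -/
structure IsLevel (Λ : Fin N → Measure E) (l : E → ℝ) : Prop where
  measurable : Measurable l
  ne_top : ∀ n t, Λ n (sublevel l t) ≠ ⊤
  sum_eq : ∀ t, 0 ≤ t → ∑ n, (Λ n (sublevel l t)).toReal = t

namespace IsLevel

lemma measure_shell_ne_top (hl : IsLevel Λ l) (s t : ℝ) (n : Fin N) : Λ n (shell l s t) ≠ ⊤ :=
  measure_ne_top_of_subset (fun _ h => h.2) (hl.ne_top n t)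

lemma sum_measure_shell (hl : IsLevel Λ l) {s t : ℝ} (hs : 0 ≤ s) (hst : s ≤ t) :
    ∑ n, (Λ n (shell l s t)).toReal = t - s := by
  have h1 := hl.sum_eq t (hs.trans hst)
  have h2 := hl.sum_eq s hs
  have h3 : ∀ n, (Λ n (sublevel l t)).toReal =
      (Λ n (sublevel l s)).toReal + (Λ n (shell l s t)).toReal := fun n => by
    rw [← sublevel_union_shell hst, measure_union (disjoint_sublevel_shell s t)
      (measurableSet_shell hl.measurable s t),
      ENNReal.toReal_add (hl.ne_top n s) (hl.measure_shell_ne_top s t n)]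
  rw [Finset.sum_congr rfl fun n _ => h3 n, Finset.sum_add_distrib, h2] at h1
  linarith

/-- Good points are a thinning of all points, of which a shell contains t - s on average; so the
good mass is nondecreasing and 1-Lipschitz. -/
lemma goodMass_sub_mem (hl : IsLevel Λ l) [IsProbabilityMeasure ρ] {s t : ℝ} (hst : s ≤ t)
    (hs : 0 ≤ s) :
    0 ≤ goodMass Λ ρ l good t - goodMass Λ ρ l good s ∧
      goodMass Λ ρ l good t - goodMass Λ ρ l good s ≤ t - s := by
  have hle : ∀ n (A : Set E), ∫⁻ y in A, ρ {r | (y, r) ∈ good n} ∂(Λ n) ≤ Λ n A := fun n A =>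
    (lintegral_mono fun _ => prob_le_one).trans_eq (setLIntegral_one A)
  have hdiff : goodMass Λ ρ l good t - goodMass Λ ρ l good s =
      ∑ n, (∫⁻ y in shell l s t, ρ {r | (y, r) ∈ good n} ∂(Λ n)).toReal := by
    rw [goodMass, goodMass, ← Finset.sum_sub_distrib]
    refine Finset.sum_congr rfl fun n _ => ?_
    rw [← sublevel_union_shell hst, lintegral_union (measurableSet_shell hl.measurable s t)
      (disjoint_sublevel_shell s t), ENNReal.toReal_add
      (ne_top_of_le_ne_top (hl.ne_top n s) (hle n _))
      (ne_top_of_le_ne_top (hl.measure_shell_ne_top s t n) (hle n _)), add_sub_cancel_left]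
  rw [hdiff]
  refine ⟨Finset.sum_nonneg fun _ _ => ENNReal.toReal_nonneg, ?_⟩
  rw [← hl.sum_measure_shell hs hst]
  exact Finset.sum_le_sum fun n _ =>
    ENNReal.toReal_mono (hl.measure_shell_ne_top s t n) (hle n _)

lemma goodMass_zero (hl : IsLevel Λ l) [IsProbabilityMeasure ρ] :
    goodMass Λ ρ l good 0 = 0 := by
  refine le_antisymm ((Finset.sum_le_sum fun n _ => ENNReal.toReal_mono (hl.ne_top n 0)
    ?_).trans_eq (hl.sum_eq 0 le_rfl)) (Finset.sum_nonneg fun _ _ => ENNReal.toReal_nonneg)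
  exact (lintegral_mono fun _ => prob_le_one).trans_eq (setLIntegral_one _)

end IsLevel

namespace IsMarkedPoisson

variable {Y : Fin N → ℕ → Ω → E} {γ : Fin N → ℕ → Ω → ℝ} {μ : Measure Ω}

/-- The marks are known to be measurable only almost everywhere, so events involving them are null
measurable. -/
lemma nullMeasurableSet_good (h : IsMarkedPoisson Y γ Λ ρ μ)
    (hgood : ∀ n, MeasurableSet (good n)) (p : Fin N × ℕ) :
    NullMeasurableSet {ω | (Y p.1 p.2 ω, γ p.1 p.2 ω) ∈ good p.1} μ :=
  (((h.ppp p.1).measurable p.2).aemeasurable.prodMk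
    (h.hasLaw_mark p.1 p.2).aemeasurable).nullMeasurableSet_preimage (hgood p.1)

lemma nullMeasurableSet_strongestGood (h : IsMarkedPoisson Y γ Λ ρ μ) (hl : Measurable l)
    (hgood : ∀ n, MeasurableSet (good n)) (M : ℕ) :
    NullMeasurableSet (strongestGood M l good Y γ) μ := by
  have : strongestGood M l good Y γ = ⋂ p : Fin N × ℕ,
      {ω | (pointsIn Y (sublevel l (l (Y p.1 p.2 ω))) ω).encard < M}ᶜ ∪
        {ω | (Y p.1 p.2 ω, γ p.1 p.2 ω) ∈ good p.1} := by
    ext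
    simp [strongestGood, imp_iff_not_or]
  rw [this]
  refine NullMeasurableSet.iInter fun p => NullMeasurableSet.union
    (MeasurableSet.nullMeasurableSet ?_) (h.nullMeasurableSet_good hgood p)
  refine MeasurableSet.compl ((measurable_encard.comp (measurable_set_iff.mpr fun q => ?_))
    (MeasurableSet.of_discrete (s := Set.Iio (M : ℕ∞))))
  exact measurableSet_setOfPred.mp (measurableSet_lt (hl.comp ((h.ppp q.1).measurable q.2))
    (hl.comp ((h.ppp p.1).measurable p.2)))

/-- Exactly `M` points lie below level `t`, all of them good, and none has level in `[s, t)`. -/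
def countGood (M : ℕ) (l : E → ℝ) (good : Fin N → Set (E × ℝ)) (Y : Fin N → ℕ → Ω → E)
    (γ : Fin N → ℕ → Ω → ℝ) (s t : ℝ) : Set Ω :=
  {ω | ((pointsIn Y (sublevel l s) ω).encard = M ∧ pointsIn Y (shell l s t) ω = ∅) ∧
    ∀ p ∈ pointsIn Y (sublevel l s) ω, (Y p.1 p.2 ω, γ p.1 p.2 ω) ∈ good p.1}

lemma nullMeasurableSet_countGood (h : IsMarkedPoisson Y γ Λ ρ μ) (hl : Measurable l)
    (hgood : ∀ n, MeasurableSet (good n)) (M : ℕ) (s t : ℝ) :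
    NullMeasurableSet (countGood M l good Y γ s t) μ := by
  have : countGood M l good Y γ s t =
      ((fun ω => (pointsIn Y (sublevel l s) ω).encard) ⁻¹' {(M : ℕ∞)} ∩
        (fun ω => (pointsIn Y (shell l s t) ω).encard) ⁻¹' {0}) ∩
      ⋂ p : Fin N × ℕ, ((Y p.1 p.2) ⁻¹' (sublevel l s))ᶜ ∪
        {ω | (Y p.1 p.2 ω, γ p.1 p.2 ω) ∈ good p.1} := by
    ext ω
    simp [countGood, imp_iff_not_or, pointsIn]
  rw [this]
  refine (((h.measurable_encard_pointsIn (measurableSet_sublevel hl s)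
    (measurableSet_singleton _)).inter (h.measurable_encard_pointsIn (measurableSet_shell hl s t)
    (measurableSet_singleton _))).nullMeasurableSet).inter
    (NullMeasurableSet.iInter fun p => NullMeasurableSet.union
      (MeasurableSet.nullMeasurableSet ?_) (h.nullMeasurableSet_good hgood p))
  exact ((h.ppp p.1).measurable p.2 (measurableSet_sublevel hl s)).compl

variable [IsProbabilityMeasure μ] [IsProbabilityMeasure ρ]

/-- The empty shell turns e^{-s} into e^{-t}. Two such events with the same t thus differ by e^{-t}
times an increment of Q^M/M!. -/
lemma measure_countGood (h : IsMarkedPoisson Y γ Λ ρ μ) (hl : IsLevel Λ l)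
    (hgood : ∀ n, MeasurableSet (good n)) (M : ℕ) {s t : ℝ} (hs : 0 ≤ s) (hst : s ≤ t) :
    μ.real (countGood M l good Y γ s t) =
      Real.exp (-t) * (goodMass Λ ρ l good s ^ M / M.factorial) := by
  have h1 := h.measure_count_good (measurableSet_sublevel hl.measurable s)
    (measurableSet_shell hl.measurable s t) (disjoint_sublevel_shell s t) (fun n => hl.ne_top n s)
    (hl.measure_shell_ne_top s t) hgood M
  rw [Finset.sum_add_distrib, hl.sum_eq s hs, hl.sum_measure_shell hs hst,
    add_sub_cancel] at h1
  have hQ : 0 ≤ goodMass Λ ρ l good s := Finset.sum_nonneg fun _ _ => ENNReal.toReal_nonneg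
  rw [measureReal_def, countGood, h1, ENNReal.toReal_ofReal (by
    unfold goodMass at hQ
    positivity), mul_div_assoc, goodMass]

lemma measure_encard_pointsIn (h : IsMarkedPoisson Y γ Λ ρ μ) {B : Set E} (hB : MeasurableSet B)
    (hΛ : ∀ n, Λ n B ≠ ⊤) (k : ℕ) :
    μ.real {ω | (pointsIn Y B ω).encard = k} =
      Real.exp (-∑ n, (Λ n B).toReal) * (∑ n, (Λ n B).toReal) ^ k / k.factorial := by
  have h1 := h.measure_count_good hB MeasurableSet.empty (Set.disjoint_empty B) hΛ
    (fun n => by simp) (good := fun _ => Set.univ) (fun _ => MeasurableSet.univ) k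
  have h2 : ∀ ω, pointsIn Y (∅ : Set E) ω = ∅ := fun ω => by simp [pointsIn]
  simp only [h2, and_true, Set.mem_univ, implies_true, measure_empty, ENNReal.toReal_zero,
    add_zero] at h1
  rw [measureReal_def, h1, ENNReal.toReal_ofReal]
  · simp
  · have : 0 ≤ ∑ n, (Λ n B).toReal := Finset.sum_nonneg fun _ _ => ENNReal.toReal_nonneg
    simp
    positivity

lemma measure_two_le_encard_le (h : IsMarkedPoisson Y γ Λ ρ μ) {B : Set E}
    (hB : MeasurableSet B) (hΛ : ∀ n, Λ n B ≠ ⊤) :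
    μ.real {ω | 2 ≤ (pointsIn Y B ω).encard} ≤ (∑ n, (Λ n B).toReal) ^ 2 := by
  set δ := ∑ n, (Λ n B).toReal with hδ
  have hδ0 : 0 ≤ δ := Finset.sum_nonneg fun _ _ => ENNReal.toReal_nonneg
  have hm : ∀ k : ℕ, MeasurableSet {ω | (pointsIn Y B ω).encard = k} := fun k =>
    h.measurable_encard_pointsIn hB (measurableSet_singleton _)
  have hset : {ω | 2 ≤ (pointsIn Y B ω).encard} =
      ({ω | (pointsIn Y B ω).encard = (0 : ℕ)} ∪ {ω | (pointsIn Y B ω).encard = (1 : ℕ)})ᶜ := by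
    ext ω
    simp only [Set.mem_compl_iff, Set.mem_union, Set.mem_ofPred_eq]
    induction (pointsIn Y B ω).encard using ENat.recTopCoe with
    | top => simp
    | coe k =>
      norm_cast
      omega
  have hdisj : Disjoint {ω | (pointsIn Y B ω).encard = (0 : ℕ)}
      {ω | (pointsIn Y B ω).encard = (1 : ℕ)} :=
    Set.disjoint_left.mpr fun ω h0 h1 => by
      rw [Set.mem_ofPred_eq] at h0 h1
      rw [h0] at h1
      exact absurd h1 (by norm_num)
  rw [hset, probReal_compl_eq_one_sub ((hm 0).union (hm 1)), measureReal_union hdisj (hm 1),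
    h.measure_encard_pointsIn hB hΛ, h.measure_encard_pointsIn hB hΛ, ← hδ]
  -- 1 - e^{-δ}(1 + δ) ≤ 1 - (1 - δ)(1 + δ) = δ².
  have := Real.add_one_le_exp (-δ)
  simp only [pow_zero, pow_one, Nat.factorial_zero, Nat.factorial_one, Nat.cast_one, div_one,
    mul_one]
  nlinarith

end IsMarkedPoisson

end Marked

end XLOS

namespace XLOS

/-! ### The probability that the M strongest points are good -/

section Marked

variable {Ω : Type*} {E : Type*} {N M : ℕ} {l : E → ℝ} {good : Fin N → Set (E × ℝ)}
  {Y : Fin N → ℕ → Ω → E} {γ : Fin N → ℕ → Ω → ℝ}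

lemma pointsIn_mono {A B : Set E} (h : A ⊆ B) (ω : Ω) : pointsIn Y A ω ⊆ pointsIn Y B ω :=
  fun _ hp => h hp

lemma sublevel_mono {s t : ℝ} (hst : s ≤ t) : sublevel l s ⊆ sublevel l t :=
  fun _ h => lt_of_lt_of_le (b := s) h hst

lemma encard_pointsIn_add {s t : ℝ} (hst : s ≤ t) (ω : Ω) :
    (pointsIn Y (sublevel l s) ω).encard + (pointsIn Y (shell l s t) ω).encard =
      (pointsIn Y (sublevel l t) ω).encard := by
  rw [← Set.encard_union_eq, ← sublevel_union_shell hst]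
  · rfl
  · exact Set.disjoint_left.mpr fun p hp hp' =>
      Set.disjoint_left.mp (disjoint_sublevel_shell s t) hp hp'

/-- With exactly M points below `t`, these are the M strongest: such a point has at most M - 1 below
it, not counting itself, and any other point has at least these M below it. Ties cause no trouble.
-/
lemma mem_strongestGood_iff {t : ℝ} {ω : Ω}
    (hω : (pointsIn Y (sublevel l t) ω).encard = M) :
    ω ∈ strongestGood M l good Y γ ↔
      ∀ p ∈ pointsIn Y (sublevel l t) ω, (Y p.1 p.2 ω, γ p.1 p.2 ω) ∈ good p.1 := by
  have hfin : (pointsIn Y (sublevel l t) ω).Finite :=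
    Set.finite_of_encard_eq_coe hω
  refine ⟨fun h p hp => h p ?_, fun h p hp => h p ?_⟩
  · rw [← hω]
    refine (hfin.subset (pointsIn_mono (sublevel_mono (le_of_lt hp)) ω)).encard_lt_encard
      ⟨pointsIn_mono (sublevel_mono (le_of_lt hp)) ω, fun hsub => ?_⟩
    have hlt : l (Y p.1 p.2 ω) < l (Y p.1 p.2 ω) := hsub hp
    exact lt_irrefl _ hlt
  · by_contra hp'
    have hle : t ≤ l (Y p.1 p.2 ω) := not_lt.mp hp'
    exact not_le.mpr hp (hω.symm.le.trans
      (Set.encard_le_encard (pointsIn_mono (sublevel_mono hle) ω)))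

lemma countGood_subset {s t : ℝ} (hst : s ≤ t) :
    IsMarkedPoisson.countGood M l good Y γ s t ⊆ IsMarkedPoisson.countGood M l good Y γ t t :=
  fun ω h => by
    have h1 := encard_pointsIn_add (l := l) (Y := Y) hst ω
    rw [h.1.2, Set.encard_empty, add_zero] at h1
    refine ⟨⟨h1.symm.trans h.1.1, ?_⟩, fun p hp => ?_⟩
    · ext p
      simp [pointsIn, shell]
    · rcases lt_or_ge (l (Y p.1 p.2 ω)) s with hs | hs
      · exact h.2 p hs
      · have : p ∈ pointsIn Y (shell l s t) ω := ⟨hs, hp⟩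
        rw [h.1.2] at this
        exact this.elim

/-- Lower half of the sandwich: with M good points below `t`, failure of the event at `s` means that
one of them lies in the shell, so that the M-th level does. -/
lemma countGood_diff_subset {s t : ℝ} (hst : s ≤ t) :
    IsMarkedPoisson.countGood M l good Y γ t t \ IsMarkedPoisson.countGood M l good Y γ s t ⊆
      strongestGood M l good Y γ ∩ ({ω | M ≤ (pointsIn Y (sublevel l t) ω).encard} \
        {ω | M ≤ (pointsIn Y (sublevel l s) ω).encard}) := fun ω h => by
  refine ⟨(mem_strongestGood_iff h.1.1.1).mpr h.1.2, h.1.1.1.symm.le, fun hs => h.2 ?_⟩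
  have h1 := encard_pointsIn_add (l := l) (Y := Y) hst ω
  rw [h.1.1.1] at h1
  have h2 : (pointsIn Y (sublevel l s) ω).encard = M :=
    le_antisymm (le_self_add.trans_eq h1) hs
  rw [h2] at h1
  have h3 : (pointsIn Y (shell l s t) ω).encard = 0 :=
    WithTop.add_left_cancel (ENat.natCast_ne_top M) (h1.trans (add_zero _).symm)
  exact ⟨⟨h2, Set.encard_eq_zero.mp h3⟩, fun p hp => h.1.2 p (sublevel_mono hst hp)⟩

/-- Upper half: if the count passes M inside the shell, it either stops at M or overshoots, and
overshooting from below M takes two points. -/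
lemma inter_diff_subset {s t : ℝ} (hst : s ≤ t) :
    strongestGood M l good Y γ ∩ ({ω | M ≤ (pointsIn Y (sublevel l t) ω).encard} \
        {ω | M ≤ (pointsIn Y (sublevel l s) ω).encard}) ⊆
      (IsMarkedPoisson.countGood M l good Y γ t t \
        IsMarkedPoisson.countGood M l good Y γ s t) ∪
        {ω | 2 ≤ (pointsIn Y (shell l s t) ω).encard} := fun ω h => by
  obtain ⟨hF, ht, hs⟩ := h
  simp only [Set.mem_ofPred_eq, not_le] at ht hs
  by_cases hM : (pointsIn Y (sublevel l t) ω).encard = M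
  · refine Or.inl ⟨⟨⟨hM, ?_⟩, (mem_strongestGood_iff hM).mp hF⟩, fun h => hs.ne h.1.1⟩
    ext p
    simp [pointsIn, shell]
  · refine Or.inr ?_
    have h1 := encard_pointsIn_add (l := l) (Y := Y) hst ω
    have h2 := lt_of_le_of_ne ht (Ne.symm hM)
    rw [← h1] at h2
    rw [Set.mem_ofPred_eq]
    generalize (pointsIn Y (sublevel l s) ω).encard = a at hs h2
    generalize (pointsIn Y (shell l s t) ω).encard = b at h2
    induction b using ENat.recTopCoe with
    | top => exact le_top
    | coe b =>
      induction a using ENat.recTopCoe with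
      | top => exact absurd hs (by simp)
      | coe a =>
        norm_cast at hs h2 ⊢
        omega

variable [MeasurableSpace Ω] [MeasurableSpace E] {Λ : Fin N → Measure E} {ρ : Measure ℝ}
  {μ : Measure Ω}

lemma IsLevel.continuousOn_goodMass [IsProbabilityMeasure ρ] (hl : IsLevel Λ l) :
    ContinuousOn (goodMass Λ ρ l good) (Set.Ici 0) := by
  refine (LipschitzOnWith.of_dist_le_mul (K := 1) fun x hx y hy => ?_).continuousOn
  rw [NNReal.coe_one, one_mul, Real.dist_eq, Real.dist_eq]
  rcases le_total x y with hxy | hxy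
  · have := hl.goodMass_sub_mem (ρ := ρ) (good := good) hxy hx
    rw [abs_sub_comm, abs_sub_comm x, abs_of_nonneg (sub_nonneg.mpr hxy), abs_of_nonneg this.1]
    exact this.2
  · have := hl.goodMass_sub_mem (ρ := ρ) (good := good) hxy hy
    rw [abs_of_nonneg (sub_nonneg.mpr hxy), abs_of_nonneg this.1]
    exact this.2

lemma IsLevel.goodMass_mem [IsProbabilityMeasure ρ] (hl : IsLevel Λ l) {t : ℝ} (ht : 0 ≤ t) :
    0 ≤ goodMass Λ ρ l good t ∧ goodMass Λ ρ l good t ≤ t := by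
  have := hl.goodMass_sub_mem (ρ := ρ) (good := good) ht le_rfl
  rwa [hl.goodMass_zero, sub_zero, sub_zero] at this

lemma IsLevel.integrableOn_exp_mul_goodMass_pow [IsProbabilityMeasure ρ] (hl : IsLevel Λ l)
    (M : ℕ) :
    IntegrableOn (fun w => Real.exp (-w) * (goodMass Λ ρ l good w ^ M / M.factorial))
      (Set.Ioi 0) := by
  have h1 := Real.GammaIntegral_convergent (s := M + 1) (by positivity)
  simp only [add_sub_cancel_right, Real.rpow_natCast] at h1
  refine Integrable.mono' h1 ?_ ?_
  · refine ContinuousOn.aestronglyMeasurable ?_ measurableSet_Ioi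
    exact (by fun_prop : Continuous fun w : ℝ => Real.exp (-w)).continuousOn.mul
      (((hl.continuousOn_goodMass.mono Set.Ioi_subset_Ici_self).pow M).div_const _)
  · refine (ae_restrict_iff' measurableSet_Ioi).mpr (Eventually.of_forall fun w hw => ?_)
    have hQ := hl.goodMass_mem (ρ := ρ) (good := good) (le_of_lt hw)
    have hf : (1 : ℝ) ≤ M.factorial := by exact_mod_cast M.factorial_pos
    rw [norm_mul, Real.norm_of_nonneg (Real.exp_pos _).le, Real.norm_of_nonneg
      (div_nonneg (pow_nonneg hQ.1 _) (by positivity))]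
    gcongr
    exact (div_le_self (pow_nonneg hQ.1 _) hf).trans (pow_le_pow_left₀ hQ.1 hQ.2 M)

namespace IsMarkedPoisson

variable [IsProbabilityMeasure μ] [IsProbabilityMeasure ρ]

lemma measure_inter_sub (h : IsMarkedPoisson Y γ Λ ρ μ) (hl : IsLevel Λ l)
    (hgood : ∀ n, MeasurableSet (good n)) (M : ℕ) {s t : ℝ} (hs : 0 ≤ s) (hst : s ≤ t) :
    Real.exp (-t) * (goodMass Λ ρ l good t ^ M / M.factorial -
        goodMass Λ ρ l good s ^ M / M.factorial) ≤
      μ.real (strongestGood M l good Y γ ∩ {ω | M ≤ (pointsIn Y (sublevel l t) ω).encard}) -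
        μ.real (strongestGood M l good Y γ ∩ {ω | M ≤ (pointsIn Y (sublevel l s) ω).encard}) ∧
    μ.real (strongestGood M l good Y γ ∩ {ω | M ≤ (pointsIn Y (sublevel l t) ω).encard}) -
        μ.real (strongestGood M l good Y γ ∩ {ω | M ≤ (pointsIn Y (sublevel l s) ω).encard}) ≤
      Real.exp (-t) * (goodMass Λ ρ l good t ^ M / M.factorial -
        goodMass Λ ρ l good s ^ M / M.factorial) + (t - s) ^ 2 := by
  set A : ℝ → Set Ω := fun t => {ω | M ≤ (pointsIn Y (sublevel l t) ω).encard} with hA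
  set F := strongestGood M l good Y γ with hF
  have hAm : ∀ t, MeasurableSet (A t) := fun t =>
    h.measurable_encard_pointsIn (measurableSet_sublevel hl.measurable t)
      (MeasurableSet.of_discrete (s := Set.Ici (M : ℕ∞)))
  have hFm : NullMeasurableSet F μ := h.nullMeasurableSet_strongestGood hl.measurable hgood M
  have hsub : A s ⊆ A t := fun ω hω =>
    le_trans (b := (pointsIn Y (sublevel l s) ω).encard) hω
      (Set.encard_le_encard (pointsIn_mono (sublevel_mono hst) ω))
  have h1 : μ.real (F ∩ A t) - μ.real (F ∩ A s) = μ.real (F ∩ (A t \ A s)) := by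
    rw [sub_eq_iff_eq_add, ← measureReal_union₀' _ _]
    · rw [← Set.inter_union_distrib_left, Set.sdiff_union_of_subset hsub]
    · exact hFm.inter ((hAm t).diff (hAm s)).nullMeasurableSet
    · exact (Set.disjoint_left.mpr fun ω h h' => h.2.2 h'.2).aedisjoint
  have h2 : μ.real (countGood M l good Y γ t t \ countGood M l good Y γ s t) =
      Real.exp (-t) * (goodMass Λ ρ l good t ^ M / M.factorial -
        goodMass Λ ρ l good s ^ M / M.factorial) := by
    have hd := measureReal_union₀' (μ := μ)
      (t := countGood M l good Y γ t t \ countGood M l good Y γ s t)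
      (h.nullMeasurableSet_countGood hl.measurable hgood M s t)
      (Set.disjoint_sdiff_right).aedisjoint
    rw [Set.union_sdiff_cancel (countGood_subset hst)] at hd
    rw [eq_sub_of_add_eq' hd.symm,
      h.measure_countGood hl hgood M (hs.trans hst) le_rfl, h.measure_countGood hl hgood M hs hst,
      mul_sub]
  rw [h1, ← h2]
  refine ⟨measureReal_mono (countGood_diff_subset hst),
    (measureReal_mono (inter_diff_subset hst)).trans ((measureReal_union_le _ _).trans ?_)⟩
  gcongr
  have h3 := h.measure_two_le_encard_le (measurableSet_shell hl.measurable s t)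
    (hl.measure_shell_ne_top s t)
  rwa [hl.sum_measure_shell hs hst] at h3

lemma measure_encard_sublevel_lt_le (h : IsMarkedPoisson Y γ Λ ρ μ) (hl : IsLevel Λ l) (M : ℕ)
    {t : ℝ} (ht : 0 ≤ t) :
    μ.real {ω | (pointsIn Y (sublevel l t) ω).encard < M} ≤
      ∑ k ∈ Finset.range M, t ^ k * Real.exp (-t) := by
  have hset : {ω | (pointsIn Y (sublevel l t) ω).encard < M} =
      ⋃ k ∈ Finset.range M, {ω | (pointsIn Y (sublevel l t) ω).encard = k} := by
    ext ω
    simp only [Set.mem_ofPred_eq, Set.mem_iUnion, Finset.mem_range, exists_prop]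
    induction (pointsIn Y (sublevel l t) ω).encard using ENat.recTopCoe with
    | top => simp
    | coe k => simp
  rw [hset]
  refine (measureReal_biUnion_finset_le _ _).trans (Finset.sum_le_sum fun k _ => ?_)
  rw [h.measure_encard_pointsIn (measurableSet_sublevel hl.measurable t) (fun n => hl.ne_top n t),
    hl.sum_eq t ht, mul_comm]
  exact div_le_self (by positivity) (by exact_mod_cast k.factorial_pos)

/-- The event is localised to at least M points below w. The localised probability vanishes at w = 0
and its increments determine it; as w tends to infinity, fewer than M points below w becomes
improbable and the boundary term e^{-w} Q(w)^M/M! disappears. -/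
theorem measure_strongestGood (h : IsMarkedPoisson Y γ Λ ρ μ) (hl : IsLevel Λ l)
    (hgood : ∀ n, MeasurableSet (good n)) (hM : 0 < M) :
    μ.real (strongestGood M l good Y γ) =
      ∫ w in Set.Ioi 0, Real.exp (-w) * (goodMass Λ ρ l good w ^ M / M.factorial) := by
  set F := strongestGood M l good Y γ with hF
  set Q := goodMass Λ ρ l good with hQ
  set A : ℝ → Set Ω := fun t => {ω | M ≤ (pointsIn Y (sublevel l t) ω).encard} with hA
  have hf : (1 : ℝ) ≤ M.factorial := by exact_mod_cast M.factorial_pos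
  have hφ0 : μ.real (F ∩ A 0) = 0 := by
    refine le_antisymm ?_ measureReal_nonneg
    have h1 := h.measure_encard_pointsIn (measurableSet_sublevel hl.measurable 0)
      (fun n => hl.ne_top n 0) 0
    rw [hl.sum_eq 0 le_rfl] at h1
    have h2 : MeasurableSet {ω | (pointsIn Y (sublevel l 0) ω).encard = (0 : ℕ)} :=
      h.measurable_encard_pointsIn (measurableSet_sublevel hl.measurable 0)
        (measurableSet_singleton _)
    have h3 := probReal_compl_eq_one_sub (μ := μ) h2
    rw [h1] at h3
    refine (measureReal_mono fun ω hω => ?_).trans_eq (h3.trans (by simp))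
    intro h4
    have h5 : (M : ℕ∞) ≤ (pointsIn Y (sublevel l 0) ω).encard := hω.2
    rw [h4] at h5
    exact absurd (Nat.cast_le.mp h5) (by omega)
  have hmain : ∀ w, 0 ≤ w → μ.real (F ∩ A w) =
      (∫ v in (0 : ℝ)..w, Real.exp (-v) * (Q v ^ M / M.factorial)) +
        Real.exp (-w) * (Q w ^ M / M.factorial) := fun w hw => by
    -- The Lipschitz constant comes from |a^M - b^M| ≤ M max(a,b)^{M-1} |a - b| together with Q(v) ≤
    -- v ≤ w.
    refine eq_integral_of_increments (φ := fun w => μ.real (F ∩ A w))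
      (G := fun w => Q w ^ M / M.factorial) (C := M * w ^ (M - 1)) hw hφ0 ?_
      (fun s t hs hst htw => ?_) (fun s t hs hst => (h.measure_inter_sub hl hgood M hs hst).1)
      (fun s t hs hst => (h.measure_inter_sub hl hgood M hs hst).2)
    · simp only [hQ, hl.goodMass_zero, zero_pow hM.ne', zero_div]
    · have d := hl.goodMass_sub_mem (ρ := ρ) (good := good) hst hs
      have m1 := hl.goodMass_mem (ρ := ρ) (good := good) hs
      have m2 := hl.goodMass_mem (ρ := ρ) (good := good) (hs.trans hst)
      rw [← hQ] at d m1 m2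
      rw [← sub_div, abs_div, abs_of_pos (by positivity : (0 : ℝ) < M.factorial)]
      refine (div_le_self (abs_nonneg _) hf).trans ((abs_pow_sub_pow_le _ _ _).trans ?_)
      rw [abs_of_nonneg d.1, abs_of_nonneg m1.1, abs_of_nonneg m2.1, mul_comm (Q t - Q s),
        mul_right_comm]
      have hmax : max (Q t) (Q s) ≤ w := max_le (m2.2.trans htw) (m1.2.trans (hst.trans htw))
      have hmax0 : 0 ≤ max (Q t) (Q s) := le_max_of_le_left m2.1
      have := d.1
      exact mul_le_mul (by gcongr) d.2 d.1 (by positivity)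
  have hlim1 : Tendsto (fun w => μ.real (F ∩ A w)) atTop (𝓝 (μ.real F)) := by
    have hz : Tendsto (fun w : ℝ => ∑ k ∈ Finset.range M, w ^ k * Real.exp (-w)) atTop (𝓝 0) := by
      have := tendsto_finsetSum (Finset.range M) fun k _ =>
        Real.tendsto_pow_mul_exp_neg_atTop_nhds_zero k
      simpa using this
    have hlow : Tendsto (fun w : ℝ => μ.real F - ∑ k ∈ Finset.range M, w ^ k * Real.exp (-w))
        atTop (𝓝 (μ.real F)) := by
      simpa using hz.const_sub (μ.real F)
    refine tendsto_of_tendsto_of_tendsto_of_le_of_le' hlow tendsto_const_nhds ?_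
      (Eventually.of_forall fun w => measureReal_mono Set.inter_subset_left)
    filter_upwards [eventually_ge_atTop 0] with w hw
    rw [sub_le_iff_le_add]
    have hsub : F ⊆ (F ∩ A w) ∪ {ω | (pointsIn Y (sublevel l w) ω).encard < M} := fun ω hω => by
      by_cases hw : ω ∈ A w
      · exact Or.inl ⟨hω, hw⟩
      · exact Or.inr (lt_of_not_ge hw : (pointsIn Y (sublevel l w) ω).encard < M)
    exact (measureReal_mono hsub).trans ((measureReal_union_le _ _).trans
      (add_le_add le_rfl (h.measure_encard_sublevel_lt_le hl M hw)))
  have hlim2 : Tendsto (fun w => (∫ v in (0 : ℝ)..w, Real.exp (-v) * (Q v ^ M / M.factorial)) +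
      Real.exp (-w) * (Q w ^ M / M.factorial)) atTop
      (𝓝 ((∫ w in Set.Ioi 0, Real.exp (-w) * (Q w ^ M / M.factorial)) + 0)) := by
    refine (intervalIntegral_tendsto_integral_Ioi 0 (hl.integrableOn_exp_mul_goodMass_pow M)
      tendsto_id).add ?_
    refine squeeze_zero' ?_ ?_ (Real.tendsto_pow_mul_exp_neg_atTop_nhds_zero M)
    · filter_upwards [eventually_ge_atTop 0] with w hw
      have := (hl.goodMass_mem (ρ := ρ) (good := good) hw).1
      positivity
    · filter_upwards [eventually_ge_atTop 0] with w hw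
      have hm := hl.goodMass_mem (ρ := ρ) (good := good) hw
      rw [mul_comm]
      gcongr
      exact (div_le_self (pow_nonneg hm.1 _) hf).trans (pow_le_pow_left₀ hm.1 hm.2 M)
  rw [add_zero] at hlim2
  refine tendsto_nhds_unique hlim1 (hlim2.congr' ?_)
  filter_upwards [eventually_ge_atTop 0] with w hw
  exact (hmain w hw).symm

end IsMarkedPoisson

end Marked

end XLOS

namespace XLOS

/-! ## Averages of ordered integrals -/

lemma AbsolutelyContinuousOnInterval.fun_pow {f : ℝ → ℝ} {a b : ℝ}
    (hf : AbsolutelyContinuousOnInterval f a b) (k : ℕ) :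
    AbsolutelyContinuousOnInterval (fun x => f x ^ k) a b := by
  induction k with
  | zero =>
    simp only [pow_zero]
    exact contDiffOn_const.absolutelyContinuousOnInterval
  | succ k ih =>
    simp only [pow_succ]
    exact ih.fun_mul hf

/-- For merely integrable `f` the primitive is absolutely continuous and differentiable almost
everywhere with derivative `f`, which suffices for the fundamental theorem applied to its power. -/
lemma integral_pow_mul_of_primitive {f : ℝ → ℝ} {y : ℝ} (hf : IntervalIntegrable f volume 0 y)
    (k : ℕ) :
    ∫ z in (0 : ℝ)..y, f z * (∫ t in (0 : ℝ)..z, f t) ^ k =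
      (∫ t in (0 : ℝ)..y, f t) ^ (k + 1) / (k + 1) := by
  have hac := hf.absolutelyContinuousOnInterval_intervalIntegral (c := 0) Set.left_mem_uIcc
  have h1 := (AbsolutelyContinuousOnInterval.fun_pow hac (k + 1)).integral_deriv_eq_sub
  rw [intervalIntegral.integral_same, zero_pow (Nat.succ_ne_zero k), sub_zero] at h1
  rw [← h1, eq_div_iff (by positivity), ← intervalIntegral.integral_mul_const]
  refine intervalIntegral.integral_congr_ae ?_
  filter_upwards [hf.ae_hasDerivAt_integral] with z hz hz'
  have h2 := (hz (Set.uIoc_subset_uIcc hz') 0 Set.left_mem_uIcc).fun_pow (k + 1)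
  rw [h2.deriv]
  push_cast
  ring

lemma lintegral_mul_pow_of_primitive {f : ℝ → ENNReal} (hf : Measurable f) {y : ℝ} (hy : 0 ≤ y)
    (hfin : ∫⁻ z in Set.Ioc 0 y, f z ≠ ⊤) (k : ℕ) :
    ∫⁻ z in Set.Ioc 0 y, f z * (∫⁻ t in Set.Ioc 0 z, f t) ^ k =
      (∫⁻ z in Set.Ioc 0 y, f z) ^ (k + 1) / (k + 1) := by
  have hae : ∀ᵐ z ∂volume.restrict (Set.Ioc 0 y), f z < ⊤ := ae_lt_top hf hfin
  set g : ℝ → ℝ := fun z => (f z).toReal with hg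
  have hint : IntegrableOn g (Set.Ioc 0 y) := integrable_toReal_of_lintegral_ne_top hf.aemeasurable
    hfin
  have hprim : ∀ z, 0 ≤ z → z ≤ y → ∫⁻ t in Set.Ioc 0 z, f t =
      ENNReal.ofReal (∫ t in (0 : ℝ)..z, g t) := fun z hz hzy => by
    have hsub : Set.Ioc 0 z ⊆ Set.Ioc 0 y := Set.Ioc_subset_Ioc_right hzy
    rw [intervalIntegral.integral_of_le hz,
      integral_toReal hf.aemeasurable (ae_restrict_of_ae_restrict_of_subset hsub hae),
      ENNReal.ofReal_toReal (ne_top_of_le_ne_top hfin (lintegral_mono_set hsub))]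
  have hpos : ∀ z, 0 ≤ z → 0 ≤ ∫ t in (0 : ℝ)..z, g t := fun z hz =>
    intervalIntegral.integral_nonneg hz fun _ _ => ENNReal.toReal_nonneg
  have hii : IntervalIntegrable g volume 0 y := (intervalIntegrable_iff_integrableOn_Ioc_of_le
    hy).mpr hint
  have h1 : ∫⁻ z in Set.Ioc 0 y, f z * (∫⁻ t in Set.Ioc 0 z, f t) ^ k =
      ∫⁻ z in Set.Ioc 0 y, ENNReal.ofReal (g z * (∫ t in (0 : ℝ)..z, g t) ^ k) := by
    refine lintegral_congr_ae ?_
    filter_upwards [hae, ae_restrict_mem measurableSet_Ioc] with z hz hz'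
    rw [hprim z hz'.1.le hz'.2, ENNReal.ofReal_mul ENNReal.toReal_nonneg,
      ENNReal.ofReal_toReal hz.ne, ENNReal.ofReal_pow (hpos z hz'.1.le)]
  have hii2 : IntegrableOn (fun z => g z * (∫ t in (0 : ℝ)..z, g t) ^ k) (Set.Ioc 0 y) := by
    refine (intervalIntegrable_iff_integrableOn_Ioc_of_le hy).mp (hii.mul_continuousOn ?_)
    exact (hii.absolutelyContinuousOnInterval_intervalIntegral
      Set.left_mem_uIcc).continuousOn.pow k
  rw [h1, ← ofReal_integral_eq_lintegral_ofReal hii2 ?_, ← intervalIntegral.integral_of_le hy,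
    integral_pow_mul_of_primitive hii, hprim y hy le_rfl, ENNReal.ofReal_div_of_pos (by positivity),
    ENNReal.ofReal_pow (hpos y hy)]
  · congr 1
    rw [ENNReal.ofReal_add (by positivity) zero_le_one]
    simp
  · filter_upwards [ae_restrict_mem measurableSet_Ioc] with z hz
    exact mul_nonneg ENNReal.toReal_nonneg (pow_nonneg (hpos z hz.1.le) k)

/-- The ordered region is a k!-th part of the cube; the recursion yields this without a
symmetrisation argument. -/
lemma ordInt_const {f : ℝ → ENNReal} (hf : Measurable f) {y : ℝ} (hy : 0 ≤ y)
    (hfin : ∫⁻ z in Set.Ioc 0 y, f z ≠ ⊤) (k : ℕ) :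
    ordInt k (fun _ => f) y = (∫⁻ z in Set.Ioc 0 y, f z) ^ k / k.factorial := by
  induction k generalizing y with
  | zero => simp
  | succ k ih =>
    have h1 : ∀ z ∈ Set.Ioc 0 y, f z * ordInt k (fun _ => f) z =
        f z * (∫⁻ t in Set.Ioc 0 z, f t) ^ k * ((k.factorial : ENNReal))⁻¹ := fun z hz => by
      rw [ih hz.1.le (ne_top_of_le_ne_top hfin
        (lintegral_mono_set (Set.Ioc_subset_Ioc_right hz.2))), div_eq_mul_inv, mul_assoc]
    rw [ordInt_succ, setLIntegral_congr_fun measurableSet_Ioc h1, lintegral_mul_const' _ _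
      (ENNReal.inv_ne_top.mpr (by exact_mod_cast k.factorial_ne_zero)),
      lintegral_mul_pow_of_primitive hf hy hfin, Nat.factorial_succ, div_eq_mul_inv,
      div_eq_mul_inv, mul_assoc]
    push_cast
    rw [ENNReal.mul_inv (by simp) (by simp)]

/-- Ordered integrals are multilinear in their factors and each factor has its own abscissa, so
averaging acts factor by factor. -/
lemma lintegral_ordInt {k : ℕ} {w : ℝ → ENNReal} (hw : Measurable w)
    {F : Fin k → ℝ → ℝ → ENNReal} (hF : ∀ m, Measurable fun q : ℝ × ℝ => F m q.1 q.2) (y : ℝ) :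
    ∫⁻ u : Fin k → ℝ, (∏ m, w (u m)) * ordInt k (fun m => F m (u m)) y =
      ordInt k (fun m z => ∫⁻ v, w v * F m v z) y := by
  induction k generalizing y with
  | zero => simp [volume_pi]
  | succ k ih =>
    set O : (Fin k → ℝ) → ℝ → ENNReal := fun u z => ordInt k (fun m => F m.castSucc (u m)) z
      with hO
    have hOm : Measurable fun q : (Fin k → ℝ) × ℝ => O q.1 q.2 :=
      measurable_ordInt (F := fun m (u : Fin k → ℝ) z => F m.castSucc (u m) z) fun m =>
        (hF m.castSucc).comp (g := fun q : ℝ × ℝ => F m.castSucc q.1 q.2)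
          (f := fun q : (Fin k → ℝ) × ℝ => (q.1 m, q.2)) (by fun_prop)
    have h1 := lintegral_initLast (k := k) (fun p => (∏ m, w (p.1 m)) * w p.2 *
      ∫⁻ z in Set.Ioc 0 y, F (Fin.last k) p.2 z * O p.1 z)
    simp only [Fin.prod_univ_castSucc, ordInt_succ]
    rw [h1]
    have hm : Measurable fun q : ((Fin k → ℝ) × ℝ) × ℝ =>
        (∏ m, w (q.1.1 m)) * w q.1.2 * (F (Fin.last k) q.1.2 q.2 * O q.1.1 q.2) := by
      refine Measurable.mul (Measurable.mul (Finset.measurable_fun_prod _ fun m _ => by fun_prop)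
        (by fun_prop)) (Measurable.mul ?_ ?_)
      · exact (hF (Fin.last k)).comp ((measurable_snd.comp measurable_fst).prodMk measurable_snd)
      · exact hOm.comp ((measurable_fst.comp measurable_fst).prodMk measurable_snd)
    have hsec : ∀ p : (Fin k → ℝ) × ℝ, Measurable fun z => F (Fin.last k) p.2 z * O p.1 z :=
      fun p => ((hF (Fin.last k)).comp (measurable_const.prodMk measurable_id)).mul
        (hOm.comp (measurable_const.prodMk measurable_id))
    simp_rw [fun p : (Fin k → ℝ) × ℝ => (lintegral_const_mul (μ := volume.restrict (Set.Ioc 0 y))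
      ((∏ m, w (p.1 m)) * w p.2) (hsec p)).symm]
    rw [lintegral_lintegral_swap hm.aemeasurable]
    refine lintegral_congr fun z => ?_
    rw [← ih (fun m => hF m.castSucc), mul_comm, Measure.volume_eq_prod, ← lintegral_prod_mul]
    · refine lintegral_congr fun p => ?_
      simp only [hO]
      ring
    · refine (Measurable.mul (Finset.measurable_fun_prod _ fun m _ => by fun_prop) ?_).aemeasurable
      exact hOm.comp (measurable_id.prodMk measurable_const)
    · exact (hw.mul ((hF (Fin.last k)).comp (measurable_id.prodMk measurable_const))).aemeasurable

/-- The same multilinearity for sums over assignments. -/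
lemma sum_prod_mul_ordInt {ι : Type*} [Fintype ι] {k : ℕ} (b : ι → ENNReal)
    {f : ι → ℝ → ENNReal} (hf : ∀ i, Measurable (f i)) (y : ℝ) :
    ∑ n : Fin k → ι, (∏ m, b (n m)) * ordInt k (fun m => f (n m)) y =
      ordInt k (fun _ z => ∑ i, b i * f i z) y := by
  induction k generalizing y with
  | zero => simp
  | succ k ih =>
    have hm : ∀ (i : ι) (n : Fin k → ι), Measurable fun z => f i z * ordInt k (fun m => f (n m)) z :=
      fun i n => (hf i).mul (measurable_ordInt_right fun m => hf _)
    rw [← (Fin.snocEquiv fun _ : Fin (k + 1) => ι).sum_comp, Fintype.sum_prod_type]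
    simp only [Fin.snocEquiv_apply, ordInt_succ, Fin.prod_univ_castSucc, Fin.snoc_last,
      Fin.snoc_castSucc]
    simp_rw [← lintegral_const_mul _ (hm _ _)]
    simp_rw [← lintegral_finsetSum _ fun n _ => (hm _ n).const_mul _]
    rw [← lintegral_finsetSum _ fun i _ => Finset.measurable_fun_sum _ fun n _ =>
      (hm i n).const_mul _]
    refine lintegral_congr fun z => ?_
    rw [← ih, Finset.sum_mul_sum]
    refine Finset.sum_congr rfl fun i _ => Finset.sum_congr rfl fun n _ => ?_
    ring

end XLOS

/-! ### Geometry of the cells with small K-factor -/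

namespace XLOS

lemma lintegral_stepFun {β x y : ℝ} (hβ : 0 < β) (hx : 0 < x) (hy : 0 ≤ y) :
    ENNReal.ofReal β * ∫⁻ z in Set.Ioc 0 y, stepFun β x z =
      ENNReal.ofReal (y ^ β - x ^ (-β)) := by
  have hx' : 0 < x⁻¹ := inv_pos.mpr hx
  have hpow : x ^ (-β) = x⁻¹ ^ β := by rw [Real.rpow_neg hx.le, Real.inv_rpow hx.le]
  have h1 : ∫⁻ z in Set.Ioc 0 y, stepFun β x z =
      ∫⁻ z in Set.Ioc x⁻¹ y, ENNReal.ofReal (z ^ (β - 1)) := by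
    rw [← lintegral_indicator measurableSet_Ioc, ← lintegral_indicator measurableSet_Ioc]
    refine lintegral_congr fun z => ?_
    have hiff : 1 < z * x ↔ x⁻¹ < z := by rw [← div_lt_iff₀ hx, one_div]
    by_cases hz : x⁻¹ < z
    · have hz0 : 0 < z := hx'.trans hz
      by_cases hzy : z ≤ y
      · rw [Set.indicator_of_mem (s := Set.Ioc 0 y) ⟨hz0, hzy⟩,
          Set.indicator_of_mem (s := Set.Ioc x⁻¹ y) ⟨hz, hzy⟩, stepFun, stepPow,
          if_pos (hiff.mpr hz)]
      · rw [Set.indicator_of_notMem fun h => hzy h.2, Set.indicator_of_notMem fun h => hzy h.2]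
    · rw [Set.indicator_of_notMem (s := Set.Ioc x⁻¹ y) fun h => hz h.1]
      refine Set.indicator_apply_eq_zero.mpr fun _ => ?_
      rw [stepFun, stepPow, if_neg (mt hiff.mp hz), ENNReal.ofReal_zero]
  rw [h1, hpow]
  rcases le_total x⁻¹ y with hxy | hxy
  · have hint : IntegrableOn (fun z : ℝ => z ^ (β - 1)) (Set.Ioc x⁻¹ y) :=
      (intervalIntegrable_iff_integrableOn_Ioc_of_le hxy).mp
        (intervalIntegral.intervalIntegrable_rpow' (by linarith))
    rw [← ofReal_integral_eq_lintegral_ofReal hint, ← ENNReal.ofReal_mul hβ.le,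
      ← intervalIntegral.integral_of_le hxy, integral_rpow (Or.inl (by linarith))]
    · congr 1
      rw [sub_add_cancel]
      field_simp
    · filter_upwards [ae_restrict_mem measurableSet_Ioc] with z hz
      exact Real.rpow_nonneg (hx'.trans hz.1).le _
  · rw [Set.Ioc_eq_empty (not_lt.mpr hxy), Measure.restrict_empty, lintegral_zero_measure,
      mul_zero, ENNReal.ofReal_of_nonpos (sub_nonpos.mpr (Real.rpow_le_rpow hy hxy hβ.le))]

/-- The lognormal law as an integral against the weight `e^{-u²}`. -/
lemma lognormalDB_apply (s : ℝ) {S : Set ℝ} (hS : MeasurableSet S) :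
    lognormalDB 0 s S = ENNReal.ofReal (√Real.pi)⁻¹ * ∫⁻ u, ENNReal.ofReal (Real.exp (-u ^ 2)) *
      S.indicator 1 ((10 : ℝ) ^ (√2 * s * u / 10)) := by
  -- The Gaussian of variance 1/2 has density e^{-u²}/√π; rescaling to it is the origin of the √2 in
  -- `nodeGain` and of the prefactor.
  have h1 : gaussianReal 0 (s ^ 2).toNNReal =
      (gaussianReal 0 (1 / 2)).map (fun u => √2 * s * u) := by
    rw [gaussianReal_map_const_mul, mul_zero]
    congr 1
    ext
    push_cast
    rw [Real.coe_toNNReal _ (sq_nonneg s), mul_pow, Real.sq_sqrt zero_le_two]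
    ring
  have hm : Measurable fun u : ℝ => (10 : ℝ) ^ (√2 * s * u / 10) := by fun_prop
  have h2 : lognormalDB 0 s = (gaussianReal 0 (1 / 2)).map
      (fun u => (10 : ℝ) ^ (√2 * s * u / 10)) := by
    rw [lognormalDB, h1, Measure.map_map (by fun_prop) (by fun_prop)]
    rfl
  have hi : Measurable fun u : ℝ => S.indicator (1 : ℝ → ENNReal) ((10 : ℝ) ^ (√2 * s * u / 10)) :=
    (measurable_one.indicator hS).comp hm
  rw [h2, ← lintegral_indicator_one hS, lintegral_map (measurable_one.indicator hS) hm,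
    gaussianReal_of_var_ne_zero _ (by norm_num),
    lintegral_withDensity_eq_lintegral_mul _ (measurable_gaussianPDF _ _) hi,
    ← lintegral_const_mul]
  · refine lintegral_congr fun u => ?_
    rw [Pi.mul_apply, ← mul_assoc, ← ENNReal.ofReal_mul (by positivity), gaussianPDF,
      gaussianPDFReal]
    congr 3
    · push_cast
      congr 2
      ring
    · push_cast
      congr 1
      ring
  · exact (by fun_prop : Measurable fun u : ℝ => ENNReal.ofReal (Real.exp (-u ^ 2))).mul
      ((measurable_one.indicator hS).comp hm)

instance isProbabilityMeasure_lognormalDB (m s : ℝ) : IsProbabilityMeasure (lognormalDB m s) :=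
  Measure.isProbabilityMeasure_map (by fun_prop)

namespace Network

variable {N : ℕ} (net : Network N)

/-- Mean number of cells closer to the origin than `y`. -/
noncomputable def level (y : EuclideanSpace ℝ (Fin 2)) : ℝ := net.rate * ‖y‖ ^ 2

/-- Cells of tier `n` with K-factor at most `Kth`. -/
def weakSet (Kth : ℝ) (n : Fin N) : Set (EuclideanSpace ℝ (Fin 2) × ℝ) :=
  {x | net.kFactor n x.2 x.1 ≤ Kth}

@[fun_prop]
lemma measurable_level : Measurable net.level := by unfold level; fun_prop

lemma measurableSet_weakSet (Kth : ℝ) (n : Fin N) : MeasurableSet (net.weakSet Kth n) := by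
  refine measurableSet_le ?_ measurable_const
  unfold kFactor
  fun_prop

lemma sublevel_level [NeZero N] (t : ℝ) :
    sublevel net.level t = Metric.ball 0 (√(t / net.rate)) := by
  ext y
  rw [mem_ball_zero_iff, Real.lt_sqrt (norm_nonneg y), lt_div_iff₀ net.rate_pos, mul_comm]
  rfl

lemma volume_ball_sqrt (t : ℝ) :
    volume (Metric.ball (0 : EuclideanSpace ℝ (Fin 2)) √t) = ENNReal.ofReal (Real.pi * t) := by
  rw [EuclideanSpace.volume_ball_fin_two]
  rcases le_total 0 t with ht | ht
  · rw [← ENNReal.ofReal_pow (Real.sqrt_nonneg t), Real.sq_sqrt ht, mul_comm Real.pi,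
      ENNReal.ofReal_mul ht, ENNReal.ofReal_eq_coe_nnreal Real.pi_pos.le]
  · rw [Real.sqrt_eq_zero_of_nonpos ht, ENNReal.ofReal_of_nonpos
      (mul_nonpos_of_nonneg_of_nonpos Real.pi_pos.le ht)]
    simp

lemma isLevel [NeZero N] :
    IsLevel (fun n => ENNReal.ofReal (net.lamTilde n) • volume) net.level where
  measurable := net.measurable_level
  ne_top n t := by
    rw [sublevel_level, Measure.smul_apply, volume_ball_sqrt, smul_eq_mul]
    exact ENNReal.mul_ne_top ENNReal.ofReal_ne_top ENNReal.ofReal_ne_top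
  sum_eq t ht := by
    have h1 : ∀ n, ((ENNReal.ofReal (net.lamTilde n) •
        (volume : Measure (EuclideanSpace ℝ (Fin 2)))) (sublevel net.level t)).toReal =
        net.lamTilde n * (Real.pi * (t / net.rate)) := fun n => by
      have := net.rate_pos
      rw [sublevel_level, Measure.smul_apply, volume_ball_sqrt, smul_eq_mul, ENNReal.toReal_mul,
        ENNReal.toReal_ofReal (net.lamTilde_pos n).le, ENNReal.toReal_ofReal (by positivity)]
    rw [Finset.sum_congr rfl fun n _ => h1 n, ← Finset.sum_mul, ← lamT, rate]
    have := net.lamT_pos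
    have := Real.pi_pos
    field_simp

/-- The origin must be excluded, since the convention 0^{-α} = 0 would make a cell there weak. -/
lemma kFactor_le_iff {Kth : ℝ} (hK : 0 < Kth) (n : Fin N) (u : ℝ)
    {y : EuclideanSpace ℝ (Fin 2)} (hy : y ≠ 0) :
    net.kFactor n (net.nodeGain u) y ≤ Kth ↔ net.thr Kth n u ^ (-net.expo) ≤ ‖y‖ ^ 2 := by
  have hy0 : 0 < ‖y‖ := norm_pos_iff.mpr hy
  have hα := net.alpha_pos
  have hg := net.nodeGain_pos u
  have hk := net.K_pos n
  have hO : 0 < net.Om n ^ (net.alpha / 2) := Real.rpow_pos_of_pos (net.Om_pos n) _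
  have ht := net.thr_pos hK n u
  have hp : 0 < ‖y‖ ^ net.alpha := Real.rpow_pos_of_pos hy0 _
  have h1 : net.kFactor n (net.nodeGain u) y ≤ Kth ↔ 1 ≤ net.thr Kth n u * ‖y‖ ^ net.alpha := by
    rw [kFactor, thr, neg_div, Real.rpow_neg (net.Om_pos n).le, Real.rpow_neg hy0.le,
      ← div_eq_mul_inv, ← div_eq_mul_inv, div_div, div_le_iff₀ (by positivity), div_mul_eq_mul_div,
      le_div_iff₀ (by positivity), one_mul, mul_comm (net.K n), mul_assoc Kth]
  have h2 : ‖y‖ ^ 2 = (‖y‖ ^ net.alpha) ^ net.expo := by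
    rw [← Real.rpow_mul hy0.le, expo, mul_div_cancel₀ _ hα.ne', Real.rpow_two]
  rw [h1, h2, Real.rpow_neg ht.le, ← Real.inv_rpow ht.le,
    Real.rpow_le_rpow_iff (inv_nonneg.mpr ht.le) hp.le net.expo_pos, inv_le_iff_one_le_mul₀' ht]

/-- For a fixed mark the weak cells fill an annulus up to a null set; `ENNReal.ofReal` truncates at
0 when the inner radius exceeds the outer one. -/
lemma volume_weak [NeZero N] {Kth : ℝ} (hK : 0 < Kth) (n : Fin N) (u t : ℝ) :
    volume {y | y ∈ sublevel net.level t ∧ net.kFactor n (net.nodeGain u) y ≤ Kth} =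
      ENNReal.ofReal (Real.pi * (t / net.rate - net.thr Kth n u ^ (-net.expo))) := by
  set a := net.thr Kth n u ^ (-net.expo) with ha
  have ha0 : 0 < a := Real.rpow_pos_of_pos (net.thr_pos hK n u) _
  have hae : {y | y ∈ sublevel net.level t ∧ net.kFactor n (net.nodeGain u) y ≤ Kth} =ᵐ[volume]
      (Metric.ball 0 √(t / net.rate) \ Metric.ball 0 √a : Set (EuclideanSpace ℝ (Fin 2))) := by
    have h0 : ∀ᵐ y : EuclideanSpace ℝ (Fin 2), y ≠ 0 := by
      simp [ae_iff, measure_singleton]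
    filter_upwards [h0] with y hy
    refine propext ?_
    change (y ∈ sublevel net.level t ∧ net.kFactor n (net.nodeGain u) y ≤ Kth) ↔
      (y ∈ Metric.ball 0 √(t / net.rate) ∧ y ∉ Metric.ball 0 √a)
    rw [net.kFactor_le_iff hK n u hy, sublevel_level, mem_ball_zero_iff (r := √a),
      Real.lt_sqrt (norm_nonneg y), not_lt]
  rw [measure_congr hae]
  rcases le_total a (t / net.rate) with h | h
  · rw [measure_sdiff (Metric.ball_subset_ball (Real.sqrt_le_sqrt h))
      Metric.isOpen_ball.measurableSet.nullMeasurableSet (by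
        rw [volume_ball_sqrt]; exact ENNReal.ofReal_ne_top), volume_ball_sqrt, volume_ball_sqrt,
      ← ENNReal.ofReal_sub _ (by positivity), mul_sub]
  · rw [Set.sdiff_eq_empty.mpr (Metric.ball_subset_ball (Real.sqrt_le_sqrt h)), measure_empty,
      ENNReal.ofReal_of_nonpos]
    exact mul_nonpos_of_nonneg_of_nonpos Real.pi_pos.le (sub_nonpos.mpr h)

end Network

end XLOS

namespace XLOS

/-! ### From the good mass to sums of ordered integrals -/

namespace Network

variable {N : ℕ} (net : Network N)

lemma measurable_nodeGain : Measurable net.nodeGain := by unfold nodeGain; fun_prop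

lemma measurable_thr (Kth : ℝ) (n : Fin N) : Measurable (net.thr Kth n) := by
  have := net.measurable_nodeGain
  unfold thr
  fun_prop

/-- The prefactor `√π (2/α) λ̃_n` of tier `n`. -/
noncomputable def tierWeight (n : Fin N) : ℝ := √Real.pi * net.expo * net.lamTilde n

lemma tierWeight_pos (n : Fin N) : 0 < net.tierWeight n :=
  mul_pos (mul_pos (Real.sqrt_pos.mpr Real.pi_pos) net.expo_pos) (net.lamTilde_pos n)

/-- After exchanging mark and position, the area of the annulus is π times β ∫ z^{β-1} over the
admissible z = ‖y‖^α. The π from the area and the 1/√π from the Gaussian density combine to the √π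
of `tierWeight`. -/
lemma lintegral_weak [NeZero N] {Kth : ℝ} (hK : 0 < Kth) (n : Fin N) {t : ℝ} (ht : 0 < t) :
    ∫⁻ y in sublevel net.level t, lognormalDB 0 net.sigmaK {r | (y, r) ∈ net.weakSet Kth n}
        ∂(ENNReal.ofReal (net.lamTilde n) • volume) =
      ENNReal.ofReal (net.tierWeight n) * ∫⁻ u, ENNReal.ofReal (Real.exp (-u ^ 2)) *
        ∫⁻ z in Set.Ioc 0 ((t / net.rate) ^ net.expo⁻¹), stepFun net.expo (net.thr Kth n u) z := by
  have hrate := net.rate_pos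
  have hpow : ((t / net.rate) ^ net.expo⁻¹) ^ net.expo = t / net.rate := by
    rw [← Real.rpow_mul (by positivity), inv_mul_cancel₀ net.expo_pos.ne', Real.rpow_one]
  have hsub := measurableSet_sublevel net.measurable_level t
  have hthr := net.measurable_thr Kth n
  have hpi := Real.pi_pos
  have hslice : ∀ y, MeasurableSet {r | (y, r) ∈ net.weakSet Kth n} := fun y =>
    measurable_prodMk_left (net.measurableSet_weakSet Kth n)
  set V : ℝ → ENNReal := fun u =>
    ENNReal.ofReal (t / net.rate - net.thr Kth n u ^ (-net.expo)) with hV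
  have hVm : Measurable V := by fun_prop
  have hem : Measurable fun u : ℝ => ENNReal.ofReal (Real.exp (-u ^ 2)) := by fun_prop
  have hright : ENNReal.ofReal (net.tierWeight n) * ∫⁻ u, ENNReal.ofReal (Real.exp (-u ^ 2)) *
      ∫⁻ z in Set.Ioc 0 ((t / net.rate) ^ net.expo⁻¹), stepFun net.expo (net.thr Kth n u) z =
      ENNReal.ofReal (√Real.pi * net.lamTilde n) *
        ∫⁻ u, ENNReal.ofReal (Real.exp (-u ^ 2)) * V u := by
    have h1 : net.tierWeight n = √Real.pi * net.lamTilde n * net.expo := by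
      rw [tierWeight]; ring
    rw [h1, ENNReal.ofReal_mul (mul_nonneg (Real.sqrt_nonneg _) (net.lamTilde_pos n).le),
      mul_assoc, ← lintegral_const_mul' _ _ ENNReal.ofReal_ne_top]
    congr 1
    refine lintegral_congr fun u => ?_
    rw [mul_left_comm, lintegral_stepFun net.expo_pos (net.thr_pos hK n u)
      (Real.rpow_nonneg (by positivity) _), hpow]
  have hind : Measurable fun q : EuclideanSpace ℝ (Fin 2) × ℝ =>
      {r | (q.1, r) ∈ net.weakSet Kth n}.indicator (1 : ℝ → ENNReal) (net.nodeGain q.2) := by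
    have hs : MeasurableSet {q : EuclideanSpace ℝ (Fin 2) × ℝ |
        (q.1, net.nodeGain q.2) ∈ net.weakSet Kth n} :=
      (measurable_fst.prodMk (net.measurable_nodeGain.comp measurable_snd))
        (net.measurableSet_weakSet Kth n)
    exact measurable_one.indicator hs
  have hinner : ∀ u, ∫⁻ y in sublevel net.level t,
      {r | (y, r) ∈ net.weakSet Kth n}.indicator (1 : ℝ → ENNReal) (net.nodeGain u) =
      ENNReal.ofReal Real.pi * V u := fun u => by
    rw [hV, ← ENNReal.ofReal_mul hpi.le, ← net.volume_weak hK n u t]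
    have hs : MeasurableSet {y | (y, net.nodeGain u) ∈ net.weakSet Kth n} :=
      measurable_prodMk_right (net.measurableSet_weakSet Kth n)
    have h2 := lintegral_indicator_one (μ := volume.restrict (sublevel net.level t)) hs
    rw [Measure.restrict_apply hs, Set.inter_comm] at h2
    exact h2
  have hleft : ∫⁻ y in sublevel net.level t,
      lognormalDB 0 net.sigmaK {r | (y, r) ∈ net.weakSet Kth n} =
      ENNReal.ofReal (√Real.pi)⁻¹ * (ENNReal.ofReal Real.pi *
        ∫⁻ u, ENNReal.ofReal (Real.exp (-u ^ 2)) * V u) := by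
    simp_rw [fun y => lognormalDB_apply net.sigmaK (hslice y)]
    change ∫⁻ y in sublevel net.level t, ENNReal.ofReal (√Real.pi)⁻¹ *
      ∫⁻ u, ENNReal.ofReal (Real.exp (-u ^ 2)) *
        {r | (y, r) ∈ net.weakSet Kth n}.indicator (1 : ℝ → ENNReal) (net.nodeGain u) = _
    rw [lintegral_const_mul' _ _ ENNReal.ofReal_ne_top, lintegral_lintegral_swap
      ((hem.comp measurable_snd).mul hind).aemeasurable]
    simp_rw [fun u => lintegral_const_mul' (μ := volume.restrict (sublevel net.level t))
      (ENNReal.ofReal (Real.exp (-u ^ 2))) (fun y => {r | (y, r) ∈ net.weakSet Kth n}.indicator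
      (1 : ℝ → ENNReal) (net.nodeGain u)) ENNReal.ofReal_ne_top, hinner, mul_left_comm _
      (ENNReal.ofReal Real.pi)]
    rw [lintegral_const_mul' _ _ ENNReal.ofReal_ne_top, mul_left_comm]
  rw [hright, Measure.restrict_smul, lintegral_smul_measure, hleft, smul_eq_mul, ← mul_assoc,
    ← mul_assoc, ← ENNReal.ofReal_mul (net.lamTilde_pos n).le, ← ENNReal.ofReal_mul
      (mul_nonneg (net.lamTilde_pos n).le (by positivity))]
  congr 2
  have hsq : √Real.pi * √Real.pi = Real.pi := Real.mul_self_sqrt hpi.le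
  have hs0 : √Real.pi ≠ 0 := (Real.sqrt_pos.mpr hpi).ne'
  field_simp
  rw [sq, hsq]

/-- Density of good cells in the variable `z = ‖y‖^α`. -/
noncomputable def goodDensity (Kth z : ℝ) : ENNReal :=
  ∑ n, ENNReal.ofReal (net.tierWeight n) *
    ∫⁻ u, ENNReal.ofReal (Real.exp (-u ^ 2)) * stepFun net.expo (net.thr Kth n u) z

lemma measurable_exp_mul_stepFun (Kth : ℝ) (n : Fin N) : Measurable fun q : ℝ × ℝ =>
    ENNReal.ofReal (Real.exp (-q.1 ^ 2)) * stepFun net.expo (net.thr Kth n q.1) q.2 := by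
  have := net.measurable_thr Kth n
  fun_prop

lemma measurable_lintegral_stepFun (Kth : ℝ) (n : Fin N) : Measurable fun z : ℝ =>
    ∫⁻ u, ENNReal.ofReal (Real.exp (-u ^ 2)) * stepFun net.expo (net.thr Kth n u) z :=
  (net.measurable_exp_mul_stepFun Kth n).lintegral_prod_left'

lemma lintegral_goodDensity [NeZero N] {Kth : ℝ} (hK : 0 < Kth) {t : ℝ} (ht : 0 < t) :
    ∫⁻ z in Set.Ioc 0 ((t / net.rate) ^ net.expo⁻¹), net.goodDensity Kth z =
      ENNReal.ofReal (goodMass (fun n => ENNReal.ofReal (net.lamTilde n) • volume)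
        (lognormalDB 0 net.sigmaK) net.level (net.weakSet Kth) t) := by
  have hfin : ∀ n, ∫⁻ y in sublevel net.level t,
      lognormalDB 0 net.sigmaK {r | (y, r) ∈ net.weakSet Kth n}
        ∂(ENNReal.ofReal (net.lamTilde n) • volume) ≠ ⊤ := fun n =>
    ne_top_of_le_ne_top (net.isLevel.ne_top n t)
      ((lintegral_mono fun _ => prob_le_one).trans_eq (setLIntegral_one _))
  rw [goodMass, ← ENNReal.toReal_sum fun n _ => hfin n,
    ENNReal.ofReal_toReal (ENNReal.sum_ne_top.mpr fun n _ => hfin n)]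
  unfold goodDensity
  rw [lintegral_finsetSum _ fun n _ => (net.measurable_lintegral_stepFun Kth n).const_mul _]
  refine Finset.sum_congr rfl fun n _ => ?_
  rw [net.lintegral_weak hK n ht, lintegral_const_mul' _ _ ENNReal.ofReal_ne_top,
    lintegral_lintegral_swap]
  · simp_rw [fun u => lintegral_const_mul' (μ := volume.restrict (Set.Ioc 0
      ((t / net.rate) ^ net.expo⁻¹))) (ENNReal.ofReal (Real.exp (-u ^ 2)))
      (fun z => stepFun net.expo (net.thr Kth n u) z) ENNReal.ofReal_ne_top]
  · exact ((net.measurable_exp_mul_stepFun Kth n).comp measurable_swap).aemeasurable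

variable {M : ℕ}

lemma measurable_closedVal (Kth : ℝ) (n : Fin M → Fin N) : Measurable fun u : Fin M → ℝ =>
    closedVal net.expo net.rate (fun m => net.thr Kth (n m) (u m)) := by
  unfold closedVal
  refine Measurable.lintegral_prod_right' (f := fun q : (Fin M → ℝ) × ℝ =>
    ENNReal.ofReal (Real.exp (-q.2)) * ordInt M (fun m => stepFun net.expo
      (net.thr Kth (n m) (q.1 m))) ((q.2 / net.rate) ^ net.expo⁻¹)) ?_
  have h1 := measurable_ordInt (A := Fin M → ℝ)
    (F := fun m u z => stepFun net.expo (net.thr Kth (n m) (u m)) z) fun m => by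
      have := net.measurable_thr Kth (n m)
      fun_prop
  exact (by fun_prop : Measurable fun q : (Fin M → ℝ) × ℝ =>
    ENNReal.ofReal (Real.exp (-q.2))).mul (h1.comp (f := fun q : (Fin M → ℝ) × ℝ =>
      (q.1, (q.2 / net.rate) ^ net.expo⁻¹)) (by fun_prop))

lemma ofReal_gaussWeight (u : Fin M → ℝ) :
    ENNReal.ofReal (gaussWeight u) = ∏ m, ENNReal.ofReal (Real.exp (-u m ^ 2)) := by
  rw [gaussWeight_eq_prod, ENNReal.ofReal_prod_of_nonneg fun _ _ => (Real.exp_pos _).le]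

/-- At each w, Q(w)^M/M! is the ordered integral of M copies of `goodDensity`. That density is a sum
over tiers of Gaussian averages, so the two multilinearity lemmas expand it into the left side. -/
lemma sum_tierWeight_mul_lintegral [NeZero N] {Kth : ℝ} (hK : 0 < Kth) :
    ∑ n : Fin M → Fin N, (∏ m, ENNReal.ofReal (net.tierWeight (n m))) *
      ∫⁻ u : Fin M → ℝ, ENNReal.ofReal (gaussWeight u) *
        closedVal net.expo net.rate (fun m => net.thr Kth (n m) (u m)) =
    ENNReal.ofReal (∫ w in Set.Ioi 0, Real.exp (-w) *
      (goodMass (fun n => ENNReal.ofReal (net.lamTilde n) • volume)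
        (lognormalDB 0 net.sigmaK) net.level (net.weakSet Kth) w ^ M / M.factorial)) := by
  set O : (Fin M → Fin N) → (Fin M → ℝ) → ℝ → ENNReal := fun n u w => ordInt M (fun m =>
    stepFun net.expo (net.thr Kth (n m) (u m))) ((w / net.rate) ^ net.expo⁻¹) with hO
  have hOm : ∀ n, Measurable fun q : (Fin M → ℝ) × ℝ => O n q.1 q.2 := fun n => by
    have h1 := measurable_ordInt (A := Fin M → ℝ)
      (F := fun m u z => stepFun net.expo (net.thr Kth (n m) (u m)) z) fun m => by
        have := net.measurable_thr Kth (n m)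
        fun_prop
    exact h1.comp (f := fun q : (Fin M → ℝ) × ℝ =>
      (q.1, (q.2 / net.rate) ^ net.expo⁻¹)) (by fun_prop)
  have hgm : Measurable fun u : Fin M → ℝ => ENNReal.ofReal (gaussWeight u) := by
    unfold gaussWeight
    fun_prop
  have hswap : ∀ n : Fin M → Fin N, ∫⁻ u : Fin M → ℝ, ENNReal.ofReal (gaussWeight u) *
      closedVal net.expo net.rate (fun m => net.thr Kth (n m) (u m)) =
      ∫⁻ w in Set.Ioi 0, ENNReal.ofReal (Real.exp (-w)) *
        ∫⁻ u : Fin M → ℝ, ENNReal.ofReal (gaussWeight u) * O n u w := fun n => by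
    unfold closedVal
    have hm : Measurable fun q : (Fin M → ℝ) × ℝ => ENNReal.ofReal (gaussWeight q.1) *
        (ENNReal.ofReal (Real.exp (-q.2)) * O n q.1 q.2) :=
      (hgm.comp measurable_fst).mul (Measurable.mul (by fun_prop) (hOm n))
    simp_rw [← lintegral_const_mul' _ _ ENNReal.ofReal_ne_top]
    rw [lintegral_lintegral_swap hm.aemeasurable]
    refine lintegral_congr fun w => lintegral_congr fun u => ?_
    rw [mul_left_comm]
  have hsec : ∀ n : Fin M → Fin N, Measurable fun w => ENNReal.ofReal (Real.exp (-w)) *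
        ∫⁻ u : Fin M → ℝ, ENNReal.ofReal (gaussWeight u) * O n u w := fun n =>
    Measurable.mul (by fun_prop) (Measurable.lintegral_prod_left'
      (f := fun q : (Fin M → ℝ) × ℝ => ENNReal.ofReal (gaussWeight q.1) * O n q.1 q.2)
      ((hgm.comp measurable_fst).mul (hOm n)))
  simp_rw [hswap]
  simp_rw [fun n => (lintegral_const_mul (μ := volume.restrict (Set.Ioi 0))
    (∏ m, ENNReal.ofReal (net.tierWeight (n m))) (hsec n)).symm]
  rw [← lintegral_finsetSum _ fun n _ => (hsec n).const_mul _,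
    ofReal_integral_eq_lintegral_ofReal (net.isLevel.integrableOn_exp_mul_goodMass_pow M)]
  · refine setLIntegral_congr_fun measurableSet_Ioi fun w hw => ?_
    have hw0 : 0 < w := hw
    have hmass := (net.isLevel.goodMass_mem (ρ := lognormalDB 0 net.sigmaK)
      (good := net.weakSet Kth) hw0.le).1
    have hdens := net.lintegral_goodDensity hK hw0
    have hdm : Measurable (net.goodDensity Kth) :=
      Finset.measurable_fun_sum _ fun n _ => (net.measurable_lintegral_stepFun Kth n).const_mul _
    have hord := ordInt_const hdm (y := (w / net.rate) ^ net.expo⁻¹)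
      (Real.rpow_nonneg (div_nonneg hw0.le net.rate_pos.le) _)
      (by rw [hdens]; exact ENNReal.ofReal_ne_top) M
    rw [hdens, ← ENNReal.ofReal_pow hmass, ← ENNReal.ofReal_natCast,
      ← ENNReal.ofReal_div_of_pos (by positivity)] at hord
    rw [ENNReal.ofReal_mul (Real.exp_pos _).le, ← hord]
    simp_rw [mul_left_comm _ (ENNReal.ofReal (Real.exp (-w)))]
    rw [← Finset.mul_sum]
    congr 1
    have havg := sum_prod_mul_ordInt (k := M) (fun n => ENNReal.ofReal (net.tierWeight n))
      (f := fun n z => ∫⁻ u, ENNReal.ofReal (Real.exp (-u ^ 2)) *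
        stepFun net.expo (net.thr Kth n u) z) (net.measurable_lintegral_stepFun Kth)
      ((w / net.rate) ^ net.expo⁻¹)
    refine Eq.trans (Finset.sum_congr rfl fun n _ => ?_) havg
    congr 1
    simp_rw [ofReal_gaussWeight]
    exact lintegral_ordInt (w := fun u => ENNReal.ofReal (Real.exp (-u ^ 2))) (by fun_prop)
      (F := fun m u z => stepFun net.expo (net.thr Kth (n m) u) z) (fun m => by
        have := net.measurable_thr Kth (n m)
        fun_prop) _
  · filter_upwards [ae_restrict_mem measurableSet_Ioi] with w hw
    have hmass := (net.isLevel.goodMass_mem (ρ := lognormalDB 0 net.sigmaK)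
      (good := net.weakSet Kth) (le_of_lt hw)).1
    positivity

end Network

end XLOS

namespace XLOS

/-! ### The service probability -/

namespace Network

variable {N M : ℕ} (net : Network N)

lemma tierSum_integral_closedI1 [NeZero N] {Kth : ℝ} (hK : 0 < Kth) (hM : 0 < M) {c : Fin M → ℝ}
    (hc : ∀ m, 0 < c m) :
    net.tierSum M (fun n => ∫ u : Fin M → ℝ, (gaussWeight u : ℂ) * net.closedI1 Kth c n u) =
      ((∫ w in Set.Ioi 0, Real.exp (-w) *
        (goodMass (fun n => ENNReal.ofReal (net.lamTilde n) • volume)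
          (lognormalDB 0 net.sigmaK) net.level (net.weakSet Kth) w ^ M / M.factorial) : ℝ) : ℂ) := by
  set X : (Fin M → Fin N) → ENNReal := fun n => ∫⁻ u : Fin M → ℝ, ENNReal.ofReal (gaussWeight u) *
    closedVal net.expo net.rate (fun m => net.thr Kth (n m) (u m)) with hX
  have hgm : Measurable fun u : Fin M → ℝ => ENNReal.ofReal (gaussWeight u) := by
    unfold gaussWeight
    fun_prop
  have h1 : ∀ n, ∫ u : Fin M → ℝ, (gaussWeight u : ℂ) * net.closedI1 Kth c n u =
      ((X n).toReal : ℂ) := fun n => by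
    have h2 : ∀ u : Fin M → ℝ, (gaussWeight u : ℂ) * net.closedI1 Kth c n u =
        (((ENNReal.ofReal (gaussWeight u) *
          closedVal net.expo net.rate (fun m => net.thr Kth (n m) (u m))).toReal : ℝ) : ℂ) :=
      fun u => by
        rw [net.closedI1_eq hK hM hc, ENNReal.toReal_mul,
          ENNReal.toReal_ofReal (gaussWeight_pos u).le, Complex.ofReal_mul]
    have hm : Measurable fun u : Fin M → ℝ => ENNReal.ofReal (gaussWeight u) *
        closedVal net.expo net.rate (fun m => net.thr Kth (n m) (u m)) :=
      hgm.mul (net.measurable_closedVal Kth n)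
    simp_rw [h2]
    rw [integral_complex_ofReal, integral_toReal hm.aemeasurable
      (Eventually.of_forall fun u => ENNReal.mul_lt_top ENNReal.ofReal_lt_top
        (net.closedVal_lt_top _))]
  have hXtop : ∀ n, (∏ m, ENNReal.ofReal (net.tierWeight (n m))) * X n ≠ ⊤ := fun n => by
    refine ne_top_of_le_ne_top ENNReal.ofReal_ne_top
      ((Finset.single_le_sum (f := fun n : Fin M → Fin N =>
        (∏ m, ENNReal.ofReal (net.tierWeight (n m))) * X n) (fun _ _ => zero_le)
        (Finset.mem_univ n)).trans_eq (net.sum_tierWeight_mul_lintegral (M := M) hK))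
  have hsum := congrArg ENNReal.toReal (net.sum_tierWeight_mul_lintegral (M := M) hK)
  rw [ENNReal.toReal_sum fun n _ => hXtop n, ENNReal.toReal_ofReal
    (setIntegral_nonneg measurableSet_Ioi fun w hw => ?_)] at hsum
  · rw [← hsum, tierSum]
    push_cast
    rw [Finset.mul_sum]
    refine Finset.sum_congr rfl fun n _ => ?_
    rw [h1, ENNReal.toReal_mul, ENNReal.toReal_prod, Complex.ofReal_mul, Complex.ofReal_prod,
      ← mul_assoc]
    congr 1
    have h3 : ∀ m, (ENNReal.ofReal (net.tierWeight (n m))).toReal =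
        2 * √Real.pi / net.alpha * net.lamTilde (n m) := fun m => by
      rw [ENNReal.toReal_ofReal (net.tierWeight_pos _).le, tierWeight, expo]
      ring
    simp_rw [h3]
    push_cast
    rw [Finset.prod_mul_distrib, Finset.prod_const, Finset.card_univ, Fintype.card_fin]
  · have := (net.isLevel.goodMass_mem (ρ := lognormalDB 0 net.sigmaK)
      (good := net.weakSet Kth) (le_of_lt hw)).1
    positivity

variable {Ω : Type*} [MeasurableSpace Ω] {μ : Measure Ω}
  {Y : Fin N → ℕ → Ω → EuclideanSpace ℝ (Fin 2)} {γ : Fin N → ℕ → Ω → ℝ}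

variable {net} in
lemma IsModel.isMarkedPoisson (h : net.IsModel Y γ μ) :
    IsMarkedPoisson Y γ (fun n => ENNReal.ofReal (net.lamTilde n) • volume)
      (lognormalDB 0 net.sigmaK) μ :=
  ⟨h.ppp, h.indep_tiers, h.hasLaw_fading, h.indep_fading, h.indep_position_fading⟩

variable {net} in
-- Needed because 0^{-ν} = 0 by convention, so that a cell at the origin would count as the weakest.
lemma IsModel.ae_ne_zero [IsProbabilityMeasure μ] (h : net.IsModel Y γ μ) :
    ∀ᵐ ω ∂μ, ∀ n i, Y n i ω ≠ 0 := by
  have hz : ∀ n, (ENNReal.ofReal (net.lamTilde n) • volume)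
      ({0} : Set (EuclideanSpace ℝ (Fin 2))) = 0 := fun n => by simp
  have h1 := h.isMarkedPoisson.measure_encard_pointsIn (measurableSet_singleton 0)
    (fun n => by rw [hz]; exact ENNReal.zero_ne_top) 0
  simp only [hz, ENNReal.toReal_zero, Finset.sum_const_zero, neg_zero, Real.exp_zero, pow_zero,
    Nat.factorial_zero, Nat.cast_one, div_one, mul_one] at h1
  have hm : MeasurableSet {ω | (pointsIn Y {0} ω).encard = ((0 : ℕ) : ℕ∞)} :=
    h.isMarkedPoisson.measurable_encard_pointsIn (measurableSet_singleton 0)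
      (measurableSet_singleton _)
  have h2 := probReal_compl_eq_one_sub (μ := μ) hm
  rw [h1, sub_self, measureReal_eq_zero_iff] at h2
  filter_upwards [compl_mem_ae_iff.mpr h2] with ω hω n i hY
  rw [compl_compl, Set.mem_ofPred_eq, Nat.cast_zero, Set.encard_eq_zero] at hω
  have : (n, i) ∈ pointsIn Y {0} ω := hY
  rw [hω] at this
  exact this

variable {net} in
-- Away from the origin r ↦ r^{-ν} is strictly decreasing, so stronger means of smaller level, and
-- failure of XLOS is the event `strongestGood` for weak cells.
theorem IsModel.pXLOS_eq [NeZero N] [IsProbabilityMeasure μ] (h : net.IsModel Y γ μ) (hM : 0 < M)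
    (Kth : ℝ) :
    net.pXLOS M Kth Y γ μ = 1 - ∫ w in Set.Ioi 0, Real.exp (-w) *
        (goodMass (fun n => ENNReal.ofReal (net.lamTilde n) • volume)
          (lognormalDB 0 net.sigmaK) net.level (net.weakSet Kth) w ^ M / M.factorial) := by
  have hgood := net.measurableSet_weakSet Kth
  rw [← h.isMarkedPoisson.measure_strongestGood net.isLevel hgood hM,
    ← probReal_compl_eq_one_sub₀ (h.isMarkedPoisson.nullMeasurableSet_strongestGood
      net.measurable_level hgood M), pXLOS]
  refine measureReal_congr ?_
  filter_upwards [h.ae_ne_zero] with ω hω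
  have hmem : ∀ p : Fin N × ℕ, p ∈ net.monitoringSet M Y ω ↔
      (pointsIn Y (sublevel net.level (net.level (Y p.1 p.2 ω))) ω).encard < M := fun p => by
    have hset : {q : Fin N × ℕ | net.rsrp (Y p.1 p.2 ω) < net.rsrp (Y q.1 q.2 ω)} =
        pointsIn Y (sublevel net.level (net.level (Y p.1 p.2 ω))) ω := by
      ext q
      change net.rsrp (Y p.1 p.2 ω) < net.rsrp (Y q.1 q.2 ω) ↔
        net.level (Y q.1 q.2 ω) < net.level (Y p.1 p.2 ω)
      rw [rsrp, rsrp, Real.rpow_lt_rpow_iff_of_neg (norm_pos_iff.mpr (hω _ _))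
        (norm_pos_iff.mpr (hω _ _)) (neg_lt_zero.mpr net.nu_pos), level, level,
        mul_lt_mul_iff_right₀ net.rate_pos, sq_lt_sq₀ (norm_nonneg _) (norm_nonneg _)]
    rw [← hset]
    rfl
  refine propext ?_
  change (∃ p ∈ net.monitoringSet M Y ω,
    Kth < net.kFactor p.1 (γ p.1 p.2 ω) (Y p.1 p.2 ω)) ↔ ω ∉ strongestGood M net.level
      (net.weakSet Kth) Y γ
  simp only [strongestGood, Set.mem_ofPred_eq, not_forall, hmem, weakSet, not_le, exists_prop]

lemma tierSum_add (J J' : (Fin M → Fin N) → ℂ) :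
    net.tierSum M (fun n => J n + J' n) = net.tierSum M J + net.tierSum M J' := by
  simp only [tierSum, mul_add, Finset.sum_add_distrib]

end Network

end XLOS

theorem mainTheorem1 {N M : ℕ} [NeZero N] [NeZero M] (net : XLOS.Network N)
    {Ω : Type*} [MeasurableSpace Ω] (μ : Measure Ω) [IsProbabilityMeasure μ]
    (Y : Fin N → ℕ → Ω → EuclideanSpace ℝ (Fin 2)) (γ : Fin N → ℕ → Ω → ℝ)
    (hmodel : net.IsModel Y γ μ) (Kth : ℝ) (hKth : 0 < Kth)
    (a c : Fin M → ℝ) (ha : ∀ m, 0 < a m) (hc : ∀ m, 0 < c m) :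
    -- the contours are legitimate and the one-variable H-function converges on them
    (net.closedParams M).Separates c ∧
    (∀ m, XLOS.Network.stepParams.Separates (a m) ∧ ∀ x : ℝ, 0 < x →
      Tendsto (XLOS.Network.stepParams.truncH (a m) x) atTop
        (𝓝 (XLOS.Network.stepParams.H (a m) x))) ∧
    -- closed form of the integral, for all tiers and all abscissas
    (∀ (n : Fin M → Fin N) (u : Fin M → ℝ),
      IntegrableOn (net.I1Integrand Kth a n u) (XLOS.Network.orderedRegion M) ∧
      Integrable ((net.closedParams M).integrand c (net.foxArg Kth n u)) ∧
      net.I1 Kth a n u = net.closedI1 Kth c n u) ∧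
    -- the service probability, before discretization of the Gaussian integral
    (∀ n : Fin M → Fin N, Integrable fun u : Fin M → ℝ =>
      (XLOS.gaussWeight u : ℂ) * net.closedI1 Kth c n u) ∧
    ((net.pXLOS M Kth Y γ μ : ℝ) : ℂ) =
      1 - net.tierSum M (fun n => ∫ u : Fin M → ℝ,
        (XLOS.gaussWeight u : ℂ) * net.closedI1 Kth c n u) ∧
    -- the cubature formula, with its error, for every cubature rule
    (∀ R : XLOS.Cubature M,
      ((net.pXLOS M Kth Y γ μ : ℝ) : ℂ) =
        1 - net.tierSum M (fun n => R.apply (net.closedI1 Kth c n)) +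
          net.tierSum M (fun n => R.error (net.closedI1 Kth c n))) ∧
    -- the cubature formula is exact in the limit of increasing degree
    (∀ R : ℕ → XLOS.Cubature M, (∀ k l, 0 ≤ (R k).w l) →
      (∀ d : ℕ, ∀ᶠ k in atTop, (R k).ExactTo d) →
      Tendsto (fun k => 1 - net.tierSum M (fun n => (R k).apply (net.closedI1 Kth c n)))
        atTop (𝓝 ((net.pXLOS M Kth Y γ μ : ℝ) : ℂ))) := by
  have hM : 0 < M := NeZero.pos M
  have hprob : ((net.pXLOS M Kth Y γ μ : ℝ) : ℂ) =
      1 - net.tierSum M (fun n => ∫ u : Fin M → ℝ,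
        (XLOS.gaussWeight u : ℂ) * net.closedI1 Kth c n u) := by
    rw [net.tierSum_integral_closedI1 hKth hM hc, hmodel.pXLOS_eq hM]
    push_cast
    rfl
  refine ⟨net.closedParams_separates hM hc, fun m =>
    ⟨XLOS.Network.stepParams_separates (ha m), fun x hx =>
      XLOS.Network.tendsto_stepParams_truncH (ha m) hx⟩, fun n u => ?_, fun n => ?_, hprob,
    fun R => ?_, fun R hw hR => ?_⟩
  · obtain ⟨h1, h2⟩ := net.I1_eq_closedI1 hKth ha hc n u
    exact ⟨h1, net.integrable_closedParams_integrand hM hc (net.foxArg_pos hKth n u), h2⟩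
  · obtain ⟨C, hC⟩ := net.exists_norm_closedI1_le hKth hM hc n
    exact XLOS.integrable_gaussWeight_mul (net.continuous_closedI1 hKth hM hc n) hC
  · have hsplit : (fun n => R.apply (net.closedI1 Kth c n)) = fun n =>
        R.error (net.closedI1 Kth c n) +
          ∫ u : Fin M → ℝ, (XLOS.gaussWeight u : ℂ) * net.closedI1 Kth c n u := by
      funext n
      rw [XLOS.Cubature.error, sub_add_cancel]
    rw [hsplit, net.tierSum_add, hprob]
    ring
  · rw [hprob]
    refine tendsto_const_nhds.sub (tendsto_const_nhds.mul (tendsto_finsetSum _ fun n _ =>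
      tendsto_const_nhds.mul ?_))
    obtain ⟨C, hC⟩ := net.exists_norm_closedI1_le hKth hM hc n
    exact XLOS.tendsto_cubature_apply hw hR (net.continuous_closedI1 hKth hM hc n) hC
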